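/- Fix $\lambda\in\left(\frac{2}{3+\sqrt5},\frac12\right)$, let $G=\frac{1+\sqrt5}{2}$ and $\beta=\frac{\log((1-\lambda)/\lambda)}{\log G}$. Let $\mathcal S_0,\mathcal S_1,\mathcal S_2,\ldots=1,2,3,5,\ldots$ be the Fibonacci numbers, $z_k=\frac12-\frac12\lambda^k$, $\hat z_k=\frac12+\frac12\lambda^k$ and $\hat V_{k+1}=[z_k,z_{k+1})\cup(\hat z_{k+1},\hat z_k]$ for $k\ge0$. Let $f=f_\lambda$ be the countably piecewise linear Fibonacci map: the continuous map, symmetric about its turning point $\frac12$, increasing to the left of $\frac12$ and decreasing to the right, with $f(z_0)=f(\hat z_0)=\frac12$, which is linear on both components of $\hat V_k$ with $|f'|=\kappa_k$ there, where $$\kappa_1=\tfrac1{1-\lambda},\quad \kappa_2=\tfrac1\lambda,\quad \kappa_3=\tfrac{1-\lambda}{\lambda},\quad \kappa_4=\tfrac{(1-\lambda)^3}{\lambda},\quad \kappa_k=\lambda^{2(k-5)}(1-\lambda)^{2k-5}\ (k\ge5),$$ and which is extended linearly, with slopes $\pm\kappa_1$, to the left of $z_0$ and to the right of $\hat z_0$.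 Let $\sigma=\mathcal S_k$ on $\hat V_{k+1}$ and let $F=f^\sigma$. (The slopes are those for which $F$ is linear on each component of $\hat V_k$, with $|F'|=\frac1{1-\lambda}$ for $k=1$ and $|F'|=\frac1{\lambda(1-\lambda)}$ for $k\ge2$.) Let $\rho(x)=\min\{n\ge1: F^n(x)\in\hat V_1\}$ be the first return time of $F$ to $\hat V_1$, let $\tau=\sum_{j=0}^{\rho-1}\sigma\circ F^j$, so that $\hat F:=F^\rho=(f^\sigma)^\rho=f^\tau$, and let $\hat\phi=-\sum_{j=0}^{\tau-1}\log|f'\circ f^j|$. Call a Borel probability measure $m$ carried by the domain of $\hat F$ (the points of $\hat V_1$ that return to $\hat V_1$) $\hat\phi$-conformal if $m(\hat F(A))=\int_A e^{-\hat\phi}\,dm$ for every Borel subset $A$ of this domain on which $\hat F$ is injective. Then there is exactly one $\hat F$-invariant Borel probability measure $\mu_{\hat\phi}$ that is equivalent (has the same null sets) to a $\hat\phi$-conformal probability measure, and there are constants $0<C_2<C_1$, depending only on $\lambda$, such that $$C_2\,n^{-\beta}\le\mu_{\hat\phi}(\tau>n)\le C_1\,n^{-\beta}\qquad\text{for all integers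 } n\ge1.$$ -/

import Mathlib

open MeasureTheory Set

noncomputable section

namespace FibonacciMap

/-- The Fibonacci numbers `1, 2, 3, 5, 8, …`, indexed from `0`. -/
def S (k : ℕ) : ℕ := Nat.fib (k + 2)

/-- The distance `l ^ k / 2` of the `k`-th precritical points to the critical point `1 / 2`. -/
def rad (l : ℝ) (k : ℕ) : ℝ := l ^ k / 2

/-- The precritical points `z_k` increasing to `1 / 2`. -/
def z (l : ℝ) (k : ℕ) : ℝ := 1 / 2 - rad l k

/-- The precritical points `ẑ_k` decreasing to `1 / 2`. -/
def zhat (l : ℝ) (k : ℕ) : ℝ := 1 / 2 + rad l k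

/-- `Vhat l k` is the set `V̂_{k+1} = [z_k, z_{k+1}) ∪ (ẑ_{k+1}, ẑ_k]`. -/
def Vhat (l : ℝ) (k : ℕ) : Set ℝ :=
  Ico (z l k) (z l (k + 1)) ∪ Ioc (zhat l (k + 1)) (zhat l k)

/-- The absolute value of the slope of the unimodal map on `Vhat l k`. These values are forced by
linearity of the map on each component of `Vhat l k`, by the Fibonacci combinatorics, and by the
requirement that the `S k`-th iterate has slope `± 1 / (1 - l)` on `Vhat l 0` and
`± 1 / (l * (1 - l))` on `Vhat l k` for `k ≥ 1`. -/
def slope (l : ℝ) : ℕ → ℝ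
  | 0 => 1 / (1 - l)
  | 1 => 1 / l
  | 2 => (1 - l) / l
  | 3 => (1 - l) ^ 3 / l
  | k + 4 => l ^ (2 * k) * (1 - l) ^ (2 * k + 5)

/-- The countably piecewise linear Fibonacci map with parameter `l`: the continuous unimodal map,
symmetric about its turning point `1 / 2`, with value `1 / 2` at `z_0 = 0` and at `ẑ_0 = 1`, with
slope `slope l k` on `[z_k, z_{k+1})` and `- slope l k` on `(ẑ_{k+1}, ẑ_k]`; the two outermost
pieces are extended linearly beyond `z_0` and `ẑ_0`, where the orbit of the critical value enters.
At `x`, the `k`-th term of the series is the increase of the map over the part of `[z_k, z_{k+1}]`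
at distance at least `|x - 1 / 2|` from `1 / 2`. -/
def f (l : ℝ) (x : ℝ) : ℝ :=
  1 / 2 + slope l 0 * (rad l 0 - max |x - 1 / 2| (rad l 1)) +
    ∑' k : ℕ, slope l (k + 1) *
      (rad l (k + 1) - max (min |x - 1 / 2| (rad l (k + 1))) (rad l (k + 2)))

open Classical in
/-- The inducing time: `σ = S_k` on `V̂_{k+1}`, and the dummy value `0` at `1 / 2` and outside
`[z_0, ẑ_0]`. -/
def sigma (l : ℝ) (x : ℝ) : ℕ :=
  if h : ∃ k, x ∈ Vhat l k then S (Nat.find h) else 0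

/-- The induced map `F = f^σ`. -/
def F (l : ℝ) (x : ℝ) : ℝ := (f l)^[sigma l x] x

/-- The first return time to `V̂_1` under the induced map `F` (with the dummy value `0` at points
that never return). -/
def rho (l : ℝ) (x : ℝ) : ℕ := sInf {n : ℕ | 1 ≤ n ∧ (F l)^[n] x ∈ Vhat l 0}

/-- The reinduced map `F^ρ`, the first return map of `F` to `V̂_1`. -/
def Fhat (l : ℝ) (x : ℝ) : ℝ := (F l)^[rho l x] x

/-- The domain of the reinduced map: the points of `V̂_1` that return to `V̂_1` under `F`. -/
def retDomain (l : ℝ) : Set ℝ :=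
  {x | x ∈ Vhat l 0 ∧ ∃ n : ℕ, 1 ≤ n ∧ (F l)^[n] x ∈ Vhat l 0}

/-- The total inducing time `τ = ∑_{j < ρ} σ ∘ F^j`, for which `(f^σ)^ρ = f^τ`. -/
def tau (l : ℝ) (x : ℝ) : ℕ := birkhoffSum (F l) (sigma l) (rho l x) x

/-- The geometric potential `- log |f'|`. -/
def phi (l : ℝ) (x : ℝ) : ℝ := -Real.log |deriv (f l) x|

/-- The reinduced potential `∑_{j < τ} φ ∘ f^j`. -/
def phihat (l : ℝ) (x : ℝ) : ℝ := birkhoffSum (f l) (phi l) (tau l x) x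

/-- A probability measure `m` is conformal for a potential `p` and a map `T` with domain `D` if it
is carried by `D` and `m (T A) = ∫_A exp (-p) dm` for each measurable `A ⊆ D` on which `T` is
injective. -/
structure IsConformal (D : Set ℝ) (T : ℝ → ℝ) (p : ℝ → ℝ) (m : Measure ℝ) : Prop where
  prob : IsProbabilityMeasure m
  carried : m Dᶜ = 0
  conformal : ∀ A : Set ℝ, MeasurableSet A → A ⊆ D → InjOn T A →
    m (T '' A) = ∫⁻ x in A, ENNReal.ofReal (Real.exp (-p x)) ∂m

/-- The reinduced measure: an invariant probability measure of the reinduced map that is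
equivalent to a conformal measure for the reinduced potential. -/
structure IsReinducedMeasure (l : ℝ) (μ : Measure ℝ) : Prop where
  prob : IsProbabilityMeasure μ
  invariant : MeasurePreserving (Fhat l) μ μ
  equivalent : ∃ m : Measure ℝ, IsConformal (retDomain l) (Fhat l) (phihat l) m ∧ μ ≪ m ∧ m ≪ μ

/-- The exponent `β = log ((1 - l) / l) / log G`, where `G` is the golden mean. -/
def beta (l : ℝ) : ℝ := Real.log ((1 - l) / l) / Real.log Real.goldenRatio

end FibonacciMap

end

/-! Write $t=|x-\frac12|$ and let the $k$-th shell be $(\lambda^{k+1}/2,\lambda^k/2)$. Everything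
rests on the fact that $f^{S_k}$ is affine on each component of the $k$-th shell, has slope $\pm
1/$`contr l k`, and maps it to one side of $\frac12$ (`f_iterate_shell`, `birkhoffSum_phi_shell`).
This is proved by induction along the orbit of the stretch beyond $f(z_k)$; the Fibonacci recursion
enters in `tracksCritical_step`.

Hence $F$ descends to a map $T$ of the coordinate $t$, which sends the $k$-th shell affinely onto
$(0,\lambda^{k-1}/2)$, or onto $(0,\frac12)$ if $k=0$. Under Lebesgue measure the shell index is
therefore a random walk: from $k\ge1$ it moves to $k-1+i$ with probability $(1-\lambda)\lambda^i$,
and from $0$ to $i$. For $\theta=(1-\lambda)/\lambda>1$ the function $\theta^k$ is harmonic away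
from $0$. Averages over shells are compared with super- and subsolutions of the walk
(`lintegral_stopped_le`, `le_lintegral_stopped`).

Existence: normalized Lebesgue measure on the domain is conformal because $\hat F$ is locally affine
with slope $\pm e^{-\hat\phi}$ and almost every point returns. Constants are harmonic, so the return
map preserves the Lebesgue distribution of $t$. As $\hat F$ depends only on $t$, the image of
Lebesgue measure under $\hat F$ is invariant; it is shown to have the same null sets.

Uniqueness: a conformal measure is symmetric, and the distribution of $t$ after one step of $F$ is
conformal for $T$ on all shells. For such a measure the deviation of its distribution function from
the linear one is multiplied by $-$`contr l k` at each step, hence vanishes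
(`eq_volume_of_conformal`). So the conformal measure is unique. Its normalized restriction to an
invariant set is again conformal, which gives ergodicity and then uniqueness of the invariant
measure.

Tail: the walk started at $0$ reaches a shell of index at least $K$ before returning with
probability of order $\theta^{-K}$, and one visit there costs at least $S_K\asymp G^K$. This is the
lower bound. For the upper bound, either such a shell is reached, or the time spent in the first $K$
shells is large; its mean is at most of order $\sum_{j<K}S_j\theta^{-j}\asymp(G/\theta)^K$, where
$\theta<G$ is the lower bound on $\lambda$. Markov's inequality with $G^K\asymp n$ makes both terms
of order $\theta^{-K}\asymp n^{-\beta}$, since $G^\beta=\theta$. -/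

noncomputable section

namespace FibonacciMap

open Filter Topology

/-! ## The unimodal map on the shells -/

section

/-- The contraction factor of the inverse branches of `F` on the `k`-th shell. -/
def contr (l : ℝ) (k : ℕ) : ℝ := if k = 0 then 1 - l else l * (1 - l)

/-- The side of `1 / 2` to which `F` maps the `k`-th shell. -/
def side : ℕ → ℝ
  | 0 => 1
  | 1 => -1
  | 2 => -1
  | 3 => 1
  | k + 4 => side k

/-- The values `f (z_k)`. -/
def precrit (l : ℝ) (k : ℕ) : ℝ :=
  1 / 2 + ∑ j ∈ Finset.range k, slope l j * (rad l j - rad l (j + 1))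

variable {l : ℝ}

lemma contr_zero : contr l 0 = 1 - l := by simp [contr]

lemma contr_succ (k : ℕ) : contr l (k + 1) = l * (1 - l) := by simp [contr]

lemma contr_pos (h0 : 0 < l) (h1 : l < 1 / 2) (k : ℕ) : 0 < contr l k := by
  have : 0 < 1 - l := by linarith
  unfold contr; split_ifs <;> positivity

lemma contr_le (h0 : 0 < l) (h1 : l < 1 / 2) (k : ℕ) : contr l k ≤ 1 - l := by
  unfold contr; split_ifs <;> nlinarith

lemma side_eq (k : ℕ) : side k = 1 ∨ side k = -1 := by
  induction k using side.induct <;> simp_all [side]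

lemma abs_side (k : ℕ) : |side k| = 1 := by
  rcases side_eq k with h | h <;> simp [h]

lemma slope_pos (h0 : 0 < l) (h1 : l < 1 / 2) (k : ℕ) : 0 < slope l k := by
  have : 0 < 1 - l := by linarith
  match k with
  | 0 | 1 | 2 | 3 | k + 4 => simp only [slope]; positivity

lemma rad_zero : rad l 0 = 1 / 2 := by simp [rad]

lemma rad_one : rad l 1 = l / 2 := by simp [rad]

lemma rad_succ (k : ℕ) : rad l (k + 1) = l * rad l k := by simp [rad, pow_succ]; ring

lemma rad_pos (h0 : 0 < l) (k : ℕ) : 0 < rad l k := by unfold rad; positivity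

lemma rad_strictAnti (h0 : 0 < l) (h1 : l < 1 / 2) : StrictAnti (rad l) :=
  strictAnti_nat_of_succ_lt fun k => by
    have := rad_pos h0 k
    rw [rad_succ]; nlinarith

lemma rad_le_half (h0 : 0 < l) (h1 : l < 1 / 2) (k : ℕ) : rad l k ≤ 1 / 2 := by
  rw [← rad_zero (l := l)]; exact (rad_strictAnti h0 h1).antitone (Nat.zero_le k)

/-! ### Value and slope of `f` on a single shell. -/

lemma f_of_outer (h0 : 0 < l) (h1 : l < 1 / 2) {x : ℝ} (hx : l / 2 ≤ |x - 1 / 2|) :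
    f l x = 1 / 2 + (1 / 2 - |x - 1 / 2|) / (1 - l) := by
  have key : ∀ k : ℕ, slope l (k + 1) *
      (rad l (k + 1) - max (min |x - 1 / 2| (rad l (k + 1))) (rad l (k + 2))) = 0 := by
    intro k
    have h2 : rad l (k + 1) ≤ |x - 1 / 2| := by
      refine le_trans ?_ hx
      rw [← rad_one]; exact (rad_strictAnti h0 h1).antitone (by omega)
    rw [min_eq_right h2, max_eq_left ((rad_strictAnti h0 h1).antitone (by omega))]
    simp
  have hs : slope l 0 = 1 / (1 - l) := rfl
  unfold f
  simp only [key, tsum_zero, rad_zero, rad_one, max_eq_left hx, hs]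
  ring

lemma f_of_shell (h0 : 0 < l) (h1 : l < 1 / 2) (k : ℕ) {x : ℝ}
    (hx : rad l (k + 1) ≤ |x - 1 / 2|) (hx' : |x - 1 / 2| ≤ rad l k) :
    f l x = precrit l k + slope l k * (rad l k - |x - 1 / 2|) := by
  have anti := (rad_strictAnti h0 h1).antitone
  cases k with
  | zero =>
    rw [f_of_outer h0 h1 (by simpa [rad_one] using hx)]
    simp [precrit, slope, rad_zero]; ring
  | succ k =>
    have hr : |x - 1 / 2| ≤ rad l 1 := hx'.trans (anti (by omega))
    unfold f
    rw [tsum_eq_sum (s := Finset.range (k + 1)), Finset.sum_range_succ, min_eq_left hx',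
      max_eq_left hx, max_eq_right hr, precrit, Finset.sum_range_succ']
    · have : ∀ j ∈ Finset.range k, slope l (j + 1) *
          (rad l (j + 1) - max (min |x - 1 / 2| (rad l (j + 1))) (rad l (j + 2))) =
          slope l (j + 1) * (rad l (j + 1) - rad l (j + 1 + 1)) := by
        intro j hj
        have hj := Finset.mem_range.1 hj
        have h2 : |x - 1 / 2| ≤ rad l (j + 2) := hx'.trans (anti (by omega))
        rw [min_eq_left (h2.trans (anti (by omega))), max_eq_right h2]
      rw [Finset.sum_congr rfl this]
      simp only [zero_add]; ring
    · intro j hj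
      have hj : k + 1 ≤ j := by simpa using hj
      have h2 : rad l (j + 1) ≤ |x - 1 / 2| := le_trans (anti (by omega)) hx
      rw [min_eq_right h2, max_eq_left (anti (by omega))]
      simp

lemma abs_deriv_of_eventuallyEq {g : ℝ → ℝ} {x a b : ℝ} (hx : x ≠ 1 / 2)
    (h : ∀ᶠ y in nhds x, g y = a + b * |y - 1 / 2|) : |deriv g x| = |b| := by
  rcases lt_or_gt_of_ne hx with hx | hx
  · have : g =ᶠ[nhds x] fun y => a + b * (1 / 2 - y) := by
      filter_upwards [h, Iio_mem_nhds hx] with y hy hy'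
      rw [hy, abs_of_neg (by simpa using hy')]; ring
    rw [this.deriv_eq]
    simp
  · have : g =ᶠ[nhds x] fun y => a + b * (y - 1 / 2) := by
      filter_upwards [h, Ioi_mem_nhds hx] with y hy hy'
      rw [hy, abs_of_pos (by simpa using hy')]
    rw [this.deriv_eq]
    simp

lemma phi_of_outer (h0 : 0 < l) (h1 : l < 1 / 2) {x : ℝ} (hx : l / 2 < |x - 1 / 2|) :
    phi l x = Real.log (1 - l) := by
  have hne : x ≠ 1 / 2 := by rintro rfl; simp at hx; linarith
  have hc : Filter.Tendsto (fun y : ℝ => |y - 1 / 2|) (nhds x) (nhds |x - 1 / 2|) := by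
    exact Continuous.tendsto (by fun_prop) x
  rw [phi, abs_deriv_of_eventuallyEq (a := 1 / 2 + 1 / 2 / (1 - l)) (b := -(1 - l)⁻¹) hne,
    abs_neg, abs_inv, Real.log_inv, Real.log_abs, neg_neg]
  filter_upwards [hc.eventually (Ioi_mem_nhds hx)] with y hy
  rw [f_of_outer h0 h1 (le_of_lt hy)]; ring

/-- The strict inequalities keep `x` away from the break points, where the slope may jump and
`deriv` would then take its default value. -/
lemma phi_of_shell (h0 : 0 < l) (h1 : l < 1 / 2) (k : ℕ) {x : ℝ}
    (hx : rad l (k + 1) < |x - 1 / 2|) (hx' : |x - 1 / 2| < rad l k) :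
    phi l x = - Real.log (slope l k) := by
  have hne : x ≠ 1 / 2 := by
    rintro rfl; simp at hx; linarith [rad_pos h0 (k + 1)]
  have hc : Filter.Tendsto (fun y : ℝ => |y - 1 / 2|) (nhds x) (nhds |x - 1 / 2|) := by
    exact Continuous.tendsto (by fun_prop) x
  rw [phi, abs_deriv_of_eventuallyEq (a := precrit l k + slope l k * rad l k)
    (b := -slope l k) hne, abs_neg, Real.log_abs]
  filter_upwards [hc.eventually (Ioo_mem_nhds hx hx')] with y hy
  rw [f_of_shell h0 h1 k hy.1.le hy.2.le]; ring

/-! ### Affine iterates along the Fibonacci combinatorics. -/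

/-- The orbit of `x` reaches `x'` in `n` steps of `f`, and, under the side condition `p`, the
derivative along the orbit has absolute value `c⁻¹`. -/
def Tracks (l : ℝ) (n : ℕ) (x x' c : ℝ) (p : Prop) : Prop :=
  (f l)^[n] x = x' ∧ (p → birkhoffSum (f l) (phi l) n x = Real.log c)

lemma Tracks.trans {n m : ℕ} {x x' x'' c c' : ℝ} {p q : Prop} (h : Tracks l n x x' c p)
    (h' : Tracks l m x' x'' c' q) (hpq : p → q) (hc : 0 < c) (hc' : 0 < c') :
    Tracks l (n + m) x x'' (c * c') p := by
  refine ⟨by rw [Nat.add_comm, Function.iterate_add_apply, h.1, h'.1], fun hp => ?_⟩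
  rw [birkhoffSum_add, h.2 hp, h.1, h'.2 (hpq hp), Real.log_mul hc.ne' hc'.ne']

lemma Tracks.mono {n : ℕ} {x x' c : ℝ} {p q : Prop} (h : Tracks l n x x' c p) (hpq : q → p) :
    Tracks l n x x' c q :=
  ⟨h.1, fun hq => h.2 (hpq hq)⟩

lemma Tracks.congr {n m : ℕ} {x x' x'' c c' : ℝ} {p : Prop} (h : Tracks l n x x' c p)
    (hn : n = m) (hx : x' = x'') (hc : c = c') : Tracks l m x x'' c' p := by
  subst hn hx hc; exact h

lemma tracks_outer (h0 : 0 < l) (h1 : l < 1 / 2) {x : ℝ} (hx : l / 2 ≤ |x - 1 / 2|) :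
    Tracks l 1 x (1 / 2 + (1 / 2 - |x - 1 / 2|) / (1 - l)) (1 - l) (l / 2 < |x - 1 / 2|) :=
  ⟨by simpa using f_of_outer h0 h1 hx, fun h => by simpa using phi_of_outer h0 h1 h⟩

/-- `f ^ (S_k - 1)` is affine on an interval starting at `f (z_k)`, for `k ≥ 1`. -/
def TracksCritical (l : ℝ) (k : ℕ) : Prop :=
  ∀ u, 0 ≤ u → u < l ^ k →
    Tracks l (S (k + 1) - 1) (precrit l (k + 1) + l * (1 - l) * slope l (k + 1) * u)
      (1 / 2 + side (k + 1) * u) (l * (1 - l) * slope l (k + 1)) (0 < u)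

/-- `f ^ S_k` is affine on both components of the `k`-th shell. -/
def TracksShell (l : ℝ) (k : ℕ) : Prop :=
  ∀ x, rad l (k + 1) ≤ |x - 1 / 2| → |x - 1 / 2| ≤ rad l k →
    Tracks l (S k) x (1 / 2 + side k * ((rad l k - |x - 1 / 2|) / contr l k)) (contr l k)
      (rad l (k + 1) < |x - 1 / 2| ∧ |x - 1 / 2| < rad l k)

lemma tracksShell_zero (h0 : 0 < l) (h1 : l < 1 / 2) : TracksShell l 0 := by
  intro x hx hx'
  have h := tracks_outer h0 h1 (x := x) (by simpa [rad_one] using hx)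
  refine ⟨?_, fun hp => ?_⟩
  · rw [show S 0 = 1 from rfl, h.1, rad_zero, contr_zero, side]; ring
  · rw [show S 0 = 1 from rfl, h.2 (by simpa [rad_one] using hp.1), contr_zero]

/-- One step of `f` folds the shell onto the stretch starting at $f(z_{k+1})$, and `TracksCritical l
k` follows that stretch for the remaining $S_{k+1}-1$ steps. The shell only needs $u\le l^k/2$; the
other half of the interval in `TracksCritical` is used in the induction on `k`. -/
lemma tracksShell_succ (h0 : 0 < l) (h1 : l < 1 / 2) {k : ℕ} (h : TracksCritical l k) :
    TracksShell l (k + 1) := by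
  intro x hx hx'
  have h2 : 0 < 1 - l := by linarith
  have hs := slope_pos h0 h1 (k + 1)
  have hpos : 0 < l ^ k := by positivity
  have e1 : rad l (k + 1) = l * (l ^ k / 2) := by rw [rad_succ]; rfl
  have e2 : rad l (k + 2) = l * (l * (l ^ k / 2)) := by rw [rad_succ, e1]
  have hu : (rad l (k + 1) - |x - 1 / 2|) / (l * (1 - l)) < l ^ k := by
    rw [div_lt_iff₀ (by positivity)]
    have : 0 < l * (1 - l) * l ^ k := by positivity
    nlinarith
  have hA := h _ (div_nonneg (sub_nonneg.2 hx') (by positivity)) hu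
  have hone : Tracks l 1 x (f l x) (slope l (k + 1))⁻¹
      (rad l (k + 2) < |x - 1 / 2| ∧ |x - 1 / 2| < rad l (k + 1)) :=
    ⟨rfl, fun hp => by
      rw [birkhoffSum_one, phi_of_shell h0 h1 (k + 1) hp.1 hp.2, Real.log_inv]⟩
  have hf : f l x = precrit l (k + 1) + l * (1 - l) * slope l (k + 1) *
      ((rad l (k + 1) - |x - 1 / 2|) / (l * (1 - l))) := by
    rw [f_of_shell h0 h1 (k + 1) hx hx']; field_simp
  rw [← hf] at hA
  refine (hone.trans hA (fun hp => div_pos (sub_pos.2 hp.2) (by positivity)) (by positivity)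
    (by positivity)).congr ?_ ?_ ?_
  · have : 0 < S (k + 1) := Nat.fib_pos.2 (by omega)
    omega
  · rw [contr_succ]
  · rw [contr_succ]; field_simp

lemma precrit_succ (k : ℕ) :
    precrit l (k + 1) = precrit l k + slope l k * (rad l k - rad l (k + 1)) := by
  rw [precrit, Finset.sum_range_succ, precrit]; ring

lemma precrit_one (h1 : l < 1 / 2) : precrit l 1 = 1 := by
  have : 1 - l ≠ 0 := by linarith
  rw [precrit_succ]; simp [precrit, slope, rad]; field_simp; ring

/-- The first three stages are done by hand: here the orbit passes outside or near the ends of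
$[0,1]$, where only the outermost slopes $\pm1/(1-l)$ act. -/
lemma tracksCritical_zero (h0 : 0 < l) (h1 : l < 1 / 2) : TracksCritical l 0 := by
  intro u hu hu'
  have h2 : 0 < 1 - l := by linarith
  have e : precrit l (0 + 1) + l * (1 - l) * slope l (0 + 1) * u = 1 + (1 - l) * u := by
    rw [precrit_one h1]; simp only [slope]; field_simp
  have ha : |1 + (1 - l) * u - 1 / 2| = 1 / 2 + (1 - l) * u := by
    rw [abs_of_nonneg (by nlinarith)]; ring
  have h := tracks_outer h0 h1 (x := 1 + (1 - l) * u) (by rw [ha]; nlinarith)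
  rw [e]
  refine ⟨?_, fun hp => ?_⟩
  · rw [show S (0 + 1) - 1 = 1 from rfl, h.1, ha]; simp only [side]; field_simp; ring
  · rw [show S (0 + 1) - 1 = 1 from rfl, h.2 (by rw [ha]; nlinarith)]
    congr 1; simp only [slope]; field_simp

lemma precrit_two (h0 : 0 < l) (h1 : l < 1 / 2) : precrit l 2 = 1 + (1 - l) / 2 := by
  rw [precrit_succ, precrit_one h1]; simp [slope, rad]; field_simp

lemma tracksCritical_one (h0 : 0 < l) (h1 : l < 1 / 2) : TracksCritical l 1 := by
  intro u hu hu'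
  have h2 : 0 < 1 - l := by linarith
  have h3 : 0 ≤ (1 - l) * u := by positivity
  have h4 : 0 ≤ (1 - l) ^ 2 * u := by positivity
  set x := precrit l (1 + 1) + l * (1 - l) * slope l (1 + 1) * u with hx
  have e : x = 1 + (1 - l) / 2 + (1 - l) ^ 2 * u := by
    rw [hx, precrit_two h0 h1]; simp only [slope]; field_simp
  have ha : |x - 1 / 2| = 1 / 2 + (1 - l) / 2 + (1 - l) ^ 2 * u := by
    rw [e, abs_of_nonneg (by linarith)]; ring
  have hb := tracks_outer h0 h1 (x := x) (by rw [ha]; linarith)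
  have e' : 1 / 2 + (1 / 2 - |x - 1 / 2|) / (1 - l) = - ((1 - l) * u) := by
    rw [ha]; field_simp; ring
  rw [e'] at hb
  have ha' : |-((1 - l) * u) - 1 / 2| = 1 / 2 + (1 - l) * u := by
    rw [abs_of_nonpos (by linarith)]; ring
  have hc := tracks_outer h0 h1 (x := -((1 - l) * u)) (by rw [ha']; linarith)
  refine ⟨?_, fun hp => ?_⟩
  · rw [show S (1 + 1) - 1 = 1 + 1 from rfl, (hb.trans hc (fun _ => by rw [ha']; linarith)
      h2 h2).1, ha']
    simp only [side]; field_simp; ring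
  · rw [show S (1 + 1) - 1 = 1 + 1 from rfl, (hb.trans hc (fun _ => by rw [ha']; linarith)
      h2 h2).2 (by rw [ha]; linarith)]
    congr 1; simp only [slope]; field_simp

lemma tracksCritical_two (h0 : 0 < l) (h1 : l < 1 / 2) : TracksCritical l 2 := by
  intro u hu hu'
  have h2 : 0 < 1 - l := by linarith
  have h3 : 0 ≤ (1 - l) * u := by positivity
  have h4 : 0 ≤ (1 - l) ^ 2 * u := by positivity
  have h5 : (1 - l) * u ≤ l ^ 2 := by nlinarith
  have h6 : (1 - l) ^ 2 * u ≤ l ^ 2 := by nlinarith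
  have h7 : l ^ 2 < l / 2 := by nlinarith
  set x := precrit l (2 + 1) + l * (1 - l) * slope l (2 + 1) * u with hx
  -- $f(z_3)$ is the point $u=l/2$ of the previous stage; two iterates of that stage bring the
  -- stretch to the inner end of the outermost shell, left of $\frac12$, and two more steps remain.
  have e : x = precrit l (1 + 1) + l * (1 - l) * slope l (1 + 1) * (l / 2 + (1 - l) ^ 2 * u) := by
    rw [hx, precrit_succ]; simp [slope, rad]; field_simp; ring
  have ha := tracksCritical_one h0 h1 (l / 2 + (1 - l) ^ 2 * u) (by linarith)
    (by rw [pow_one]; linarith)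
  rw [← e] at ha
  simp only [side, show 1 + 1 = 2 from rfl] at ha
  have r1 : |1 / 2 + -1 * (l / 2 + (1 - l) ^ 2 * u) - 1 / 2| = l / 2 + (1 - l) ^ 2 * u := by
    rw [abs_of_nonpos (by linarith)]; ring
  have hb := tracks_outer h0 h1 (x := 1 / 2 + -1 * (l / 2 + (1 - l) ^ 2 * u))
    (by rw [r1]; linarith)
  have e' : 1 / 2 + (1 / 2 - |1 / 2 + -1 * (l / 2 + (1 - l) ^ 2 * u) - 1 / 2|) / (1 - l) =
      1 - (1 - l) * u := by
    rw [r1]; field_simp; ring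
  rw [e'] at hb
  have r2 : |1 - (1 - l) * u - 1 / 2| = 1 / 2 - (1 - l) * u := by
    rw [abs_of_nonneg (by linarith)]; ring
  have hc := tracks_outer h0 h1 (x := 1 - (1 - l) * u) (by rw [r2]; linarith)
  have hs : 0 < l * (1 - l) * slope l 2 := by have := slope_pos h0 h1 2; positivity
  have hpos : 0 < u → 0 < (1 - l) ^ 2 * u := fun _ => by positivity
  refine ((ha.mono (q := 0 < u) fun _ => by linarith).trans (hb.trans hc
    (fun _ => by rw [r2]; linarith) h2 h2) (fun h => by rw [r1]; linarith [hpos h]) hs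
    (by positivity)).congr rfl ?_ ?_
  · rw [r2]; simp only [side]; field_simp; ring
  · simp only [slope]; field_simp

/-- The point $f(z_{j+4})$ is the point $u=$ `rad l (j + 2)` of the stretch starting at
$f(z_{j+3})$. The previous stage thus brings the new stretch just outside the inner end of shell
$j+1$. Then $f^{S_{j+1}}$ moves it just inside the outer end of shell $j$, and $f^{S_j}$ opens it up
from $\frac12$. Following the stretch beyond $u=$ `rad l (j + 2)` is the reason why `TracksCritical`
covers an interval twice as long as a shell requires. -/
lemma tracksCritical_step (h0 : 0 < l) (h1 : l < 1 / 2) {j : ℕ}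
    (hA : TracksCritical l (j + 2)) (hB : TracksShell l (j + 1)) (hC : TracksShell l j) :
    TracksCritical l (j + 3) := by
  intro u hu hu'
  have h2 : 0 < 1 - l := by linarith
  have hd := contr_pos h0 h1 j
  have hd' := contr_le h0 h1 j
  have hs := slope_pos h0 h1 (j + 3)
  have hp : 0 < l ^ j := by positivity
  have e1 : l ^ (j + 3) = l ^ 3 * l ^ j := by ring
  have e2 : l ^ (j + 2) = l ^ 2 * l ^ j := by ring
  have r0 : rad l j = l ^ j / 2 := rfl
  have r1 : rad l (j + 1) = l * l ^ j / 2 := by rw [rad_succ, r0]; ring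
  have r2 : rad l (j + 2) = l ^ 2 * l ^ j / 2 := by rw [rad_succ, r1]; ring
  have r3 : rad l (j + 3) = l ^ 3 * l ^ j / 2 := by rw [rad_succ, r2]; ring
  have r4 : rad l (j + 4) = l ^ 4 * l ^ j / 2 := by rw [rad_succ, r3]; ring
  have hl3 : l ^ 2 ≤ 1 / 4 := by nlinarith
  have hdu : contr l j * u ≤ l ^ 3 * l ^ j := by rw [← e1]; nlinarith
  have hdu0 : 0 ≤ contr l j * u := by positivity
  have hdu1 : 0 ≤ l * (1 - l) * (contr l j * u) := by positivity
  have hq : l * (1 - l) ≤ 1 / 4 := by nlinarith [sq_nonneg (l - 1 / 2)]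
  have hdu2 : l * (1 - l) * (contr l j * u) ≤ 1 / 4 * (l ^ 3 * l ^ j) :=
    mul_le_mul hq hdu hdu0 (by norm_num)
  -- The recursion that determines the slopes: the contractions of the two extra shells, $j+1$ and
  -- $j$, are absorbed into the slope of the next piece.
  have hslope : l * (1 - l) * slope l (j + 4) =
      l * (1 - l) * slope l (j + 3) * (l * (1 - l) * contr l j) := by
    cases j with
    | zero => simp only [slope, contr_zero]; field_simp; ring
    | succ j => simp only [slope, contr_succ]; ring
  set u₁ := l ^ 2 * l ^ j / 2 + l * (1 - l) * (contr l j * u) with hu₁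
  have hpos : ∀ i : ℕ, 0 < l ^ i * l ^ j := fun i => by positivity
  have hl2 : l ^ 3 * l ^ j ≤ 1 / 2 * (l ^ 2 * l ^ j) := by nlinarith [hpos 2]
  have hl1 : l ^ 2 * l ^ j ≤ 1 / 2 * (l * l ^ j) := by nlinarith [hpos 1]
  have hl0 : l * l ^ j ≤ 1 / 2 * l ^ j := by nlinarith
  have ha := hA u₁ (by rw [hu₁]; linarith [hpos 2]) (by rw [hu₁, e2]; linarith [hpos 2])
  have e : precrit l (j + 4) + l * (1 - l) * slope l (j + 4) * u =
      precrit l (j + 2 + 1) + l * (1 - l) * slope l (j + 2 + 1) * u₁ := by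
    rw [hslope, precrit_succ, hu₁, r3, r4]; ring
  rw [← e] at ha
  have a1 : |1 / 2 + side (j + 2 + 1) * u₁ - 1 / 2| = u₁ := by
    rw [add_sub_cancel_left, abs_mul, abs_side, one_mul, abs_of_nonneg]
    rw [hu₁]; linarith [hpos 2]
  have hb := hB (1 / 2 + side (j + 2 + 1) * u₁) (by rw [a1, hu₁, r2]; linarith)
    (by rw [a1, hu₁, r1]; linarith [hpos 2])
  set u₂ := (rad l (j + 1) - u₁) / (l * (1 - l)) with hu₂
  have hu₂' : u₂ = l ^ j / 2 - contr l j * u := by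
    rw [hu₂, hu₁, r1]; field_simp; ring
  rw [a1, contr_succ, ← hu₂] at hb
  have a2 : |1 / 2 + side (j + 1) * u₂ - 1 / 2| = u₂ := by
    rw [add_sub_cancel_left, abs_mul, abs_side, one_mul, abs_of_nonneg]
    rw [hu₂']; linarith
  have hc := hC (1 / 2 + side (j + 1) * u₂) (by rw [a2, hu₂', r1]; linarith [hpos 2])
    (by rw [a2, hu₂', r0]; linarith)
  rw [a2] at hc
  have hdup : 0 < u → 0 < contr l j * u := fun _ => by positivity
  have hdup' : 0 < u → 0 < l * (1 - l) * (contr l j * u) := fun _ => by positivity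
  refine ((ha.mono (q := 0 < u) fun _ => by rw [hu₁]; linarith [hpos 2]).trans
    ((hb.mono (q := 0 < u) fun h => ⟨by rw [r2, hu₁]; linarith [hdup' h],
      by rw [hu₁, r1]; linarith [hpos 2, hpos 1]⟩).trans hc
    (fun h => ⟨by rw [hu₂', r1]; linarith [hpos 2], by rw [hu₂', r0]; linarith [hdup h]⟩)
    (by positivity) hd) id (by positivity) (by positivity)).congr ?_ ?_ ?_
  -- The time is $(S_{j+3}-1)+S_{j+1}+S_j=S_{j+4}-1$.
  · have e1 : S (j + 3 + 1) = S (j + 3) + S (j + 2) := by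
      simp only [S, Nat.fib_add_two]; ring
    have e2 : S (j + 2) = S (j + 1) + S j := by
      simp only [S, Nat.fib_add_two]; ring
    have e3 : S (j + 2 + 1) = S (j + 3) := rfl
    have : 0 < S (j + 3) := Nat.fib_pos.2 (by omega)
    omega
  · rw [hu₂', r0, show j + 3 + 1 = j + 4 from rfl, side]; field_simp; ring
  · rw [hslope]

lemma tracks_all (h0 : 0 < l) (h1 : l < 1 / 2) :
    ∀ k, TracksShell l k ∧ TracksShell l (k + 1) ∧ TracksCritical l k ∧ TracksCritical l (k + 1) ∧
      TracksCritical l (k + 2)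
  | 0 => ⟨tracksShell_zero h0 h1, tracksShell_succ h0 h1 (tracksCritical_zero h0 h1),
      tracksCritical_zero h0 h1, tracksCritical_one h0 h1, tracksCritical_two h0 h1⟩
  | k + 1 => by
    obtain ⟨hB, hB', hA, hA', hA''⟩ := tracks_all h0 h1 k
    exact ⟨hB', tracksShell_succ h0 h1 hA', hA', hA'', tracksCritical_step h0 h1 hA'' hB' hB⟩

/-- `f ^ S_k` maps both components of the (closed) `k`-th shell affinely to the same side. -/
lemma f_iterate_shell (h0 : 0 < l) (h1 : l < 1 / 2) (k : ℕ) {x : ℝ}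
    (hx : rad l (k + 1) ≤ |x - 1 / 2|) (hx' : |x - 1 / 2| ≤ rad l k) :
    (f l)^[S k] x = 1 / 2 + side k * ((rad l k - |x - 1 / 2|) / contr l k) :=
  ((tracks_all h0 h1 k).1 x hx hx').1

lemma birkhoffSum_phi_shell (h0 : 0 < l) (h1 : l < 1 / 2) (k : ℕ) {x : ℝ}
    (hx : rad l (k + 1) < |x - 1 / 2|) (hx' : |x - 1 / 2| < rad l k) :
    birkhoffSum (f l) (phi l) (S k) x = Real.log (contr l k) :=
  ((tracks_all h0 h1 k).1 x hx.le hx'.le).2 ⟨hx, hx'⟩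

end

/-! ## The induced map in the coordinate `|x - 1 / 2|` -/

section

/-- The induced map in the coordinate `|x - 1 / 2|`. -/
def T (l t : ℝ) : ℝ := |F l (1 / 2 + t) - 1 / 2|

/-- The index `k` for which `rad l (k + 1) < t ≤ rad l k`, for `0 < t ≤ 1 / 2`. -/
def idx (l t : ℝ) : ℕ := sInf {k | rad l (k + 1) < t}

/-- The set `V̂_1` in the coordinate `|x - 1 / 2|`. -/
def base (l : ℝ) : Set ℝ := Ioc (rad l 1) (rad l 0)

/-- The interior of `V̂_{k+1}` in the coordinate `|x - 1 / 2|`. -/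
def shell (l : ℝ) (k : ℕ) : Set ℝ := Ioo (rad l (k + 1)) (rad l k)

/-- The return time to `V̂_1` in the coordinate `|x - 1 / 2|`. -/
def ret (l t : ℝ) : ℕ := sInf {n | 1 ≤ n ∧ (T l)^[n] t ∈ base l}

/-- The domain of the reinduced map in the coordinate `|x - 1 / 2|`. -/
def retBase (l : ℝ) : Set ℝ := {t | t ∈ base l ∧ ∃ n, 1 ≤ n ∧ (T l)^[n] t ∈ base l}

/-- The absolute value of the derivative of `T^n`. -/
def jac (l : ℝ) (n : ℕ) (t : ℝ) : ℝ :=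
  ∏ i ∈ Finset.range n, (contr l (idx l ((T l)^[i] t)))⁻¹

variable {l : ℝ}

lemma mem_Vhat (h0 : 0 < l) (k : ℕ) {x : ℝ} :
    x ∈ Vhat l k ↔ |x - 1 / 2| ∈ Ioc (rad l (k + 1)) (rad l k) := by
  have := rad_pos h0 (k + 1)
  simp only [Vhat, z, zhat, mem_union, mem_Ico, mem_Ioc]
  rcases abs_cases (x - 1 / 2) with ⟨h, h'⟩ | ⟨h, h'⟩ <;> rw [h]
  · constructor
    · rintro (⟨h1, h2⟩ | ⟨h1, h2⟩) <;> constructor <;> linarith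
    · rintro ⟨h1, h2⟩; right; constructor <;> linarith
  · constructor
    · rintro (⟨h1, h2⟩ | ⟨h1, h2⟩) <;> constructor <;> linarith
    · rintro ⟨h1, h2⟩; left; constructor <;> linarith

lemma mem_Vhat_zero (h0 : 0 < l) {x : ℝ} : x ∈ Vhat l 0 ↔ |x - 1 / 2| ∈ base l :=
  mem_Vhat h0 0

lemma Ioc_rad_unique (h0 : 0 < l) (h1 : l < 1 / 2) {k j : ℕ} {t : ℝ}
    (hk : t ∈ Ioc (rad l (k + 1)) (rad l k)) (hj : t ∈ Ioc (rad l (j + 1)) (rad l j)) :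
    k = j := by
  by_contra hne
  have anti := (rad_strictAnti h0 h1).antitone
  rcases lt_or_gt_of_ne hne with h | h
  · linarith [hk.1, hj.2, anti (show k + 1 ≤ j from h)]
  · linarith [hj.1, hk.2, anti (show j + 1 ≤ k from h)]

lemma exists_mem_Ioc (h0 : 0 < l) (h1 : l < 1 / 2) {t : ℝ} (ht : 0 < t) (ht' : t ≤ 1 / 2) :
    ∃ k, t ∈ Ioc (rad l (k + 1)) (rad l k) := by
  have hlim : ∃ k, rad l (k + 1) < t := by
    obtain ⟨n, hn⟩ := exists_pow_lt_of_lt_one ht (show l < 1 by linarith)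
    refine ⟨n, ?_⟩
    have := rad_pos h0 n
    have e : rad l n = l ^ n / 2 := rfl
    rw [rad_succ]; nlinarith
  classical
  refine ⟨Nat.find hlim, Nat.find_spec hlim, ?_⟩
  rcases Nat.eq_zero_or_pos (Nat.find hlim) with h | h
  · rw [h, rad_zero]; exact ht'
  · have := Nat.find_min hlim (Nat.sub_lt h one_pos)
    rw [show Nat.find hlim - 1 + 1 = Nat.find hlim from Nat.sub_add_cancel h] at this
    exact not_lt.1 this

lemma idx_of_mem (h0 : 0 < l) (h1 : l < 1 / 2) {k : ℕ} {t : ℝ}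
    (h : t ∈ Ioc (rad l (k + 1)) (rad l k)) : idx l t = k := by
  refine le_antisymm (Nat.sInf_le h.1) (le_csInf ⟨k, h.1⟩ fun j hj => ?_)
  by_contra hlt
  have := (rad_strictAnti h0 h1).antitone (show j + 1 ≤ k by omega)
  have hj : rad l (j + 1) < t := hj
  linarith [h.2]

lemma sigma_of_mem (h0 : 0 < l) (h1 : l < 1 / 2) {k : ℕ} {x : ℝ}
    (h : |x - 1 / 2| ∈ Ioc (rad l (k + 1)) (rad l k)) : sigma l x = S k := by
  classical
  have hex : ∃ k, x ∈ Vhat l k := ⟨k, (mem_Vhat h0 k).2 h⟩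
  have := Ioc_rad_unique h0 h1 ((mem_Vhat h0 _).1 (Nat.find_spec hex)) h
  unfold sigma
  rw [dif_pos hex]
  convert congrArg S this

lemma F_of_mem (h0 : 0 < l) (h1 : l < 1 / 2) {k : ℕ} {x : ℝ}
    (h : |x - 1 / 2| ∈ Ioc (rad l (k + 1)) (rad l k)) :
    F l x = 1 / 2 + side k * ((rad l k - |x - 1 / 2|) / contr l k) := by
  rw [F, sigma_of_mem h0 h1 h, f_iterate_shell h0 h1 k h.1.le h.2]

/-- The dummy value $\sigma=0$ makes these points fixed by `F`, so an orbit that lands on one of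
them never returns and contributes nothing. -/
lemma F_of_trap (h0 : 0 < l) (h1 : l < 1 / 2) {x : ℝ}
    (h : |x - 1 / 2| = 0 ∨ 1 / 2 < |x - 1 / 2|) : F l x = x := by
  have : ¬ ∃ k, x ∈ Vhat l k := by
    rintro ⟨k, hk⟩
    rw [mem_Vhat h0] at hk
    have h2 := rad_le_half h0 h1 k
    have h3 := rad_pos h0 (k + 1)
    rcases h with h | h <;> linarith [hk.1, hk.2]
  simp [F, sigma, this]

lemma trap_or_mem (h0 : 0 < l) (h1 : l < 1 / 2) {t : ℝ} (ht : 0 ≤ t) :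
    (t = 0 ∨ 1 / 2 < t) ∨ ∃ k, t ∈ Ioc (rad l (k + 1)) (rad l k) := by
  by_cases h : t = 0 ∨ 1 / 2 < t
  · exact .inl h
  · push Not at h
    exact .inr (exists_mem_Ioc h0 h1 (lt_of_le_of_ne ht (Ne.symm h.1)) h.2)

lemma T_of_mem (h0 : 0 < l) (h1 : l < 1 / 2) {k : ℕ} {t : ℝ}
    (h : t ∈ Ioc (rad l (k + 1)) (rad l k)) : T l t = (rad l k - t) / contr l k := by
  have ht : |1 / 2 + t - 1 / 2| = t := by
    rw [add_sub_cancel_left, abs_of_pos ((rad_pos h0 _).trans h.1)]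
  rw [T, F_of_mem h0 h1 (k := k) (by rwa [ht]), ht, add_sub_cancel_left, abs_mul, abs_side, one_mul,
    abs_of_nonneg (div_nonneg (sub_nonneg.2 h.2) (contr_pos h0 h1 k).le)]

lemma T_of_trap (h0 : 0 < l) (h1 : l < 1 / 2) {t : ℝ} (h : t = 0 ∨ 1 / 2 < t) : T l t = t := by
  have h2 : 0 ≤ t := by rcases h with h | h <;> linarith
  have ht : |1 / 2 + t - 1 / 2| = t := by rw [add_sub_cancel_left, abs_of_nonneg h2]
  rw [T, F_of_trap h0 h1 (by rwa [ht]), ht]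

/-- The semiconjugacy from `F` to `T`: both components of a shell have the same image under `F`. It
reduces return times and return sets to the coordinate $|x-\frac12|$. -/
lemma dist_F (h0 : 0 < l) (h1 : l < 1 / 2) (x : ℝ) : |F l x - 1 / 2| = T l |x - 1 / 2| := by
  rcases trap_or_mem h0 h1 (abs_nonneg (x - 1 / 2)) with h | ⟨k, h⟩
  · rw [T_of_trap h0 h1 h, F_of_trap h0 h1 h]
  · rw [T_of_mem h0 h1 h, F_of_mem h0 h1 h, add_sub_cancel_left, abs_mul, abs_side, one_mul,
      abs_of_nonneg (div_nonneg (sub_nonneg.2 h.2) (contr_pos h0 h1 k).le)]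

lemma dist_F_iterate (h0 : 0 < l) (h1 : l < 1 / 2) (n : ℕ) (x : ℝ) :
    |(F l)^[n] x - 1 / 2| = (T l)^[n] |x - 1 / 2| := by
  induction n with
  | zero => rfl
  | succ n ih => rw [Function.iterate_succ_apply', Function.iterate_succ_apply', dist_F h0 h1, ih]

lemma T_nonneg (t : ℝ) : 0 ≤ T l t := abs_nonneg _

lemma T_iterate_nonneg (n : ℕ) {t : ℝ} (ht : 0 ≤ t) : 0 ≤ (T l)^[n] t := by
  cases n with
  | zero => exact ht
  | succ n => rw [Function.iterate_succ_apply']; exact T_nonneg _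

lemma mem_retDomain (h0 : 0 < l) (h1 : l < 1 / 2) {x : ℝ} :
    x ∈ retDomain l ↔ |x - 1 / 2| ∈ retBase l := by
  simp only [retDomain, retBase, mem_ofPred_eq, mem_Vhat_zero h0, dist_F_iterate h0 h1]

lemma rho_eq (h0 : 0 < l) (h1 : l < 1 / 2) (x : ℝ) : rho l x = ret l |x - 1 / 2| := by
  simp only [rho, ret, mem_Vhat_zero h0, dist_F_iterate h0 h1]

lemma ret_spec {t : ℝ} (ht : t ∈ retBase l) : 1 ≤ ret l t ∧ (T l)^[ret l t] t ∈ base l :=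
  Nat.sInf_mem (s := {n | 1 ≤ n ∧ (T l)^[n] t ∈ base l}) ht.2

lemma not_mem_base_of_lt_ret {t : ℝ} {i : ℕ} (hi : 1 ≤ i) (hi' : i < ret l t) :
    (T l)^[i] t ∉ base l :=
  fun h => Nat.notMem_of_lt_sInf (s := {n | 1 ≤ n ∧ (T l)^[n] t ∈ base l}) hi' ⟨hi, h⟩

lemma ret_eq {t : ℝ} {n : ℕ} (hn : 1 ≤ n) (h : (T l)^[n] t ∈ base l)
    (h' : ∀ i, 1 ≤ i → i < n → (T l)^[i] t ∉ base l) : ret l t = n := by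
  refine le_antisymm (Nat.sInf_le ⟨hn, h⟩) (le_csInf ⟨n, hn, h⟩ fun j hj => ?_)
  by_contra hlt
  exact h' j hj.1 (not_le.1 hlt) hj.2

lemma mem_base_of_zero (h : (0 : ℝ) ∈ base l) (h0 : 0 < l) : False := by
  have := rad_pos h0 1
  linarith [h.1]

lemma T_iterate_trap (h0 : 0 < l) (h1 : l < 1 / 2) {t : ℝ} (h : t = 0 ∨ 1 / 2 < t) (n : ℕ) :
    (T l)^[n] t = t :=
  Function.iterate_fixed (T_of_trap h0 h1 h) n

lemma mem_Ioc_of_shell {k : ℕ} {t : ℝ} (h : t ∈ shell l k) : t ∈ Ioc (rad l (k + 1)) (rad l k) :=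
  ⟨h.1, h.2.le⟩

lemma shell_zero_subset : shell l 0 ⊆ base l := fun _ h => mem_Ioc_of_shell h

lemma eq_zero_of_mem_base (h0 : 0 < l) (h1 : l < 1 / 2) {k : ℕ} {t : ℝ} (h : t ∈ shell l k)
    (hb : t ∈ base l) : k = 0 :=
  Ioc_rad_unique h0 h1 (mem_Ioc_of_shell h) hb

/-- Points that enter `V̂_1` at a positive time lie in the interior of a shell. -/
lemma exists_mem_shell (h0 : 0 < l) (h1 : l < 1 / 2) {t : ℝ} (ht : 0 ≤ t) {n : ℕ} (hn : 1 ≤ n)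
    (h : (T l)^[n] t ∈ base l) : ∃ k, t ∈ shell l k := by
  rcases trap_or_mem h0 h1 ht with h' | ⟨k, hk⟩
  · rw [T_iterate_trap h0 h1 h'] at h
    rcases h' with rfl | h'
    · exact (mem_base_of_zero h h0).elim
    · rw [base, rad_zero] at h; linarith [h.2]
  -- The outer end of a shell is sent to the fixed point $0$ of `T`, from which there is no return.
  · refine ⟨k, hk.1, lt_of_le_of_ne hk.2 fun e => ?_⟩
    obtain ⟨m, rfl⟩ : ∃ m, n = m + 1 := ⟨n - 1, by omega⟩
    rw [Function.iterate_succ_apply, T_of_mem h0 h1 hk, e, sub_self, zero_div,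
      T_iterate_trap h0 h1 (.inl rfl)] at h
    exact mem_base_of_zero h h0

/-- The truncated subtraction `k - 1` covers the shell `0` as well, which is mapped to all of
$(0,\frac12)$. -/
lemma T_mem_of_shell (h0 : 0 < l) (h1 : l < 1 / 2) {k : ℕ} {t : ℝ} (h : t ∈ shell l k) :
    T l t ∈ Ioo 0 (rad l (k - 1)) := by
  have hc := contr_pos h0 h1 k
  rw [T_of_mem h0 h1 (mem_Ioc_of_shell h)]
  refine ⟨div_pos (sub_pos.2 h.2) hc, ?_⟩
  rw [div_lt_iff₀ hc]
  have h3 := h.1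
  cases k with
  | zero =>
    simp only [contr_zero, Nat.zero_sub, rad_zero]
    rw [zero_add, rad_one] at h3
    linarith
  | succ k =>
    rw [contr_succ, Nat.add_sub_cancel]
    rw [rad_succ, rad_succ] at h3
    rw [rad_succ]; linarith

/-- The orbit of a point of the domain of the return map stays in the interiors of the shells. -/
lemma orbit_mem_shell (h0 : 0 < l) (h1 : l < 1 / 2) {t : ℝ} (ht : t ∈ retBase l) {i : ℕ}
    (hi : i < ret l t) : ∃ k, (T l)^[i] t ∈ shell l k := by
  have h2 : 0 ≤ t := ((rad_pos h0 1).trans ht.1.1).le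
  refine exists_mem_shell h0 h1 (T_iterate_nonneg i h2) (n := ret l t - i) (by omega) ?_
  rw [← Function.iterate_add_apply, Nat.sub_add_cancel hi.le]
  exact (ret_spec ht).2

lemma That_mem_shell (h0 : 0 < l) (h1 : l < 1 / 2) {t : ℝ} (ht : t ∈ retBase l) :
    (T l)^[ret l t] t ∈ shell l 0 := by
  obtain ⟨h2, h3⟩ := ret_spec ht
  obtain ⟨k, hk⟩ := orbit_mem_shell h0 h1 ht (show ret l t - 1 < ret l t by omega)
  have := (T_mem_of_shell h0 h1 hk).2
  rw [← Function.iterate_succ_apply' (T l), Nat.succ_eq_add_one, Nat.sub_add_cancel h2] at this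
  refine ⟨h3.1, this.trans_le ?_⟩
  rw [rad_zero]; exact rad_le_half h0 h1 _

lemma jac_succ (n : ℕ) (t : ℝ) :
    jac l (n + 1) t = jac l n t * (contr l (idx l ((T l)^[n] t)))⁻¹ :=
  Finset.prod_range_succ _ _

/-- Along an orbit in the interiors of the shells, `T^n` is locally affine. -/
lemma T_iterate_local (h0 : 0 < l) (h1 : l < 1 / 2) {t : ℝ} (n : ℕ)
    (h : ∀ i < n, ∃ k, (T l)^[i] t ∈ shell l k) :
    ∃ a, |a| = jac l n t ∧ ∀ᶠ u in 𝓝 t,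
      (∀ i < n, ∃ k, (T l)^[i] t ∈ shell l k ∧ (T l)^[i] u ∈ shell l k) ∧
      (T l)^[n] u = (T l)^[n] t + a * (u - t) := by
  induction n with
  | zero => exact ⟨1, by simp [jac], by simp⟩
  | succ n ih =>
    obtain ⟨a, ha, hloc⟩ := ih fun i hi => h i (by omega)
    obtain ⟨k, hk⟩ := h n (by omega)
    refine ⟨-(a * (contr l k)⁻¹), ?_, ?_⟩
    · rw [jac_succ, idx_of_mem h0 h1 (mem_Ioc_of_shell hk), abs_neg, abs_mul, ha, abs_inv,
        abs_of_pos (contr_pos h0 h1 k)]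
    · have hc : Tendsto (fun u => (T l)^[n] t + a * (u - t)) (𝓝 t)
          (𝓝 ((T l)^[n] t + a * (t - t))) := Continuous.tendsto (by fun_prop) t
      rw [sub_self, mul_zero, add_zero] at hc
      filter_upwards [hloc, hc.eventually (Ioo_mem_nhds hk.1 hk.2)] with u hu hu'
      rw [← hu.2] at hu'
      refine ⟨fun i hi => ?_, ?_⟩
      · rcases Nat.lt_succ_iff_lt_or_eq.1 hi with hi | rfl
        · exact hu.1 i hi
        · exact ⟨k, hk, hu'⟩
      · rw [Function.iterate_succ_apply', Function.iterate_succ_apply',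
          T_of_mem h0 h1 (mem_Ioc_of_shell hu'), T_of_mem h0 h1 (mem_Ioc_of_shell hk), hu.2]
        have := (contr_pos h0 h1 k).ne'
        field_simp; ring

lemma jac_congr (h0 : 0 < l) (h1 : l < 1 / 2) {t u : ℝ} {n : ℕ}
    (h : ∀ i < n, ∃ k, (T l)^[i] t ∈ shell l k ∧ (T l)^[i] u ∈ shell l k) :
    jac l n u = jac l n t := by
  refine Finset.prod_congr rfl fun i hi => ?_
  obtain ⟨k, hk, hk'⟩ := h i (Finset.mem_range.1 hi)
  rw [idx_of_mem h0 h1 (mem_Ioc_of_shell hk), idx_of_mem h0 h1 (mem_Ioc_of_shell hk')]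

/-- The return map is locally affine on its domain. -/
lemma retBase_local (h0 : 0 < l) (h1 : l < 1 / 2) {t : ℝ} (ht : t ∈ retBase l) :
    ∃ a, |a| = jac l (ret l t) t ∧ ∀ᶠ u in 𝓝 t, u ∈ retBase l ∧ ret l u = ret l t ∧
      (∀ i < ret l t, ∃ k, (T l)^[i] t ∈ shell l k ∧ (T l)^[i] u ∈ shell l k) ∧
      (T l)^[ret l t] u = (T l)^[ret l t] t + a * (u - t) := by
  obtain ⟨a, ha, hloc⟩ := T_iterate_local h0 h1 (ret l t) fun i hi => orbit_mem_shell h0 h1 ht hi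
  refine ⟨a, ha, ?_⟩
  obtain ⟨hn, -⟩ := ret_spec ht
  have hm := That_mem_shell h0 h1 ht
  have hc : Tendsto (fun u => (T l)^[ret l t] t + a * (u - t)) (𝓝 t)
      (𝓝 ((T l)^[ret l t] t + a * (t - t))) := Continuous.tendsto (by fun_prop) t
  rw [sub_self, mul_zero, add_zero] at hc
  filter_upwards [hloc, hc.eventually (Ioo_mem_nhds hm.1 hm.2)] with u hu hu'
  rw [← hu.2] at hu'
  have hub : (T l)^[ret l t] u ∈ base l := shell_zero_subset hu'
  refine ⟨⟨?_, _, hn, hub⟩, ret_eq hn hub fun i hi hi' hb => ?_, hu⟩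
  · obtain ⟨k, hk, hk'⟩ := hu.1 0 (by omega)
    obtain rfl := eq_zero_of_mem_base h0 h1 hk ht.1
    exact shell_zero_subset hk'
  · obtain ⟨k, hk, hk'⟩ := hu.1 i hi'
    obtain rfl := eq_zero_of_mem_base h0 h1 hk' hb
    exact not_mem_base_of_lt_ret hi hi' (shell_zero_subset hk)

lemma f_iterate_birkhoffSum (n : ℕ) (x : ℝ) :
    (f l)^[birkhoffSum (F l) (sigma l) n x] x = (F l)^[n] x := by
  induction n with
  | zero => simp
  | succ n ih =>
    rw [birkhoffSum_succ, Nat.add_comm, Function.iterate_add_apply, ih,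
      Function.iterate_succ_apply', ← F]

/-- The chain rule for inducing: the `f`-orbit up to the total induced time splits into blocks of
length $\sigma$, one for each step of `F`. -/
lemma birkhoffSum_phi_induced (n : ℕ) (x : ℝ) :
    birkhoffSum (f l) (phi l) (birkhoffSum (F l) (sigma l) n x) x =
      birkhoffSum (F l) (fun y => birkhoffSum (f l) (phi l) (sigma l y) y) n x := by
  induction n with
  | zero => simp
  | succ n ih => rw [birkhoffSum_succ, birkhoffSum_add, ih, f_iterate_birkhoffSum,
      birkhoffSum_succ]

lemma tau_eq (h0 : 0 < l) (h1 : l < 1 / 2) {x : ℝ} (hx : x ∈ retDomain l) :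
    tau l x = ∑ i ∈ Finset.range (ret l |x - 1 / 2|), S (idx l ((T l)^[i] |x - 1 / 2|)) := by
  rw [tau, rho_eq h0 h1, birkhoffSum]
  refine Finset.sum_congr rfl fun i hi => ?_
  obtain ⟨k, hk⟩ := orbit_mem_shell h0 h1 ((mem_retDomain h0 h1).1 hx) (Finset.mem_range.1 hi)
  have hk := mem_Ioc_of_shell hk
  rw [idx_of_mem h0 h1 hk, sigma_of_mem h0 h1 (by rwa [dist_F_iterate h0 h1])]

lemma exp_neg_phihat (h0 : 0 < l) (h1 : l < 1 / 2) {x : ℝ} (hx : x ∈ retDomain l) :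
    Real.exp (-phihat l x) = jac l (ret l |x - 1 / 2|) |x - 1 / 2| := by
  rw [phihat, tau, birkhoffSum_phi_induced, rho_eq h0 h1, birkhoffSum, jac,
    ← Finset.sum_neg_distrib, Real.exp_sum]
  refine Finset.prod_congr rfl fun i hi => ?_
  obtain ⟨k, hk⟩ := orbit_mem_shell h0 h1 ((mem_retDomain h0 h1).1 hx) (Finset.mem_range.1 hi)
  have hk' := mem_Ioc_of_shell hk
  rw [idx_of_mem h0 h1 hk', sigma_of_mem h0 h1 (by rwa [dist_F_iterate h0 h1]),
    birkhoffSum_phi_shell h0 h1 k (by rw [dist_F_iterate h0 h1]; exact hk.1)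
      (by rw [dist_F_iterate h0 h1]; exact hk.2), Real.exp_neg, Real.exp_log (contr_pos h0 h1 k)]

lemma dist_Fhat (h0 : 0 < l) (h1 : l < 1 / 2) (x : ℝ) :
    |Fhat l x - 1 / 2| = (T l)^[ret l |x - 1 / 2|] |x - 1 / 2| := by
  rw [Fhat, dist_F_iterate h0 h1, rho_eq h0 h1]

/-- On its domain the return map only depends on the distance to `1 / 2`. -/
lemma F_iterate_eq (h0 : 0 < l) (h1 : l < 1 / 2) {x : ℝ} {n k : ℕ}
    (hk : (T l)^[n] |x - 1 / 2| ∈ shell l k) :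
    (F l)^[n + 1] x = 1 / 2 + side k * (T l)^[n + 1] |x - 1 / 2| := by
  have hk := mem_Ioc_of_shell hk
  rw [Function.iterate_succ_apply', F_of_mem h0 h1 (by rwa [dist_F_iterate h0 h1]),
    Function.iterate_succ_apply', T_of_mem h0 h1 hk, dist_F_iterate h0 h1]

/-- The return time depends only on the distance, and so does the shell from which the last step
starts. That shell fixes the side of the image. -/
lemma Fhat_congr (h0 : 0 < l) (h1 : l < 1 / 2) {x y : ℝ} (hx : x ∈ retDomain l)
    (h : |x - 1 / 2| = |y - 1 / 2|) : Fhat l x = Fhat l y := by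
  rw [mem_retDomain h0 h1] at hx
  obtain ⟨hn, -⟩ := ret_spec hx
  obtain ⟨m, hm⟩ : ∃ m, ret l |x - 1 / 2| = m + 1 := ⟨ret l |x - 1 / 2| - 1, by omega⟩
  obtain ⟨k, hk⟩ := orbit_mem_shell h0 h1 hx (show m < _ by omega)
  rw [Fhat, Fhat, rho_eq h0 h1, rho_eq h0 h1, ← h, hm, F_iterate_eq h0 h1 hk,
    F_iterate_eq h0 h1 (h ▸ hk), h]

lemma abs_sub_half_local {x : ℝ} (hx : x ≠ 1 / 2) :
    ∃ e : ℝ, |e| = 1 ∧ ∀ᶠ y in 𝓝 x, |y - 1 / 2| = |x - 1 / 2| + e * (y - x) := by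
  rcases lt_or_gt_of_ne hx with hx | hx
  · refine ⟨-1, by simp, ?_⟩
    filter_upwards [Iio_mem_nhds hx] with y hy
    have : y < 1 / 2 := hy
    rw [abs_of_neg (by linarith), abs_of_neg (by linarith)]; ring
  · refine ⟨1, by simp, ?_⟩
    filter_upwards [Ioi_mem_nhds hx] with y hy
    have : 1 / 2 < y := hy
    rw [abs_of_pos (by linarith), abs_of_pos (by linarith)]; ring

lemma ne_half_of_mem_retDomain (h0 : 0 < l) {x : ℝ} (hx : x ∈ retDomain l) :
    x ≠ 1 / 2 := by
  rintro rfl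
  have := ((mem_Vhat_zero h0).1 hx.1).1
  simp at this
  linarith [rad_pos h0 1]

/-- The reinduced map is locally affine on its domain, with slope `± exp (-φ̂)`. -/
lemma Fhat_local (h0 : 0 < l) (h1 : l < 1 / 2) {x : ℝ} (hx : x ∈ retDomain l) :
    ∃ a b, |a| = Real.exp (-phihat l x) ∧ |b| = Real.exp (-phihat l x) ∧
      ∀ᶠ y in 𝓝 x, y ∈ retDomain l ∧ phihat l y = phihat l x ∧
        Fhat l y = Fhat l x + a * (y - x) ∧
        |Fhat l y - 1 / 2| = |Fhat l x - 1 / 2| + b * (y - x) := by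
  have hx' := (mem_retDomain h0 h1).1 hx
  obtain ⟨a, ha, hloc⟩ := retBase_local h0 h1 hx'
  obtain ⟨e, he, habs⟩ := abs_sub_half_local (ne_half_of_mem_retDomain h0 hx)
  obtain ⟨hn, -⟩ := ret_spec hx'
  obtain ⟨m, hm⟩ : ∃ m, ret l |x - 1 / 2| = m + 1 := ⟨ret l |x - 1 / 2| - 1, by omega⟩
  obtain ⟨k, hk⟩ := orbit_mem_shell h0 h1 hx' (show m < _ by omega)
  have hc : Tendsto (fun y : ℝ => |y - 1 / 2|) (𝓝 x) (𝓝 |x - 1 / 2|) :=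
    Continuous.tendsto (by fun_prop) x
  refine ⟨side k * a * e, a * e, ?_, ?_, ?_⟩
  · rw [abs_mul, abs_mul, he, ha, abs_side, exp_neg_phihat h0 h1 hx]; ring
  · rw [abs_mul, he, ha, exp_neg_phihat h0 h1 hx]; ring
  · filter_upwards [hc.eventually hloc, habs] with y ⟨hy1, hy2, hy3, hy4⟩ hy5
    have hyD := (mem_retDomain h0 h1).2 hy1
    have hk' : (T l)^[m] |y - 1 / 2| ∈ shell l k := by
      obtain ⟨k', hk', hk''⟩ := hy3 m (by omega)
      rwa [← Ioc_rad_unique h0 h1 (mem_Ioc_of_shell hk') (mem_Ioc_of_shell hk)]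
    refine ⟨hyD, ?_, ?_, ?_⟩
    · rw [← neg_inj, ← Real.exp_eq_exp, exp_neg_phihat h0 h1 hx, exp_neg_phihat h0 h1 hyD, hy2,
        jac_congr h0 h1 hy3]
    · rw [Fhat, Fhat, rho_eq h0 h1, rho_eq h0 h1, hy2, hm, F_iterate_eq h0 h1 hk,
        F_iterate_eq h0 h1 hk', ← hm, hy4, hy5]
      ring
    · rw [dist_Fhat h0 h1, dist_Fhat h0 h1, hy2, hy4, hy5]; ring

/-! ### Measurability -/

lemma measurableSet_Vhat (k : ℕ) : MeasurableSet (Vhat l k) :=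
  measurableSet_Ico.union measurableSet_Ioc

lemma measurable_F (h0 : 0 < l) (h1 : l < 1 / 2) : Measurable (F l) := by
  intro B hB
  have : F l ⁻¹' B = (⋃ k, Vhat l k ∩
      (fun x => 1 / 2 + side k * ((rad l k - |x - 1 / 2|) / contr l k)) ⁻¹' B) ∪
      ((⋃ k, Vhat l k)ᶜ ∩ B) := by
    ext x
    simp only [mem_preimage, mem_union, mem_iUnion, mem_inter_iff, mem_compl_iff]
    rcases trap_or_mem h0 h1 (abs_nonneg (x - 1 / 2)) with h | ⟨k, hk⟩
    · have hno : ¬ ∃ k, x ∈ Vhat l k := by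
        rintro ⟨k, hk⟩
        have hk := (mem_Vhat h0 k).1 hk
        rcases h with h | h
        · linarith [hk.1, rad_pos h0 (k + 1)]
        · linarith [hk.2, rad_le_half h0 h1 k]
      rw [F_of_trap h0 h1 h]
      constructor
      · exact fun hx => .inr ⟨hno, hx⟩
      · rintro (⟨k, hk, -⟩ | h)
        exacts [(hno ⟨k, hk⟩).elim, h.2]
    · have hk' := (mem_Vhat h0 k).2 hk
      rw [F_of_mem h0 h1 hk]
      constructor
      · exact fun hx => .inl ⟨k, hk', hx⟩
      · rintro (⟨j, hj, hx⟩ | h)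
        · rwa [Ioc_rad_unique h0 h1 hk ((mem_Vhat h0 j).1 hj)]
        · exact (h.1 ⟨k, hk'⟩).elim
  rw [this]
  have hm := measurableSet_Vhat (l := l)
  refine (MeasurableSet.iUnion fun k => (hm k).inter ?_).union
    ((MeasurableSet.iUnion hm).compl.inter hB)
  exact Measurable.comp (g := fun x => x) measurable_id (by fun_prop) hB

lemma measurable_T (h0 : 0 < l) (h1 : l < 1 / 2) : Measurable (T l) := by
  have := measurable_F h0 h1
  exact ((this.comp (measurable_const.add measurable_id)).sub_const _).norm

lemma measurable_sInf_nat {p : ℕ → ℝ → Prop} (hp : ∀ n, MeasurableSet {x | p n x}) :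
    Measurable fun x => sInf {n | p n x} := by
  refine measurable_to_countable' fun n => ?_
  -- The second set is present only for `m = 0`, since the infimum of the empty set is `0`.
  have h2 : ∀ m, {x | sInf {n | p n x} = m} = ({x | p m x} ∩ ⋂ j ∈ Finset.range m, {x | p j x}ᶜ) ∪
      (if m = 0 then ⋂ j, {x | p j x}ᶜ else ∅) := by
    intro m
    ext x
    simp only [mem_ofPred_eq, mem_union, mem_inter_iff, mem_iInter, mem_compl_iff,
      Finset.mem_range]
    rcases Set.eq_empty_or_nonempty {n | p n x} with he | he
    · have hno : ∀ j, ¬ p j x := fun j hj => by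
        have : j ∈ {n | p n x} := hj
        rw [he] at this; exact this
      rw [he, Nat.sInf_empty]
      rcases Nat.eq_zero_or_pos m with rfl | hm
      · simp [hno]
      · simp [hno, hm.ne, hm.ne']
    · have hsp := Nat.sInf_mem he
      constructor
      · rintro rfl
        exact .inl ⟨hsp, fun j hj => Nat.notMem_of_lt_sInf hj⟩
      · rintro (⟨h3, h4⟩ | h3)
        · refine le_antisymm (Nat.sInf_le h3) (not_lt.1 fun hlt => h4 _ hlt hsp)
        · split_ifs at h3
          · simp only [mem_iInter, mem_compl_iff, mem_ofPred_eq] at h3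
            exact (h3 _ hsp).elim
          · exact h3.elim
  change MeasurableSet {x | sInf {n | p n x} = n}
  rw [h2]
  refine ((hp n).inter (Finset.measurableSet_biInter _ fun j _ => (hp j).compl)).union ?_
  split_ifs
  · exact MeasurableSet.iInter fun j => (hp j).compl
  · exact MeasurableSet.empty

lemma measurableSet_base : MeasurableSet (base l) := measurableSet_Ioc

lemma measurable_ret (h0 : 0 < l) (h1 : l < 1 / 2) : Measurable (ret l) := by
  refine measurable_sInf_nat (p := fun n t => 1 ≤ n ∧ (T l)^[n] t ∈ base l) fun n => ?_
  exact (MeasurableSet.const _).inter ((measurable_T h0 h1).iterate n measurableSet_base)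

lemma measurable_apply_nat {β : Type*} [MeasurableSpace β] {g : ℕ → ℝ → β}
    (hg : ∀ n, Measurable (g n)) {N : ℝ → ℕ}
    (hN : Measurable N) : Measurable fun x => g (N x) x :=
  (measurable_from_prod_countable_right (f := fun p : ℕ × ℝ => g p.1 p.2) hg).comp
    (hN.prodMk measurable_id)

lemma measurable_Fhat (h0 : 0 < l) (h1 : l < 1 / 2) : Measurable (Fhat l) := by
  refine measurable_apply_nat (g := fun n => (F l)^[n]) (fun n => (measurable_F h0 h1).iterate n) ?_
  have : rho l = fun x => ret l |x - 1 / 2| := funext fun x => rho_eq h0 h1 x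
  rw [this]
  exact (measurable_ret h0 h1).comp (by fun_prop)

lemma measurableSet_retBase (h0 : 0 < l) (h1 : l < 1 / 2) : MeasurableSet (retBase l) := by
  have : retBase l = base l ∩ ⋃ n : ℕ, {t | 1 ≤ n ∧ (T l)^[n] t ∈ base l} := by
    ext t; simp [retBase]
  rw [this]
  refine measurableSet_base.inter (MeasurableSet.iUnion fun n => ?_)
  exact (MeasurableSet.const _).inter ((measurable_T h0 h1).iterate n measurableSet_base)

lemma measurableSet_retDomain (h0 : 0 < l) (h1 : l < 1 / 2) : MeasurableSet (retDomain l) := by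
  have : retDomain l = (fun x => |x - 1 / 2|) ⁻¹' retBase l := by
    ext x; exact mem_retDomain h0 h1
  rw [this]
  exact (by fun_prop : Measurable fun x : ℝ => |x - 1 / 2|) (measurableSet_retBase h0 h1)

end

/-! ## The transfer of integrals over the shells -/

section

/-- The length of a shell. -/
def mass (l : ℝ) (k : ℕ) : ℝ := (1 - l) * rad l k

/-- The `n`-step value of a functional of the orbit under `T`, which collects `c` along the orbit
until the set `Z` is reached, where it collects `g`, or until time `n`, where it collects `u`. -/
def stopped (l : ℝ) (Z : Set ℝ) (g c : ℝ → ENNReal) (u : ENNReal) : ℕ → ℝ → ENNReal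
  | 0 => fun _ => u
  | n + 1 => fun t => Z.indicator g t + Zᶜ.indicator (fun s => c s + stopped l Z g c u n (T l s)) t

variable {l : ℝ}

lemma mass_pos (h0 : 0 < l) (h1 : l < 1 / 2) (k : ℕ) : 0 < mass l k :=
  mul_pos (by linarith) (rad_pos h0 k)

lemma measurableSet_shell (k : ℕ) : MeasurableSet (shell l k) := measurableSet_Ioo

lemma volume_shell (k : ℕ) : volume (shell l k) = ENNReal.ofReal (mass l k) := by
  rw [shell, Real.volume_Ioo, rad_succ, mass]; ring_nf

/-- The transition law of the random walk: the points of shell `k` sent to shell `k - 1 + i` make up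
the proportion $(1-l)l^i$ of shell `k`. -/
lemma contr_mul_mass (k i : ℕ) :
    contr l k * mass l (k - 1 + i) = (1 - l) * l ^ i * mass l k := by
  cases k with
  | zero => simp [contr_zero, mass, rad]; ring
  | succ k => simp [contr_succ, mass, rad]; ring

/-- The inverse branch of `T` with values in the `k`-th shell. -/
def invBranch (l : ℝ) (k : ℕ) (u : ℝ) : ℝ := rad l k - contr l k * u

lemma invBranch_mem (h0 : 0 < l) (h1 : l < 1 / 2) {k : ℕ} {u : ℝ} (hu : u ∈ Ioo 0 (rad l (k - 1))) :
    invBranch l k u ∈ shell l k := by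
  have hc := contr_pos h0 h1 k
  have h2 : 0 < 1 - l := by linarith
  have hu1 := hu.1
  have hu2 := hu.2
  refine ⟨?_, by simp only [invBranch]; linarith [mul_pos hc hu1]⟩
  have h3 := mul_lt_mul_of_pos_left hu2 hc
  have : rad l (k + 1) = rad l k - contr l k * rad l (k - 1) := by
    cases k with
    | zero => simp [contr_zero, rad]; ring
    | succ k => simp [contr_succ, rad]; ring
  simp only [invBranch]; linarith

lemma T_invBranch (h0 : 0 < l) (h1 : l < 1 / 2) {k : ℕ} {u : ℝ} (hu : u ∈ Ioo 0 (rad l (k - 1))) :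
    T l (invBranch l k u) = u := by
  have := (contr_pos h0 h1 k).ne'
  rw [T_of_mem h0 h1 (mem_Ioc_of_shell (invBranch_mem h0 h1 hu)), invBranch]
  field_simp; ring

lemma invBranch_T (h0 : 0 < l) (h1 : l < 1 / 2) {k : ℕ} {t : ℝ} (ht : t ∈ shell l k) :
    invBranch l k (T l t) = t := by
  have := (contr_pos h0 h1 k).ne'
  rw [T_of_mem h0 h1 (mem_Ioc_of_shell ht), invBranch]
  field_simp; ring

lemma image_invBranch (h0 : 0 < l) (h1 : l < 1 / 2) (k : ℕ) :
    invBranch l k '' Ioo 0 (rad l (k - 1)) = shell l k := by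
  ext t
  constructor
  · rintro ⟨u, hu, rfl⟩; exact invBranch_mem h0 h1 hu
  · exact fun ht => ⟨T l t, T_mem_of_shell h0 h1 ht, invBranch_T h0 h1 ht⟩

lemma invBranch_injective (h0 : 0 < l) (h1 : l < 1 / 2) (k : ℕ) :
    Function.Injective (invBranch l k) := by
  intro u v h
  have := (contr_pos h0 h1 k).ne'
  simp only [invBranch, sub_right_inj] at h
  exact mul_left_cancel₀ this h

/-- Change of variables by the affine inverse branch. -/
lemma lintegral_shell_comp_T (h0 : 0 < l) (h1 : l < 1 / 2) (k : ℕ) (U : ℝ → ENNReal) :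
    ∫⁻ t in shell l k, U (T l t) =
      ENNReal.ofReal (contr l k) * ∫⁻ u in Ioo 0 (rad l (k - 1)), U u := by
  rw [← image_invBranch h0 h1 k, lintegral_image_eq_lintegral_abs_deriv_mul measurableSet_Ioo
    (f' := fun _ => -contr l k) ?_ (invBranch_injective h0 h1 k).injOn,
    ← lintegral_const_mul' _ _ ENNReal.ofReal_ne_top]
  · refine setLIntegral_congr_fun measurableSet_Ioo fun u hu => ?_
    rw [T_invBranch h0 h1 hu, abs_neg, abs_of_pos (contr_pos h0 h1 k)]
  · intro u _
    have := (((hasDerivAt_id u).const_mul (contr l k)).const_sub (rad l k)).hasDerivWithinAt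
      (s := Ioo 0 (rad l (k - 1)))
    have h2 : HasDerivWithinAt (fun x => rad l k - contr l k * x) (-contr l k)
      (Ioo 0 (rad l (k - 1))) u := by simpa using this
    exact h2

lemma iUnion_Ioc_rad (h0 : 0 < l) (h1 : l < 1 / 2) (j : ℕ) :
    ⋃ i, Ioc (rad l (j + i + 1)) (rad l (j + i)) = Ioc 0 (rad l j) := by
  have anti := rad_strictAnti h0 h1
  ext t
  simp only [mem_iUnion]
  constructor
  · rintro ⟨i, hi⟩
    exact ⟨(rad_pos h0 _).trans hi.1, hi.2.trans (anti.antitone (by omega))⟩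
  · intro ht
    obtain ⟨k, hk⟩ := exists_mem_Ioc h0 h1 ht.1 (ht.2.trans (rad_le_half h0 h1 j))
    have : j < k + 1 := anti.lt_iff_gt.1 (hk.1.trans_le ht.2)
    refine ⟨k - j, ?_⟩
    rwa [show j + (k - j) = k by omega]

lemma lintegral_Ioo_eq_tsum (h0 : 0 < l) (h1 : l < 1 / 2) (j : ℕ) (U : ℝ → ENNReal) :
    ∫⁻ u in Ioo 0 (rad l j), U u = ∑' i, ∫⁻ u in shell l (j + i), U u := by
  rw [setLIntegral_congr Ioo_ae_eq_Ioc, ← iUnion_Ioc_rad h0 h1 j,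
    lintegral_iUnion (fun i => measurableSet_Ioc)]
  · exact tsum_congr fun i => (setLIntegral_congr Ioo_ae_eq_Ioc).symm
  · intro a b hab
    refine disjoint_left.2 fun t ha hb => hab ?_
    have := Ioc_rad_unique h0 h1 ha hb
    omega

lemma lintegral_shell_comp_T_eq_tsum (h0 : 0 < l) (h1 : l < 1 / 2) (k : ℕ) (U : ℝ → ENNReal) :
    ∫⁻ t in shell l k, U (T l t) =
      ∑' i, ENNReal.ofReal (contr l k) * ∫⁻ u in shell l (k - 1 + i), U u := by
  rw [lintegral_shell_comp_T h0 h1, lintegral_Ioo_eq_tsum h0 h1, ENNReal.tsum_mul_left]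

lemma ofReal_contr_mul {k i : ℕ} (h0 : 0 < l) (h1 : l < 1 / 2) (a : ℝ) :
    ENNReal.ofReal (contr l k) * ENNReal.ofReal (a * mass l (k - 1 + i)) =
      ENNReal.ofReal ((1 - l) * l ^ i * a) * ENNReal.ofReal (mass l k) := by
  rw [← ENNReal.ofReal_mul (contr_pos h0 h1 k).le, ← ENNReal.ofReal_mul' (mass_pos h0 h1 k).le]
  congr 1
  linear_combination a * contr_mul_mass (l := l) k i

/-- If the average of `U` over the `j`-th shell is at most `h j`, then its average after one step
is at most the expectation of `h` after one step of the random walk. -/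
lemma lintegral_comp_T_le (h0 : 0 < l) (h1 : l < 1 / 2) {U : ℝ → ENNReal} {h : ℕ → ℝ}
    (hh : ∀ j, 0 ≤ h j) (hU : ∀ j, ∫⁻ t in shell l j, U t ≤ ENNReal.ofReal (h j * mass l j))
    {k : ℕ} (hs : Summable fun i => (1 - l) * l ^ i * h (k - 1 + i)) :
    ∫⁻ t in shell l k, U (T l t) ≤
      ENNReal.ofReal ((∑' i, (1 - l) * l ^ i * h (k - 1 + i)) * mass l k) := by
  have h2 : 0 < 1 - l := by linarith
  rw [lintegral_shell_comp_T_eq_tsum h0 h1, ENNReal.ofReal_mul' (mass_pos h0 h1 k).le,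
    ENNReal.ofReal_tsum_of_nonneg (fun i => by have := hh (k - 1 + i); positivity) hs,
    ← ENNReal.tsum_mul_right]
  refine ENNReal.tsum_le_tsum fun i => ?_
  rw [← ofReal_contr_mul h0 h1]
  gcongr
  exact hU _

lemma le_lintegral_comp_T (h0 : 0 < l) (h1 : l < 1 / 2) {U : ℝ → ENNReal} {h : ℕ → ℝ}
    (hh : ∀ j, 0 ≤ h j) (hU : ∀ j, ENNReal.ofReal (h j * mass l j) ≤ ∫⁻ t in shell l j, U t)
    {k : ℕ} (hs : Summable fun i => (1 - l) * l ^ i * h (k - 1 + i)) :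
    ENNReal.ofReal ((∑' i, (1 - l) * l ^ i * h (k - 1 + i)) * mass l k) ≤
      ∫⁻ t in shell l k, U (T l t) := by
  have h2 : 0 < 1 - l := by linarith
  rw [lintegral_shell_comp_T_eq_tsum h0 h1, ENNReal.ofReal_mul' (mass_pos h0 h1 k).le,
    ENNReal.ofReal_tsum_of_nonneg (fun i => by have := hh (k - 1 + i); positivity) hs,
    ← ENNReal.tsum_mul_right]
  refine ENNReal.tsum_le_tsum fun i => ?_
  rw [← ofReal_contr_mul h0 h1]
  gcongr
  exact hU _

lemma measurable_stopped (h0 : 0 < l) (h1 : l < 1 / 2) {Z : Set ℝ} (hZ : MeasurableSet Z)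
    {g c : ℝ → ENNReal} (hg : Measurable g) (hc : Measurable c) (u : ENNReal) (n : ℕ) :
    Measurable (stopped l Z g c u n) := by
  induction n with
  | zero => exact measurable_const
  | succ n ih =>
    exact (hg.indicator hZ).add ((hc.add (ih.comp (measurable_T h0 h1))).indicator hZ.compl)

lemma stopped_succ_of_mem {Z : Set ℝ} {g c : ℝ → ENNReal} {u : ENNReal} (n : ℕ) {t : ℝ}
    (ht : t ∈ Z) : stopped l Z g c u (n + 1) t = g t := by
  simp [stopped, ht]

lemma stopped_succ_of_notMem {Z : Set ℝ} {g c : ℝ → ENNReal} {u : ENNReal} (n : ℕ) {t : ℝ}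
    (ht : t ∉ Z) : stopped l Z g c u (n + 1) t = c t + stopped l Z g c u n (T l t) := by
  simp [stopped, ht]

/-- Comparison of a stopped functional with a supersolution. -/
lemma lintegral_stopped_le (h0 : 0 < l) (h1 : l < 1 / 2) {Z : Set ℝ} {P : Set ℕ}
    (hZP : ∀ k, ∀ t ∈ shell l k, t ∈ Z ↔ k ∈ P) {g c : ℝ → ENNReal} {c' : ℕ → ℝ}
    (hc' : ∀ k, 0 ≤ c' k) (hcc : ∀ k, ∀ t ∈ shell l k, c t = ENNReal.ofReal (c' k)) {u : ENNReal}
    {h : ℕ → ℕ → ℝ} (hh : ∀ n k, 0 ≤ h n k) (hu : ∀ k, u ≤ ENNReal.ofReal (h 0 k))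
    (hg : ∀ n, ∀ k ∈ P, ∫⁻ t in shell l k, g t ≤ ENNReal.ofReal (h (n + 1) k * mass l k))
    (hs : ∀ n, ∀ k ∉ P, Summable fun i => (1 - l) * l ^ i * h n (k - 1 + i))
    (hsuper : ∀ n, ∀ k ∉ P, c' k + ∑' i, (1 - l) * l ^ i * h n (k - 1 + i) ≤ h (n + 1) k)
    (n k : ℕ) :
    ∫⁻ t in shell l k, stopped l Z g c u n t ≤ ENNReal.ofReal (h n k * mass l k) := by
  induction n generalizing k with
  | zero =>
    simp only [stopped, setLIntegral_const, volume_shell]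
    rw [ENNReal.ofReal_mul (hh 0 k)]
    gcongr
    exact hu k
  | succ n ih =>
    have hm := mass_pos h0 h1 k
    by_cases hk : k ∈ P
    · rw [setLIntegral_congr_fun (measurableSet_shell k) (g := g)
        fun t ht => stopped_succ_of_mem n ((hZP k t ht).2 hk)]
      exact hg n k hk
    · rw [setLIntegral_congr_fun (measurableSet_shell k)
        (g := fun t => ENNReal.ofReal (c' k) + stopped l Z g c u n (T l t)) fun t ht => by
          rw [← hcc k t ht]
          exact stopped_succ_of_notMem n (fun h' => hk ((hZP k t ht).1 h')),
        lintegral_add_left measurable_const, setLIntegral_const, volume_shell,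
        ← ENNReal.ofReal_mul (hc' k)]
      refine (add_le_add_right (lintegral_comp_T_le h0 h1 (hh n) (fun j => ih j) (hs n k hk)) _).trans ?_
      have h2 : 0 < 1 - l := by linarith
      rw [← ENNReal.ofReal_add (mul_nonneg (hc' k) hm.le)
        (mul_nonneg (tsum_nonneg fun i => by have := hh n (k - 1 + i); positivity) hm.le), ← add_mul]
      exact ENNReal.ofReal_le_ofReal (mul_le_mul_of_nonneg_right (hsuper n k hk) hm.le)

/-- Comparison of a stopped functional without running cost with a subsolution. -/
lemma le_lintegral_stopped (h0 : 0 < l) (h1 : l < 1 / 2) {Z : Set ℝ} {P : Set ℕ}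
    (hZP : ∀ k, ∀ t ∈ shell l k, t ∈ Z ↔ k ∈ P) {g : ℝ → ENNReal} {u : ENNReal}
    {h : ℕ → ℝ} (hh : ∀ k, 0 ≤ h k) (hu : ∀ k, ENNReal.ofReal (h k) ≤ u)
    (hg : ∀ k ∈ P, ENNReal.ofReal (h k * mass l k) ≤ ∫⁻ t in shell l k, g t)
    (hs : ∀ k ∉ P, Summable fun i => (1 - l) * l ^ i * h (k - 1 + i))
    (hsub : ∀ k ∉ P, h k ≤ ∑' i, (1 - l) * l ^ i * h (k - 1 + i)) (n k : ℕ) :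
    ENNReal.ofReal (h k * mass l k) ≤ ∫⁻ t in shell l k, stopped l Z g 0 u n t := by
  induction n generalizing k with
  | zero =>
    simp only [stopped, setLIntegral_const, volume_shell]
    rw [ENNReal.ofReal_mul (hh k)]
    gcongr
    exact hu k
  | succ n ih =>
    have hm := mass_pos h0 h1 k
    by_cases hk : k ∈ P
    · rw [setLIntegral_congr_fun (measurableSet_shell k) (g := g)
        fun t ht => stopped_succ_of_mem n ((hZP k t ht).2 hk)]
      exact hg k hk
    · rw [setLIntegral_congr_fun (measurableSet_shell k)
        (g := fun t => stopped l Z g 0 u n (T l t)) fun t ht => by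
          have := stopped_succ_of_notMem (l := l) (g := g) (c := 0) (u := u) n
            (fun h' => hk ((hZP k t ht).1 h'))
          simpa using this]
      refine le_trans ?_ (le_lintegral_comp_T h0 h1 hh (fun j => ih j) (hs k hk))
      exact ENNReal.ofReal_le_ofReal (mul_le_mul_of_nonneg_right (hsub k hk) hm.le)

/-! ### Expectations of exponentials under the random walk -/

lemma hasSum_step_pow (h0 : 0 < l) {q : ℝ} (hq : 0 < q) (hlq : l * q < 1) (a : ℝ) (k : ℕ) :
    HasSum (fun i => (1 - l) * l ^ i * (a * q ^ (k + i))) (a * q ^ k * ((1 - l) / (1 - l * q))) := by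
  have := (hasSum_geometric_of_lt_one (by positivity : 0 ≤ l * q) hlq).mul_left (a * q ^ k * (1 - l))
  have e : (fun i => (1 - l) * l ^ i * (a * q ^ (k + i))) =
      fun i => a * q ^ k * (1 - l) * (l * q) ^ i := by
    funext i; rw [mul_pow, pow_add]; ring
  rw [e, div_eq_mul_inv, ← mul_assoc]
  exact this

lemma hasSum_step_const (h0 : 0 < l) (h1 : l < 1 / 2) (a : ℝ) :
    HasSum (fun i : ℕ => (1 - l) * l ^ i * a) a := by
  have := hasSum_step_pow h0 one_pos (by linarith : l * 1 < 1) a 0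
  have h2 : (1 - l) ≠ 0 := by linarith
  simpa [h2] using this

/-- The base of the exponential harmonic function of the random walk. -/
def theta (l : ℝ) : ℝ := (1 - l) / l

lemma one_lt_theta (h0 : 0 < l) (h1 : l < 1 / 2) : 1 < theta l := by
  rw [theta, lt_div_iff₀ h0]; linarith

lemma l_mul_theta (h0 : 0 < l) : l * theta l = 1 - l := by
  rw [theta]; field_simp

/-- The exponential decay rate of the probability of not having returned. -/
def decay (l : ℝ) : ℝ := (1 - l) / (√(theta l) * (1 - l * √(theta l)))

/-- One step multiplies the mean of $q^k$ by $(1-l)/(q(1-lq))$. This factor is $1$ at $q=1$ and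
$q=\theta$, and less than $1$ in between; $q=\sqrt\theta$ is a convenient choice. -/
lemma sqrt_theta_facts (h0 : 0 < l) (h1 : l < 1 / 2) :
    1 < √(theta l) ∧ l * √(theta l) < 1 ∧ 0 ≤ decay l ∧ decay l < 1 := by
  have h2 := one_lt_theta h0 h1
  have h3 : 1 < √(theta l) := by rwa [Real.lt_sqrt (by norm_num), one_pow]
  have h4 : √(theta l) ^ 2 = theta l := Real.sq_sqrt (by linarith)
  have h5 := l_mul_theta h0
  have h6 : l * √(theta l) < 1 := by nlinarith
  -- Squaring turns this into $4l(1-l)<1$.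
  have h7 : 2 * (1 - l) < √(theta l) := by
    rw [Real.lt_sqrt (by linarith), theta, lt_div_iff₀ h0]
    have : 0 < (1 - l) * (1 - 2 * l) ^ 2 := by
      have : 0 < 1 - 2 * l := by linarith
      have : 0 < 1 - l := by linarith
      positivity
    nlinarith
  refine ⟨h3, h6, div_nonneg (by linarith) (mul_nonneg (by linarith) (by linarith)), ?_⟩
  rw [decay, div_lt_one (mul_pos (by linarith) (by linarith))]
  nlinarith

lemma hasSum_step_sqrt (h0 : 0 < l) (h1 : l < 1 / 2) (a : ℝ) (k : ℕ) :
    HasSum (fun i => (1 - l) * l ^ i * (a * √(theta l) ^ (k + i)))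
      (decay l * a * √(theta l) ^ (k + 1)) := by
  obtain ⟨h3, h4, -, -⟩ := sqrt_theta_facts h0 h1
  convert hasSum_step_pow h0 (by linarith) h4 a k using 1
  have : 1 - l * √(theta l) ≠ 0 := by linarith
  rw [decay, pow_succ]; field_simp

/-- Since $l\theta=1-l$, the geometric series gives the factor $(1-l)/l=\theta$: the function
$\theta^k$ is harmonic. -/
lemma hasSum_step_theta (h0 : 0 < l) (h1 : l < 1 / 2) (a : ℝ) (k : ℕ) :
    HasSum (fun i => (1 - l) * l ^ i * (a * theta l ^ (k + i))) (a * theta l ^ (k + 1)) := by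
  have h3 := l_mul_theta h0
  convert hasSum_step_pow h0 (by linarith [one_lt_theta h0 h1]) (by rw [h3]; linarith) a k using 1
  rw [h3, pow_succ, theta]; ring

/-! ### Almost every point returns -/

/-- The indicator of not having entered `V̂_1` before time `n`. -/
def alive (l : ℝ) : ℕ → ℝ → ENNReal := stopped l (base l) 0 0 1

lemma mem_base_iff (h0 : 0 < l) (h1 : l < 1 / 2) (k : ℕ) (t : ℝ) (ht : t ∈ shell l k) :
    t ∈ base l ↔ k ∈ ({0} : Set ℕ) :=
  ⟨eq_zero_of_mem_base h0 h1 ht, fun h => shell_zero_subset (by rwa [mem_singleton_iff.1 h] at ht)⟩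

/-- The supersolution $d^n\sqrt\theta^{\,k}$, with $d$ the decay rate, dominates the initial value
$1$. The probability of not returning within $n$ steps thus decays exponentially, which disposes of
every cut-off at a finite time below. -/
lemma lintegral_alive_le (h0 : 0 < l) (h1 : l < 1 / 2) (n k : ℕ) :
    ∫⁻ t in shell l k, alive l n t ≤
      ENNReal.ofReal (decay l ^ n * √(theta l) ^ k * mass l k) := by
  obtain ⟨h3, h4, h5, h6⟩ := sqrt_theta_facts h0 h1
  have hsum : ∀ n : ℕ, ∀ k ∉ ({0} : Set ℕ), HasSum (fun i => (1 - l) * l ^ i *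
      (decay l ^ n * √(theta l) ^ (k - 1 + i))) (decay l ^ (n + 1) * √(theta l) ^ k) := by
    intro n k hk
    convert hasSum_step_sqrt h0 h1 (decay l ^ n) (k - 1) using 1
    rw [Nat.sub_add_cancel (Nat.one_le_iff_ne_zero.2 hk)]; ring
  refine lintegral_stopped_le h0 h1 (mem_base_iff h0 h1) (c' := 0) (fun _ => le_rfl) (by simp)
    (h := fun n k => decay l ^ n * √(theta l) ^ k) (fun n k => by positivity) ?_ ?_
    (fun n k hk => (hsum n k hk).summable) ?_ n k
  · intro k
    rw [← ENNReal.ofReal_one]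
    exact ENNReal.ofReal_le_ofReal (by simpa using one_le_pow₀ h3.le)
  · intro n k _; simp
  · intro n k hk
    rw [(hsum n k hk).tsum_eq]; simp

lemma alive_eq_one {n : ℕ} {t : ℝ} (h : ∀ i < n, (T l)^[i] t ∉ base l) : alive l n t = 1 := by
  induction n generalizing t with
  | zero => rfl
  | succ n ih =>
    rw [alive, stopped_succ_of_notMem _ (show t ∉ base l from h 0 (by omega)), ← alive, ih]
    · simp
    · intro i hi
      rw [← Function.iterate_succ_apply]; exact h _ (by omega)

lemma lintegral_alive_T_le (h0 : 0 < l) (h1 : l < 1 / 2) (n : ℕ) :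
    ∫⁻ t in shell l 0, alive l n (T l t) ≤
      ENNReal.ofReal (decay l ^ (n + 1) * √(theta l) * mass l 0) := by
  obtain ⟨h3, h4, h5, h6⟩ := sqrt_theta_facts h0 h1
  have hs : HasSum (fun i => (1 - l) * l ^ i * (decay l ^ n * √(theta l) ^ (0 - 1 + i)))
      (decay l ^ (n + 1) * √(theta l)) := by
    have := hasSum_step_sqrt h0 h1 (decay l ^ n) 0
    rwa [zero_add, pow_one, ← pow_succ'] at this
  have := lintegral_comp_T_le h0 h1 (h := fun k => decay l ^ n * √(theta l) ^ k)
    (fun k => by positivity) (lintegral_alive_le h0 h1 n) hs.summable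
  rwa [hs.tsum_eq] at this

lemma tendsto_decay (h0 : 0 < l) (h1 : l < 1 / 2) (a : ℝ) :
    Tendsto (fun n : ℕ => ENNReal.ofReal (decay l ^ (n + 1) * a)) atTop (𝓝 0) := by
  obtain ⟨h3, h4, h5, h6⟩ := sqrt_theta_facts h0 h1
  have := ((tendsto_pow_atTop_nhds_zero_of_lt_one h5 h6).comp (tendsto_add_atTop_nat 1)).mul_const a
  rw [zero_mul] at this
  simpa using ENNReal.tendsto_ofReal this

lemma volume_base_diff_retBase (h0 : 0 < l) (h1 : l < 1 / 2) :
    volume (base l \ retBase l) = 0 := by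
  have hle : ∀ n : ℕ, volume (shell l 0 \ retBase l) ≤
      ENNReal.ofReal (decay l ^ (n + 1) * (√(theta l) * mass l 0)) := by
    intro n
    rw [← mul_assoc]
    refine le_trans ?_ (lintegral_alive_T_le h0 h1 n)
    rw [← setLIntegral_one]
    refine le_trans (setLIntegral_mono' (g := fun t => alive l n (T l t))
      ((measurableSet_shell 0).diff (measurableSet_retBase h0 h1)) fun t ht => ?_)
      (lintegral_mono_set sdiff_subset)
    rw [alive_eq_one fun i hi hb => ht.2 ⟨shell_zero_subset ht.1, i + 1, by omega, ?_⟩]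
    rwa [Function.iterate_succ_apply]
  have hz : volume (shell l 0 \ retBase l) = 0 :=
    le_antisymm (ge_of_tendsto' (tendsto_decay h0 h1 _) hle) zero_le
  have hsub : base l \ retBase l ⊆ (shell l 0 \ retBase l) ∪ {rad l 0} := by
    rintro t ⟨ht, ht'⟩
    rcases eq_or_lt_of_le ht.2 with h | h
    · exact .inr h
    · exact .inl ⟨⟨ht.1, h⟩, ht'⟩
  exact measure_mono_null hsub (measure_union_null hz (measure_singleton _))

end

/-! ## The conformal and the invariant measure -/

section

/-- Normalized Lebesgue measure on the domain of the reinduced map. -/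
def refMeasure (l : ℝ) : Measure ℝ :=
  (ENNReal.ofReal (1 - l))⁻¹ • volume.restrict (retDomain l)

/-- The invariant measure of the reinduced map. -/
def invMeasure (l : ℝ) : Measure ℝ := (refMeasure l).map (Fhat l)

variable {l : ℝ}

lemma measurable_dist : Measurable fun x : ℝ => |x - 1 / 2| := by fun_prop

lemma volume_dist_preimage {N : Set ℝ} (hN : MeasurableSet N) (hpos : N ⊆ Ioi 0) :
    volume {x : ℝ | |x - 1 / 2| ∈ N} = 2 * volume N := by
  have e : {x : ℝ | |x - 1 / 2| ∈ N} = (fun x => x + -(1 / 2)) ⁻¹' N ∪ (fun x => 1 / 2 - x) ⁻¹' N := by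
    ext x
    simp only [mem_ofPred_eq, mem_union, mem_preimage, ← sub_eq_add_neg]
    rcases abs_cases (x - 1 / 2) with ⟨h, h'⟩ | ⟨h, h'⟩ <;> rw [h]
    · refine ⟨.inl, fun h2 => h2.elim id fun h2 => ?_⟩
      have : (0 : ℝ) < 1 / 2 - x := hpos h2
      linarith
    · rw [neg_sub]
      refine ⟨.inr, fun h2 => h2.elim (fun h2 => ?_) id⟩
      have : (0 : ℝ) < x - 1 / 2 := hpos h2
      linarith
  rw [e, measure_union _ ((by fun_prop : Measurable fun x : ℝ => 1 / 2 - x) hN),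
    measure_preimage_add_right,
    (volume.measurePreserving_sub_left (1 / 2 : ℝ)).measure_preimage hN.nullMeasurableSet, two_mul]
  refine disjoint_left.2 fun x hx hx' => ?_
  have h2 : (0 : ℝ) < x + -(1 / 2) := hpos hx
  have h3 : (0 : ℝ) < 1 / 2 - x := hpos hx'
  linarith

lemma retBase_subset : retBase l ⊆ base l := fun _ h => h.1

lemma base_subset (h0 : 0 < l) : base l ⊆ Ioi 0 := fun _ h => (rad_pos h0 1).trans h.1

lemma retDomain_eq (h0 : 0 < l) (h1 : l < 1 / 2) :
    retDomain l = {x | |x - 1 / 2| ∈ retBase l} := by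
  ext x; exact mem_retDomain h0 h1

lemma volume_base : volume (base l) = ENNReal.ofReal ((1 - l) / 2) := by
  rw [base, Real.volume_Ioc, rad_zero, rad_one]; ring_nf

lemma volume_retDomain (h0 : 0 < l) (h1 : l < 1 / 2) :
    volume (retDomain l) = ENNReal.ofReal (1 - l) := by
  have hb : volume (retBase l) = volume (base l) :=
    measure_eq_measure_of_null_sdiff retBase_subset (volume_base_diff_retBase h0 h1)
  rw [retDomain_eq h0 h1, volume_dist_preimage (measurableSet_retBase h0 h1)
    (retBase_subset.trans (base_subset h0)), hb, volume_base,
    show (2 : ENNReal) = ENNReal.ofReal 2 by simp, ← ENNReal.ofReal_mul (by norm_num)]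
  ring_nf

lemma volume_Vhat_diff_retDomain (h0 : 0 < l) (h1 : l < 1 / 2) :
    volume (Vhat l 0 \ retDomain l) = 0 := by
  have : Vhat l 0 \ retDomain l = {x | |x - 1 / 2| ∈ base l \ retBase l} := by
    ext x
    simp only [Set.mem_sdiff, mem_Vhat_zero h0, mem_retDomain h0 h1, mem_ofPred_eq]
  rw [this, volume_dist_preimage (measurableSet_base.diff (measurableSet_retBase h0 h1))
    (sdiff_subset.trans (base_subset h0)), volume_base_diff_retBase h0 h1, mul_zero]

lemma normalizer_ne (h1 : l < 1 / 2) :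
    (ENNReal.ofReal (1 - l))⁻¹ ≠ 0 ∧ (ENNReal.ofReal (1 - l))⁻¹ ≠ ⊤ := by
  have : ENNReal.ofReal (1 - l) ≠ 0 := by
    rw [ne_eq, ENNReal.ofReal_eq_zero]; linarith
  exact ⟨by simp, ENNReal.inv_ne_top.2 this⟩

lemma Fhat_mem_Vhat (h0 : 0 < l) (h1 : l < 1 / 2) {x : ℝ} (hx : x ∈ retDomain l) :
    Fhat l x ∈ Vhat l 0 := by
  rw [mem_Vhat_zero h0, dist_Fhat h0 h1]
  exact (ret_spec ((mem_retDomain h0 h1).1 hx)).2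

lemma hasDerivAt_Fhat (h0 : 0 < l) (h1 : l < 1 / 2) {x : ℝ} (hx : x ∈ retDomain l) :
    HasDerivAt (Fhat l) (deriv (Fhat l) x) x ∧ |deriv (Fhat l) x| = Real.exp (-phihat l x) := by
  obtain ⟨a, b, ha, -, hloc⟩ := Fhat_local h0 h1 hx
  have : HasDerivAt (Fhat l) a x := by
    have h2 : HasDerivAt (fun y => Fhat l x + a * (y - x)) a x := by
      simpa using (((hasDerivAt_id x).sub_const x).const_mul a).const_add (Fhat l x)
    exact h2.congr_of_eventuallyEq (hloc.mono fun y hy => hy.2.2.1)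
  rw [this.deriv]
  exact ⟨this, ha⟩

lemma isProbabilityMeasure_refMeasure (h0 : 0 < l) (h1 : l < 1 / 2) :
    IsProbabilityMeasure (refMeasure l) := by
  refine ⟨?_⟩
  rw [refMeasure, Measure.smul_apply, Measure.restrict_apply_univ, volume_retDomain h0 h1,
    smul_eq_mul]
  refine ENNReal.inv_mul_cancel ?_ ENNReal.ofReal_ne_top
  rw [ne_eq, ENNReal.ofReal_eq_zero]; linarith

/-- Normalized Lebesgue measure is conformal. -/
lemma isConformal_refMeasure (h0 : 0 < l) (h1 : l < 1 / 2) :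
    IsConformal (retDomain l) (Fhat l) (phihat l) (refMeasure l) := by
  have hD := measurableSet_retDomain h0 h1
  refine ⟨isProbabilityMeasure_refMeasure h0 h1, ?_, fun A hA hAD hinj => ?_⟩
  · rw [refMeasure, Measure.smul_apply, Measure.restrict_apply hD.compl]; simp
  · have hF : MeasurableSet (Fhat l '' A) := hA.image_of_measurable_injOn (measurable_Fhat h0 h1) hinj
    -- The image need not lie in the domain, but it lies in $\hat V_1$, and almost every point of
    -- $\hat V_1$ returns.
    have h2 : volume (Fhat l '' A \ retDomain l) = 0 := by
      refine measure_mono_null (sdiff_subset_sdiff_left ?_) (volume_Vhat_diff_retDomain h0 h1)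
      rintro _ ⟨x, hx, rfl⟩
      exact Fhat_mem_Vhat h0 h1 (hAD hx)
    have h3 : volume (Fhat l '' A ∩ retDomain l) = volume (Fhat l '' A) := by
      refine measure_eq_measure_of_null_sdiff inter_subset_left ?_
      rwa [sdiff_self_inter]
    rw [refMeasure, Measure.smul_apply, Measure.restrict_apply hF, h3, Measure.restrict_smul,
      lintegral_smul_measure, Measure.restrict_restrict hA, inter_eq_left.2 hAD]
    congr 1
    rw [← setLIntegral_one, lintegral_image_eq_lintegral_abs_deriv_mul hA
      (fun x hx => (hasDerivAt_Fhat h0 h1 (hAD hx)).1.hasDerivWithinAt) hinj]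
    refine setLIntegral_congr_fun hA fun x hx => ?_
    simp only [mul_one]
    rw [(hasDerivAt_Fhat h0 h1 (hAD hx)).2]

/-! ### Invariance -/

lemma hit_eq_one {E : Set ℝ} {n m : ℕ} {t : ℝ} (hmn : m < n) (hb : (T l)^[m] t ∈ base l)
    (hE : (T l)^[m] t ∈ E) (h : ∀ i < m, (T l)^[i] t ∉ base l) :
    stopped l (base l) (E.indicator 1) 0 0 n t = 1 := by
  induction n generalizing m t with
  | zero => omega
  | succ n ih =>
    cases m with
    | zero =>
      rw [stopped_succ_of_mem n (show t ∈ base l from hb)]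
      exact indicator_of_mem (f := (1 : ℝ → ENNReal)) hE
    | succ m =>
      rw [stopped_succ_of_notMem n (show t ∉ base l from h 0 (by omega)),
        ih (m := m) (by omega) hb hE fun i hi => h (i + 1) (by omega)]
      simp

/-- With terminal value the indicator of `E`, the constant function equal to the proportion of `E`
in shell `0` is a supersolution, as the step probabilities sum to $1$. Only this inequality is
needed: total masses turn it into an equality in `map_dist_invMeasure`. -/
lemma volume_That_preimage_le (h0 : 0 < l) (h1 : l < 1 / 2) {E : Set ℝ} (hE : MeasurableSet E) :
    volume {t | t ∈ retBase l ∧ (T l)^[ret l t] t ∈ E} ≤ volume (E ∩ shell l 0) := by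
  have hfin : volume (E ∩ shell l 0) ≠ ⊤ :=
    ((measure_mono inter_subset_right).trans_lt (by rw [volume_shell]; exact ENNReal.ofReal_lt_top)).ne
  set b := (volume (E ∩ shell l 0)).toReal / mass l 0 with hb
  have hm := mass_pos h0 h1 0
  have hb0 : 0 ≤ b := div_nonneg ENNReal.toReal_nonneg hm.le
  have hbm : ENNReal.ofReal (b * mass l 0) = volume (E ∩ shell l 0) := by
    rw [hb, div_mul_cancel₀ _ hm.ne', ENNReal.ofReal_toReal hfin]
  have hs := hasSum_step_const h0 h1 b
  have hstopped : ∀ n k, ∫⁻ t in shell l k, stopped l (base l) (E.indicator 1) 0 0 n t ≤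
      ENNReal.ofReal (b * mass l k) := by
    refine fun n k => lintegral_stopped_le h0 h1 (mem_base_iff h0 h1) (c' := 0) (fun _ => le_rfl)
      (by simp) (h := fun _ _ => b) (fun _ _ => hb0) (by simp) ?_ (fun n k _ => hs.summable) ?_ n k
    · intro n k hk
      rw [mem_singleton_iff.1 hk, hbm, lintegral_indicator_one hE, Measure.restrict_apply hE]
    · intro n k _
      rw [hs.tsum_eq]; simp
  have hT : ∀ n, ∫⁻ t in shell l 0, stopped l (base l) (E.indicator 1) 0 0 n (T l t) ≤
      volume (E ∩ shell l 0) := by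
    intro n
    have := lintegral_comp_T_le h0 h1 (h := fun _ => b) (fun _ => hb0) (hstopped n) (k := 0)
      hs.summable
    rwa [hs.tsum_eq, hbm] at this
  have hret := measurable_ret h0 h1
  have hThat : Measurable fun t => (T l)^[ret l t] t :=
    measurable_apply_nat (fun n => (measurable_T h0 h1).iterate n) hret
  have e : {t | t ∈ retBase l ∧ (T l)^[ret l t] t ∈ E} ⊆
      (⋃ n : ℕ, {t | t ∈ shell l 0 ∧ (t ∈ retBase l ∧ (T l)^[ret l t] t ∈ E ∧ ret l t ≤ n)}) := by
    rintro t ⟨ht, htE⟩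
    obtain ⟨k, hk⟩ := orbit_mem_shell h0 h1 ht (i := 0) (by have := (ret_spec ht).1; omega)
    obtain rfl := eq_zero_of_mem_base h0 h1 hk ht.1
    exact mem_iUnion.2 ⟨ret l t, hk, ht, htE, le_rfl⟩
  refine (measure_mono e).trans ?_
  rw [Monotone.measure_iUnion]
  · refine iSup_le fun n => le_trans ?_ (hT n)
    rw [← setLIntegral_one]
    refine le_trans (setLIntegral_mono' (g := fun t =>
      stopped l (base l) (E.indicator 1) 0 0 n (T l t)) ?_ fun t ht => ?_)
      (lintegral_mono_set fun t ht => ht.1)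
    · exact (measurableSet_shell 0).inter ((measurableSet_retBase h0 h1).inter
        ((hThat hE).inter (hret measurableSet_Iic)))
    · obtain ⟨-, ht, htE, htn⟩ := ht
      obtain ⟨hr, hrb⟩ := ret_spec ht
      have e : (T l)^[ret l t - 1] (T l t) = (T l)^[ret l t] t := by
        rw [← Function.iterate_succ_apply, Nat.succ_eq_add_one, Nat.sub_add_cancel hr]
      rw [hit_eq_one (m := ret l t - 1) (by omega) (by rwa [e]) (by rwa [e])]
      intro i hi
      rw [← Function.iterate_succ_apply]
      exact not_mem_base_of_lt_ret (by omega) (by omega)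
  · intro n m hnm t ht
    exact ⟨ht.1, ht.2.1, ht.2.2.1, ht.2.2.2.trans hnm⟩

/-- The return map does not increase the distribution of the distance, and two probability measures,
one of which is at most the other, coincide. -/
lemma map_dist_invMeasure (h0 : 0 < l) (h1 : l < 1 / 2) :
    (invMeasure l).map (fun x => |x - 1 / 2|) = (refMeasure l).map (fun x => |x - 1 / 2|) := by
  have hF := measurable_Fhat h0 h1
  have := isProbabilityMeasure_refMeasure h0 h1
  have : IsProbabilityMeasure (invMeasure l) := Measure.isProbabilityMeasure_map hF.aemeasurable
  have i1 : IsProbabilityMeasure ((invMeasure l).map (fun x => |x - 1 / 2|)) :=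
    Measure.isProbabilityMeasure_map measurable_dist.aemeasurable
  have i2 : IsProbabilityMeasure ((refMeasure l).map (fun x => |x - 1 / 2|)) :=
    Measure.isProbabilityMeasure_map measurable_dist.aemeasurable
  refine Measure.eq_of_le_of_isProbabilityMeasure (Measure.le_intro fun E hE _ => ?_)
  have hret := measurable_ret h0 h1
  have hThat : Measurable fun t => (T l)^[ret l t] t :=
    measurable_apply_nat (fun n => (measurable_T h0 h1).iterate n) hret
  rw [Measure.map_apply measurable_dist hE, Measure.map_apply measurable_dist hE, invMeasure,
    Measure.map_apply hF (measurable_dist hE), refMeasure, Measure.smul_apply, Measure.smul_apply,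
    Measure.restrict_apply (hF (measurable_dist hE)), Measure.restrict_apply (measurable_dist hE)]
  refine mul_le_mul_right ?_ _
  have e1 : Fhat l ⁻¹' ((fun x => |x - 1 / 2|) ⁻¹' E) ∩ retDomain l =
      {x | |x - 1 / 2| ∈ {t | t ∈ retBase l ∧ (T l)^[ret l t] t ∈ E}} := by
    ext x
    simp only [mem_inter_iff, mem_preimage, dist_Fhat h0 h1, mem_retDomain h0 h1, mem_ofPred_eq,
      and_comm]
  have e2 : (fun x => |x - 1 / 2|) ⁻¹' E ∩ retDomain l =
      {x : ℝ | |x - 1 / 2| ∈ E ∩ retBase l} := by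
    ext x
    simp only [mem_inter_iff, mem_preimage, mem_retDomain h0 h1, mem_ofPred_eq]
  have hpos := retBase_subset.trans (base_subset h0)
  have hm : MeasurableSet {t | t ∈ retBase l ∧ (T l)^[ret l t] t ∈ E} :=
    (measurableSet_retBase h0 h1).inter (hThat hE)
  rw [e1, e2, volume_dist_preimage hm (fun t ht => hpos ht.1),
    volume_dist_preimage (hE.inter (measurableSet_retBase h0 h1))
    (fun t ht => hpos ht.2)]
  gcongr 2 * ?_
  refine (volume_That_preimage_le h0 h1 hE).trans ?_
  refine (measure_mono (t := (E ∩ retBase l) ∪ (base l \ retBase l)) ?_).trans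
    ((measure_union_le _ _).trans_eq (by rw [volume_base_diff_retBase h0 h1, add_zero]))
  rintro t ⟨ht, ht'⟩
  by_cases h : t ∈ retBase l
  · exact .inl ⟨ht, h⟩
  · exact .inr ⟨shell_zero_subset ht', h⟩

lemma invMeasure_retDomain_compl (h0 : 0 < l) (h1 : l < 1 / 2) :
    invMeasure l (retDomain l)ᶜ = 0 := by
  have e : (retDomain l)ᶜ = (fun x => |x - 1 / 2|) ⁻¹' (retBase l)ᶜ := by
    rw [retDomain_eq h0 h1]; rfl
  have hm := (measurableSet_retBase h0 h1).compl
  rw [e, ← Measure.map_apply measurable_dist hm, map_dist_invMeasure h0 h1,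
    Measure.map_apply measurable_dist hm, ← e]
  exact (isConformal_refMeasure h0 h1).carried

/-- As `Fhat` factors through the distance on its domain, the image of a measure under it depends
only on the distribution of the distance. -/
lemma map_Fhat_eq (h0 : 0 < l) (h1 : l < 1 / 2) {ν : Measure ℝ} (hν : ν (retDomain l)ᶜ = 0) :
    ν.map (Fhat l) = (ν.map fun x => |x - 1 / 2|).map fun t => Fhat l (1 / 2 + t) := by
  have hF : Measurable fun t => Fhat l (1 / 2 + t) :=
    (measurable_Fhat h0 h1).comp (measurable_const_add _)
  rw [Measure.map_map hF measurable_dist]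
  refine Measure.map_congr ?_
  have : ∀ᵐ x ∂ν, x ∈ retDomain l := by
    rw [ae_iff]; exact hν
  filter_upwards [this] with x hx
  exact Fhat_congr h0 h1 hx (by simp)

/-- `invMeasure l` and `refMeasure l` have the same distribution of the distance, hence the same
image under `Fhat`; the image of the latter is `invMeasure l` by definition. -/
lemma measurePreserving_invMeasure (h0 : 0 < l) (h1 : l < 1 / 2) :
    MeasurePreserving (Fhat l) (invMeasure l) (invMeasure l) := by
  refine ⟨measurable_Fhat h0 h1, ?_⟩
  rw [map_Fhat_eq h0 h1 (invMeasure_retDomain_compl h0 h1), map_dist_invMeasure h0 h1,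
    ← map_Fhat_eq h0 h1 (isConformal_refMeasure h0 h1).carried, invMeasure]

/-! ### Equivalence of the conformal and the invariant measure. -/

lemma refMeasure_absolutelyContinuous_volume : refMeasure l ≪ volume :=
  (Measure.smul_absolutelyContinuous).trans Measure.restrict_le_self.absolutelyContinuous

lemma volume_eq_zero_of_refMeasure (h1 : l < 1 / 2) {A : Set ℝ} (hA : MeasurableSet A)
    (h : refMeasure l A = 0) : volume (A ∩ retDomain l) = 0 := by
  rw [refMeasure, Measure.smul_apply, Measure.restrict_apply hA, smul_eq_mul, mul_eq_zero] at h
  exact h.resolve_left (normalizer_ne h1).1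

lemma invMeasure_absolutelyContinuous (h0 : 0 < l) (h1 : l < 1 / 2) :
    invMeasure l ≪ refMeasure l := by
  refine Measure.AbsolutelyContinuous.mk fun N hN hN0 => ?_
  have h2 := volume_eq_zero_of_refMeasure h1 hN hN0
  have hND := hN.inter (measurableSet_retDomain h0 h1)
  -- Only the distribution of the distance is known for `invMeasure l`, so the null set is enlarged
  -- to its symmetrization, which is still Lebesgue null.
  set N' : Set ℝ := {t | 1 / 2 + t ∈ N ∩ retDomain l ∨ 1 / 2 - t ∈ N ∩ retDomain l} with hN'
  have hN'm : MeasurableSet N' :=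
    ((by fun_prop : Measurable fun t : ℝ => 1 / 2 + t) hND).union
      ((by fun_prop : Measurable fun t : ℝ => 1 / 2 - t) hND)
  have hsub : N ⊆ (fun x => |x - 1 / 2|) ⁻¹' N' ∪ (retDomain l)ᶜ := by
    intro x hx
    by_cases hxD : x ∈ retDomain l
    · left
      rcases abs_cases (x - 1 / 2) with ⟨h, -⟩ | ⟨h, -⟩
      · left
        simp only [h, add_sub_cancel]; exact ⟨hx, hxD⟩
      · right
        simp only [h, sub_neg_eq_add, add_sub_cancel]; exact ⟨hx, hxD⟩
    · exact .inr hxD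
  refine measure_mono_null hsub (measure_union_null ?_ (invMeasure_retDomain_compl h0 h1))
  rw [← Measure.map_apply measurable_dist hN'm, map_dist_invMeasure h0 h1,
    Measure.map_apply measurable_dist hN'm]
  refine refMeasure_absolutelyContinuous_volume ?_
  refine measure_mono_null (t := (N ∩ retDomain l) ∪ (fun x => 1 - x) ⁻¹' (N ∩ retDomain l)) ?_
    (measure_union_null h2 ?_)
  · intro x hx
    simp only [mem_preimage, mem_ofPred_eq, hN'] at hx
    rcases abs_cases (x - 1 / 2) with ⟨h, -⟩ | ⟨h, -⟩ <;> rw [h] at hx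
    · rw [add_sub_cancel, show (1 : ℝ) / 2 - (x - 1 / 2) = 1 - x by ring] at hx
      exact hx
    · rw [show (1 : ℝ) / 2 + -(x - 1 / 2) = 1 - x by ring, sub_neg_eq_add, add_sub_cancel] at hx
      exact hx.symm
  · rwa [(volume.measurePreserving_sub_left (1 : ℝ)).measure_preimage hND.nullMeasurableSet]

lemma volume_shell_inter_T_preimage (h0 : 0 < l) (h1 : l < 1 / 2) (k : ℕ) {E : Set ℝ}
    (hE : MeasurableSet E) :
    volume (shell l k ∩ T l ⁻¹' E) =
      ENNReal.ofReal (contr l k) * volume (E ∩ Ioo 0 (rad l (k - 1))) := by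
  have := lintegral_shell_comp_T h0 h1 k (E.indicator 1)
  rw [lintegral_indicator_one hE, Measure.restrict_apply hE] at this
  rw [← this, inter_comm]
  have h2 : ∀ t, E.indicator (1 : ℝ → ENNReal) (T l t) = (T l ⁻¹' E).indicator 1 t := fun t => rfl
  simp only [h2]
  rw [lintegral_indicator_one (measurable_T h0 h1 hE),
    Measure.restrict_apply (measurable_T h0 h1 hE)]

lemma volume_eq_zero_of_T_preimage (h0 : 0 < l) (h1 : l < 1 / 2) {k : ℕ} {E : Set ℝ}
    (hE : MeasurableSet E) (hEk : E ⊆ Ioo 0 (rad l (k - 1)))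
    (h : volume (shell l k ∩ T l ⁻¹' E) = 0) : volume E = 0 := by
  rw [volume_shell_inter_T_preimage h0 h1 k hE, inter_eq_left.2 hEk, mul_eq_zero,
    ENNReal.ofReal_eq_zero] at h
  exact h.resolve_left (not_le.2 (contr_pos h0 h1 k))

lemma shell_subset (h0 : 0 < l) (h1 : l < 1 / 2) {j k : ℕ} (hjk : j ≤ k) :
    shell l k ⊆ Ioo 0 (rad l j) := fun _ ht =>
  ⟨(rad_pos h0 _).trans ht.1, ht.2.trans_le ((rad_strictAnti h0 h1).antitone hjk)⟩

lemma ret_eq_one {t : ℝ} (h : T l t ∈ base l) : ret l t = 1 :=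
  ret_eq le_rfl h fun i h2 h3 => by omega

/-- The direct branch of the reinduced map. -/
lemma Fhat_of_T_mem (h0 : 0 < l) (h1 : l < 1 / 2) {x : ℝ} (hx : |x - 1 / 2| ∈ shell l 0)
    (h : T l |x - 1 / 2| ∈ base l) : x ∈ retDomain l ∧ Fhat l x = 1 / 2 + T l |x - 1 / 2| := by
  have hD : |x - 1 / 2| ∈ retBase l := ⟨shell_zero_subset hx, 1, le_rfl, h⟩
  refine ⟨(mem_retDomain h0 h1).2 hD, ?_⟩
  rw [Fhat, rho_eq h0 h1, ret_eq_one h]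
  have := F_iterate_eq h0 h1 (n := 0) (k := 0) hx
  simpa [side] using this

/-- Two branches of the return map suffice to cover $\hat V_1$ up to null sets: the direct branch
through shell `0` covers the right component, and the branch through the shells `0` and `1` covers
the left one. Affine branches pull sets of positive measure back to such sets. -/
lemma refMeasure_absolutelyContinuous (h0 : 0 < l) (h1 : l < 1 / 2) :
    refMeasure l ≪ invMeasure l := by
  have hF := measurable_Fhat h0 h1
  have hT := measurable_T h0 h1
  refine Measure.AbsolutelyContinuous.mk fun N hN hN0 => ?_
  rw [invMeasure, Measure.map_apply hF hN] at hN0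
  have h2 := volume_eq_zero_of_refMeasure h1 (hF hN) hN0
  have hpull : volume ((fun t => t + 1 / 2) ⁻¹' (Fhat l ⁻¹' N ∩ retDomain l)) = 0 := by
    rwa [measure_preimage_add_right]
  set R : Set ℝ := shell l 0 ∩ (fun t => 1 / 2 + t) ⁻¹' N with hR
  set L : Set ℝ := shell l 0 ∩ (fun t => 1 / 2 - t) ⁻¹' N with hL
  have hRm : MeasurableSet R := (measurableSet_shell 0).inter
    ((by fun_prop : Measurable fun t : ℝ => 1 / 2 + t) hN)
  have hLm : MeasurableSet L := (measurableSet_shell 0).inter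
    ((by fun_prop : Measurable fun t : ℝ => 1 / 2 - t) hN)
  have hpos : ∀ {k : ℕ} {t : ℝ}, t ∈ shell l k → |t + 1 / 2 - 1 / 2| = t := fun {k t} ht => by
    rw [add_sub_cancel_right, abs_of_pos ((rad_pos h0 _).trans ht.1)]
  have hR0 : volume R = 0 := by
    refine volume_eq_zero_of_T_preimage h0 h1 (k := 0) hRm
      (fun t ht => shell_subset h0 h1 (j := 0 - 1) le_rfl ht.1) (measure_mono_null ?_ hpull)
    rintro t ⟨ht, htR, htN⟩
    obtain ⟨h3, h4⟩ := Fhat_of_T_mem h0 h1 (x := t + 1 / 2) (by rwa [hpos ht])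
      (by rw [hpos ht]; exact shell_zero_subset htR)
    refine ⟨?_, h3⟩
    rw [mem_preimage, h4, hpos ht]
    exact htN
  have hL0 : volume L = 0 := by
    refine volume_eq_zero_of_T_preimage h0 h1 (k := 1) hLm
      (fun t ht => shell_subset h0 h1 (j := 1 - 1) le_rfl ht.1) ?_
    refine volume_eq_zero_of_T_preimage h0 h1 (k := 0) ((measurableSet_shell 1).inter (hT hLm))
      (fun t ht => shell_subset h0 h1 (j := 0 - 1) (Nat.zero_le 1) ht.1)
      (measure_mono_null ?_ hpull)
    rintro t ⟨ht, ht1, ht2, htN⟩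
    have hret : ret l t = 2 := by
      refine ret_eq (by norm_num) (shell_zero_subset ht2) fun i hi hi' => ?_
      obtain rfl : i = 1 := by omega
      exact fun hb => absurd (eq_zero_of_mem_base h0 h1 ht1 hb) one_ne_zero
    have hD : t ∈ retBase l := ⟨shell_zero_subset ht, 2, by norm_num, shell_zero_subset ht2⟩
    refine ⟨?_, (mem_retDomain h0 h1).2 (by rwa [hpos ht])⟩
    have h5 := F_iterate_eq h0 h1 (x := t + 1 / 2) (n := 1) (k := 1) (by rwa [hpos ht])
    rw [mem_preimage, Fhat, rho_eq h0 h1, hpos ht, hret, h5, hpos ht]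
    have : 1 / 2 + side 1 * (T l)^[1 + 1] t = 1 / 2 - T l (T l t) := by
      simp [side]; ring
    rw [this]
    exact htN
  rw [refMeasure, Measure.smul_apply, Measure.restrict_apply hN, smul_eq_mul]
  refine mul_eq_zero_of_right _ (measure_mono_null (t := (fun x => x + -(1 / 2)) ⁻¹' R ∪
    (fun x => 1 / 2 - x) ⁻¹' L) ?_ (measure_union_null ?_ ?_))
  · rintro x ⟨hxN, hxD⟩
    have hx := (mem_retDomain h0 h1).1 hxD
    obtain ⟨k, hk⟩ := orbit_mem_shell h0 h1 hx (i := 0) (by have := (ret_spec hx).1; omega)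
    obtain rfl := eq_zero_of_mem_base h0 h1 hk hx.1
    rw [Function.iterate_zero, id_eq] at hk
    rcases abs_cases (x - 1 / 2) with ⟨h, -⟩ | ⟨h, -⟩ <;> rw [h] at hk
    · refine .inl ⟨hk, ?_⟩
      simpa [mem_preimage] using hxN
    · rw [neg_sub] at hk
      refine .inr ⟨hk, ?_⟩
      simpa [mem_preimage] using hxN
  · rwa [measure_preimage_add_right]
  · rwa [(volume.measurePreserving_sub_left (1 / 2 : ℝ)).measure_preimage hLm.nullMeasurableSet]

end

/-! ## Conformal measures are Lebesgue measure -/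

section

variable {l : ℝ}

/-- Two measures carried by `D` that agree locally on `D` are equal. -/
lemma measure_ext_of_locally {D : Set ℝ} (hD : MeasurableSet D) {μ ν : Measure ℝ} (hμ : μ Dᶜ = 0)
    (hν : ν Dᶜ = 0)
    (h : ∀ x ∈ D, ∃ U ∈ 𝓝 x, ∀ A, MeasurableSet A → A ⊆ U ∩ D → μ A = ν A) : μ = ν := by
  choose! U hU hUA using h
  obtain ⟨s, hsD, hsc, hs⟩ := TopologicalSpace.countable_cover_nhdsWithin
    (f := fun x => interior (U x)) (s := D)
    fun x hx => mem_nhdsWithin_of_mem_nhds (interior_mem_nhds.2 (hU x hx))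
  have hcover : ⋃ x ∈ s, interior (U x) ∩ D = D := by
    refine subset_antisymm (iUnion₂_subset fun x _ => inter_subset_right) fun x hx => ?_
    obtain ⟨y, hy, hxy⟩ := mem_iUnion₂.1 (hs hx)
    exact mem_iUnion₂.2 ⟨y, hy, hxy, hx⟩
  have key : μ.restrict (⋃ x ∈ s, interior (U x) ∩ D) = ν.restrict (⋃ x ∈ s, interior (U x) ∩ D) := by
    rw [Measure.restrict_biUnion_congr hsc]
    intro x hx
    ext A hA
    rw [Measure.restrict_apply hA, Measure.restrict_apply hA]
    exact hUA x (hsD hx) _ (hA.inter (isOpen_interior.measurableSet.inter hD))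
      fun y hy => ⟨interior_subset hy.2.1, hy.2.2⟩
  rwa [hcover, Measure.restrict_eq_self_of_ae_mem (by rw [ae_iff]; exact hμ),
    Measure.restrict_eq_self_of_ae_mem (by rw [ae_iff]; exact hν)] at key

/-! ### Conformal measures for the map `T` -/

lemma measureReal_rad_eq_zero {N : Measure ℝ} (h0 : 0 < l) (h1 : l < 1 / 2)
    (hN : N (⋃ k, shell l k)ᶜ = 0) (k : ℕ) :
    N.real {rad l k} = 0 := by
  rw [measureReal_def, measure_mono_null _ hN, ENNReal.toReal_zero]
  rintro t rfl ht
  obtain ⟨j, hj⟩ := mem_iUnion.1 ht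
  have anti := rad_strictAnti h0 h1
  have h2 := anti.lt_iff_gt.1 hj.1
  have h3 := anti.lt_iff_gt.1 hj.2
  omega

section Linear

variable {N : Measure ℝ} [IsFiniteMeasure N]

/-- Conformality on shell $j$ gives $N(0,r_j)=N(0,r_{j+1})+c_j\,N(0,r_{j-1})$, where $r_j$ is `rad l
j` and $c_j$ is `contr l j`. This two-term recursion determines all values from the total mass, so
two consecutive ones are carried through the induction. -/
lemma measureReal_Ioo_rad (h0 : 0 < l) (h1 : l < 1 / 2) (hN : N (⋃ k, shell l k)ᶜ = 0)
    (hT : ∀ k E, MeasurableSet E → E ⊆ Ioo 0 (rad l (k - 1)) →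
      N (shell l k ∩ T l ⁻¹' E) = ENNReal.ofReal (contr l k) * N E) (k : ℕ) :
    N.real (Ioo 0 (rad l k)) = l ^ k * N.real univ ∧
      N.real (Ioo 0 (rad l (k + 1))) = l ^ (k + 1) * N.real univ := by
  have anti := rad_strictAnti h0 h1
  have hz : N.real (Ioo 0 (rad l 0)) = N.real univ := by
    rw [measureReal_def, measureReal_def, measure_eq_measure_of_null_sdiff (subset_univ _)]
    refine measure_mono_null ?_ hN
    rintro t ⟨-, ht⟩ ht'
    obtain ⟨j, hj⟩ := mem_iUnion.1 ht'
    exact ht (shell_subset h0 h1 (Nat.zero_le j) hj)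
  have hsplit : ∀ j, N.real (Ioo 0 (rad l j)) =
      N.real (Ioo 0 (rad l (j + 1))) + contr l j * N.real (Ioo 0 (rad l (j - 1))) := by
    intro j
    have e : Ioo 0 (rad l j) = (Ioo 0 (rad l (j + 1)) ∪ {rad l (j + 1)}) ∪ shell l j := by
      rw [Ioo_union_right (rad_pos h0 _), shell,
        Ioc_union_Ioo_eq_Ioo (rad_pos h0 _).le (anti (Nat.lt_succ_self j))]
    have hd1 : Disjoint (Ioo 0 (rad l (j + 1)) ∪ {rad l (j + 1)}) (shell l j) := by
      rw [Ioo_union_right (rad_pos h0 _)]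
      exact disjoint_left.2 fun t ht ht' => by linarith [ht.2, ht'.1]
    have hd2 : Disjoint (Ioo 0 (rad l (j + 1))) {rad l (j + 1)} := by simp
    rw [e, measureReal_union hd1 (measurableSet_shell j), measureReal_union hd2
      (measurableSet_singleton _), measureReal_rad_eq_zero h0 h1 hN, add_zero]
    have h3 := hT j (Ioo 0 (rad l (j - 1))) measurableSet_Ioo subset_rfl
    rw [inter_eq_left.2 (show shell l j ⊆ T l ⁻¹' Ioo 0 (rad l (j - 1)) from
      fun t ht => T_mem_of_shell h0 h1 ht)] at h3
    rw [measureReal_def, measureReal_def, measureReal_def, h3, ENNReal.toReal_mul,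
      ENNReal.toReal_ofReal (contr_pos h0 h1 j).le]
  induction k with
  | zero =>
    refine ⟨by rw [hz, pow_zero, one_mul], ?_⟩
    have := hsplit 0
    rw [contr_zero, Nat.zero_sub, hz] at this
    linear_combination -this
  | succ k ih =>
    refine ⟨ih.2, ?_⟩
    have := hsplit (k + 1)
    rw [contr_succ, Nat.add_sub_cancel, ih.1, ih.2] at this
    linear_combination -this

/-- The deviation of the distribution function from the linear one is contracted by the branch
containing `x`. The branch reverses orientation, hence the sign and the exchange of open and
half-open intervals; both are followed because atoms are not excluded beforehand. -/
lemma measureReal_Ioo_Ioc_step (h0 : 0 < l) (h1 : l < 1 / 2) (hN : N (⋃ k, shell l k)ᶜ = 0)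
    (hT : ∀ k E, MeasurableSet E → E ⊆ Ioo 0 (rad l (k - 1)) →
      N (shell l k ∩ T l ⁻¹' E) = ENNReal.ofReal (contr l k) * N E) {k : ℕ} {x : ℝ}
    (hx : x ∈ shell l k) :
    N.real (Ioo 0 x) - 2 * x * N.real univ =
        -(contr l k * (N.real (Ioc 0 (T l x)) - 2 * T l x * N.real univ)) ∧
      N.real (Ioc 0 x) - 2 * x * N.real univ =
        -(contr l k * (N.real (Ioo 0 (T l x)) - 2 * T l x * N.real univ)) := by
  have hy := T_mem_of_shell h0 h1 hx
  have hc := contr_pos h0 h1 k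
  have hx0 : 0 < x := (rad_pos h0 _).trans hx.1
  have hxe : x = rad l k - contr l k * T l x := (invBranch_T h0 h1 hx).symm
  have hb := (measureReal_Ioo_rad h0 h1 hN hT k).1
  have hr : l ^ k = 2 * rad l k := by simp [rad]; ring
  have e1 : Ico x (rad l k) = shell l k ∩ T l ⁻¹' Ioc 0 (T l x) := by
    ext t
    constructor
    · intro ht
      have hts : t ∈ shell l k := ⟨hx.1.trans_le ht.1, ht.2⟩
      refine ⟨hts, (T_mem_of_shell h0 h1 hts).1, ?_⟩
      rw [T_of_mem h0 h1 (mem_Ioc_of_shell hts), T_of_mem h0 h1 (mem_Ioc_of_shell hx)]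
      exact div_le_div_of_nonneg_right (by linarith [ht.1]) hc.le
    · rintro ⟨ht, ht'⟩
      refine ⟨?_, ht.2⟩
      rw [← invBranch_T h0 h1 ht, hxe, invBranch]
      have := mul_le_mul_of_nonneg_left ht'.2 hc.le
      linarith
  have e2 : Ioo x (rad l k) = shell l k ∩ T l ⁻¹' Ioo 0 (T l x) := by
    ext t
    constructor
    · intro ht
      have hts : t ∈ shell l k := ⟨hx.1.trans ht.1, ht.2⟩
      refine ⟨hts, (T_mem_of_shell h0 h1 hts).1, ?_⟩
      rw [T_of_mem h0 h1 (mem_Ioc_of_shell hts), T_of_mem h0 h1 (mem_Ioc_of_shell hx)]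
      exact div_lt_div_of_pos_right (by linarith [ht.1]) hc
    · rintro ⟨ht, ht'⟩
      refine ⟨?_, ht.2⟩
      rw [← invBranch_T h0 h1 ht, hxe, invBranch]
      have := mul_lt_mul_of_pos_left ht'.2 hc
      linarith
  have hT' : ∀ E, MeasurableSet E → E ⊆ Ioo 0 (rad l (k - 1)) →
      N.real (shell l k ∩ T l ⁻¹' E) = contr l k * N.real E := by
    intro E hE hE'
    rw [measureReal_def, hT k E hE hE', ENNReal.toReal_mul, ENNReal.toReal_ofReal hc.le,
      measureReal_def]
  have s1 : N.real (Ioo 0 (rad l k)) = N.real (Ioo 0 x) + contr l k * N.real (Ioc 0 (T l x)) := by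
    rw [← hT' _ measurableSet_Ioc fun t ht => ⟨ht.1, ht.2.trans_lt hy.2⟩, ← e1,
      ← measureReal_union _ measurableSet_Ico, Ioo_union_Ico_eq_Ioo hx0 hx.2.le]
    exact disjoint_left.2 fun t ht ht' => by linarith [ht.2, ht'.1]
  have s2 : N.real (Ioo 0 (rad l k)) = N.real (Ioc 0 x) + contr l k * N.real (Ioo 0 (T l x)) := by
    rw [← hT' _ measurableSet_Ioo fun t ht => ⟨ht.1, ht.2.trans hy.2⟩, ← e2,
      ← measureReal_union _ measurableSet_Ioo, Ioc_union_Ioo_eq_Ioo hx0.le hx.2]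
    exact disjoint_left.2 fun t ht ht' => by linarith [ht.2, ht'.1]
  constructor
  · linear_combination -s1 + hb + hr * N.real univ - 2 * N.real univ * hxe
  · linear_combination -s2 + hb + hr * N.real univ - 2 * N.real univ * hxe

/-- Iteration of the contraction; at the break points, where no branch applies, the deviation
vanishes by `measureReal_Ioo_rad`. -/
lemma abs_measureReal_sub_le (h0 : 0 < l) (h1 : l < 1 / 2) (hN : N (⋃ k, shell l k)ᶜ = 0)
    (hT : ∀ k E, MeasurableSet E → E ⊆ Ioo 0 (rad l (k - 1)) →
      N (shell l k ∩ T l ⁻¹' E) = ENNReal.ofReal (contr l k) * N E) (n : ℕ) :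
    ∀ x ∈ Ioo (0 : ℝ) (1 / 2),
      |N.real (Ioo 0 x) - 2 * x * N.real univ| ≤ (1 - l) ^ n * N.real univ ∧
      |N.real (Ioc 0 x) - 2 * x * N.real univ| ≤ (1 - l) ^ n * N.real univ := by
  have hu : 0 ≤ N.real univ := measureReal_nonneg
  have h2 : 0 < 1 - l := by linarith
  induction n with
  | zero =>
    intro x hx
    have hx1 := hx.1
    have hx2 := hx.2
    have a1 : N.real (Ioo 0 x) ≤ N.real univ := measureReal_mono (subset_univ _)
    have a2 : N.real (Ioc 0 x) ≤ N.real univ := measureReal_mono (subset_univ _)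
    have a3 : 0 ≤ N.real (Ioo 0 x) := measureReal_nonneg
    have a4 : 0 ≤ N.real (Ioc 0 x) := measureReal_nonneg
    have a5 : 0 ≤ 2 * x * N.real univ := by positivity
    have a6 : 2 * x * N.real univ ≤ N.real univ := by nlinarith
    rw [pow_zero, one_mul, abs_le, abs_le]
    refine ⟨⟨?_, ?_⟩, ?_, ?_⟩ <;> linarith
  | succ n ih =>
    intro x hx
    have hpos : 0 ≤ (1 - l) ^ (n + 1) * N.real univ := by positivity
    obtain ⟨k, hk⟩ := exists_mem_Ioc h0 h1 hx.1 hx.2.le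
    rcases eq_or_lt_of_le hk.2 with h | h
    · have hb := (measureReal_Ioo_rad h0 h1 hN hT k).1
      have hr : l ^ k = 2 * rad l k := by simp [rad]; ring
      rw [hr, ← h] at hb
      have hc : N.real (Ioc 0 x) = N.real (Ioo 0 x) := by
        rw [← Ioo_union_right hx.1, measureReal_union (by simp) (measurableSet_singleton _), h,
          measureReal_rad_eq_zero h0 h1 hN, add_zero]
      rw [hc, hb, sub_self, abs_zero]
      exact ⟨hpos, hpos⟩
    · have hs : x ∈ shell l k := ⟨hk.1, h⟩
      obtain ⟨s1, s2⟩ := measureReal_Ioo_Ioc_step h0 h1 hN hT hs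
      have hy := T_mem_of_shell h0 h1 hs
      obtain ⟨i1, i2⟩ := ih (T l x) ⟨hy.1, hy.2.trans_le (rad_le_half h0 h1 _)⟩
      have hc := contr_pos h0 h1 k
      have hc' := contr_le h0 h1 k
      rw [s1, s2, abs_neg, abs_neg, abs_mul, abs_mul, abs_of_pos hc, pow_succ']
      rw [mul_assoc (1 - l)]
      exact ⟨mul_le_mul hc' i2 (abs_nonneg _) h2.le, mul_le_mul hc' i1 (abs_nonneg _) h2.le⟩

/-- A finite measure which is conformal for `T` is a multiple of Lebesgue measure. -/
lemma eq_volume_of_conformal (h0 : 0 < l) (h1 : l < 1 / 2) (hN : N (⋃ k, shell l k)ᶜ = 0)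
    (hT : ∀ k E, MeasurableSet E → E ⊆ Ioo 0 (rad l (k - 1)) →
      N (shell l k ∩ T l ⁻¹' E) = ENNReal.ofReal (contr l k) * N E) :
    N = (2 * N univ) • volume.restrict (Ioo 0 (1 / 2)) := by
  have hcar : N (Ioo 0 (1 / 2))ᶜ = 0 := by
    refine measure_mono_null (compl_subset_compl.2 (iUnion_subset fun k => ?_)) hN
    have := shell_subset h0 h1 (Nat.zero_le k)
    rwa [rad_zero] at this
  have hIoc : ∀ x ∈ Ioo (0 : ℝ) (1 / 2), N.real (Ioc 0 x) = 2 * x * N.real univ := by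
    intro x hx
    have hlim : Tendsto (fun n : ℕ => (1 - l) ^ n * N.real univ) atTop (𝓝 0) := by
      simpa using (tendsto_pow_atTop_nhds_zero_of_lt_one (by linarith : 0 ≤ 1 - l)
        (by linarith)).mul_const (N.real univ)
    have := ge_of_tendsto' hlim fun n => (abs_measureReal_sub_le h0 h1 hN hT n x hx).2
    exact sub_eq_zero.1 (abs_nonpos_iff.1 this)
  have : IsFiniteMeasure ((2 * N univ) • volume.restrict (Ioo (0 : ℝ) (1 / 2))) :=
    Measure.smul_finite _ (ENNReal.mul_ne_top (by simp) (measure_ne_top _ _))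
  refine Measure.ext_of_Iic _ _ fun a => ?_
  have hz : N (Iic a \ Ioo 0 (1 / 2)) = 0 := measure_mono_null (fun t ht => ht.2) hcar
  rw [← measure_inter_add_sdiff (Iic a) (measurableSet_Ioo (a := (0 : ℝ)) (b := 1 / 2)), hz, add_zero,
    Measure.smul_apply,
    Measure.restrict_apply measurableSet_Iic, smul_eq_mul]
  rcases le_or_gt a 0 with ha | ha
  · have : Iic a ∩ Ioo (0 : ℝ) (1 / 2) = ∅ := by
      ext t; simp only [mem_inter_iff, mem_Iic, mem_Ioo, mem_empty_iff_false, iff_false]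
      intro h; linarith [h.1, h.2.1]
    rw [this]; simp
  rcases le_or_gt (1 / 2) a with ha' | ha'
  · rw [inter_eq_right.2 fun t ht => ht.2.le.trans ha', Real.volume_Ioo,
      measure_eq_measure_of_null_sdiff (subset_univ _) (by rwa [← compl_eq_univ_sdiff]),
      mul_comm 2, mul_assoc, show (2 : ENNReal) = ENNReal.ofReal 2 by simp,
      ← ENNReal.ofReal_mul (by norm_num)]
    norm_num
  · have e : Iic a ∩ Ioo (0 : ℝ) (1 / 2) = Ioc 0 a := by
      ext t; simp only [mem_inter_iff, mem_Iic, mem_Ioo, mem_Ioc]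
      constructor
      · intro h; exact ⟨h.2.1, h.1⟩
      · intro h; exact ⟨h.2, h.1, by linarith [h.2]⟩
    rw [e, Real.volume_Ioc, ← ENNReal.toReal_eq_toReal_iff' (measure_ne_top _ _)
      (ENNReal.mul_ne_top (ENNReal.mul_ne_top (by simp) (measure_ne_top _ _)) ENNReal.ofReal_ne_top),
      ← measureReal_def, hIoc a ⟨ha, ha'⟩, ENNReal.toReal_mul, ENNReal.toReal_mul,
      ENNReal.toReal_ofReal (by linarith), measureReal_def]
    simp; ring

end Linear

end

/-! ## Uniqueness of the reinduced measure -/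

section

variable {l : ℝ} {m : Measure ℝ}

lemma phihat_congr (h0 : 0 < l) (h1 : l < 1 / 2) {x y : ℝ} (hx : x ∈ retDomain l)
    (h : |x - 1 / 2| = |y - 1 / 2|) : y ∈ retDomain l ∧ phihat l x = phihat l y := by
  have hy : y ∈ retDomain l := by
    rw [mem_retDomain h0 h1, ← h]; exact (mem_retDomain h0 h1).1 hx
  refine ⟨hy, ?_⟩
  rw [← neg_inj, ← Real.exp_eq_exp, exp_neg_phihat h0 h1 hx, exp_neg_phihat h0 h1 hy, h]

lemma dist_reflect (x : ℝ) : |x - 1 / 2| = |1 - x - 1 / 2| := by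
  rw [← abs_neg]; ring_nf

lemma IsConformal.measure_image {D : Set ℝ} {F p : ℝ → ℝ} (hm : IsConformal D F p m) {A : Set ℝ}
    (hA : MeasurableSet A) (hAD : A ⊆ D) (hinj : InjOn F A) {c : ℝ}
    (hc : ∀ x ∈ A, Real.exp (-p x) = c) : m (F '' A) = ENNReal.ofReal c * m A := by
  rw [hm.conformal A hA hAD hinj, setLIntegral_congr_fun (g := fun _ => ENNReal.ofReal c) hA
    (fun x hx => by rw [hc x hx]), setLIntegral_const]

lemma exists_nhds_injOn (h0 : 0 < l) (h1 : l < 1 / 2) {x : ℝ} (hx : x ∈ retDomain l) :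
    ∃ U ∈ 𝓝 x, (∀ y ∈ U, y ∈ retDomain l ∧ phihat l y = phihat l x) ∧
      InjOn (fun y => |Fhat l y - 1 / 2|) U := by
  obtain ⟨a, b, -, hb, hloc⟩ := Fhat_local h0 h1 hx
  have hb0 : b ≠ 0 := by
    intro h
    rw [h, abs_zero] at hb
    exact (Real.exp_pos _).ne hb
  refine ⟨_, hloc, fun y hy => ⟨hy.1, hy.2.1⟩, fun y hy z hz h => ?_⟩
  have h : |Fhat l y - 1 / 2| = |Fhat l z - 1 / 2| := h
  rw [hy.2.2.2, hz.2.2.2] at h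
  have := mul_left_cancel₀ hb0 (add_left_cancel h)
  linarith

lemma injOn_of_injOn_dist {F : ℝ → ℝ} {A : Set ℝ} (h : InjOn (fun y => |F y - 1 / 2|) A) :
    InjOn F A := fun x hx y hy e => h hx hy (by simp only [e])

lemma measurable_reflect : Measurable fun x : ℝ => 1 - x := by fun_prop

/-- Conformal measures are symmetric. -/
lemma IsConformal.map_reflect (h0 : 0 < l) (h1 : l < 1 / 2)
    (hm : IsConformal (retDomain l) (Fhat l) (phihat l) m) : m.map (fun x => 1 - x) = m := by
  have hD := measurableSet_retDomain h0 h1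
  refine (measure_ext_of_locally hD hm.carried ?_ fun x hx => ?_).symm
  · rw [Measure.map_apply measurable_reflect hD.compl]
    refine measure_mono_null (t := (retDomain l)ᶜ) (fun x hx hxD => hx ?_) hm.carried
    exact (phihat_congr h0 h1 hxD (dist_reflect x)).1
  · obtain ⟨U, hU, hUD, hinj⟩ := exists_nhds_injOn h0 h1 hx
    refine ⟨U, hU, fun A hA hAU => ?_⟩
    rw [Measure.map_apply measurable_reflect hA]
    have hAD : A ⊆ retDomain l := fun y hy => (hAU hy).2
    have hinjA : InjOn (Fhat l) A := (injOn_of_injOn_dist hinj).mono fun y hy => (hAU hy).1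
    have hsym : ∀ y ∈ (fun x : ℝ => 1 - x) ⁻¹' A, y ∈ retDomain l ∧ Fhat l y = Fhat l (1 - y) ∧
        phihat l y = phihat l (1 - y) := fun y hy => by
      obtain ⟨h2, h3⟩ := phihat_congr h0 h1 (hAD hy) (dist_reflect y).symm
      exact ⟨h2, Fhat_congr h0 h1 h2 (dist_reflect y), h3.symm⟩
    have i1 := hm.measure_image hA hAD hinjA (c := Real.exp (-phihat l x))
      fun y hy => by rw [(hUD y (hAU hy).1).2]
    have i2 := hm.measure_image (measurable_reflect hA) (fun y hy => (hsym y hy).1)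
      (fun y hy z hz e => ?_) (c := Real.exp (-phihat l x))
      fun y hy => by rw [(hsym y hy).2.2, (hUD _ (hAU hy).1).2]
    -- A set and its reflection have the same image and the same potential, so conformality gives
    -- them the same mass.
    · have himg : Fhat l '' ((fun x : ℝ => 1 - x) ⁻¹' A) = Fhat l '' A := by
        ext w
        constructor
        · rintro ⟨y, hy, rfl⟩
          exact ⟨1 - y, hy, ((hsym y hy).2.1).symm⟩
        · rintro ⟨y, hy, rfl⟩
          have hy' : 1 - y ∈ (fun x : ℝ => 1 - x) ⁻¹' A := by simpa using hy
          refine ⟨1 - y, hy', ?_⟩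
          rw [(hsym _ hy').2.1]; simp
      rw [himg, i1] at i2
      exact (ENNReal.mul_right_inj (by simpa using Real.exp_pos _) ENNReal.ofReal_ne_top).1 i2
    · rw [(hsym y hy).2.1, (hsym z hz).2.1] at e
      have := hinjA hy hz e
      linarith

lemma IsConformal.measure_reflect (h0 : 0 < l) (h1 : l < 1 / 2)
    (hm : IsConformal (retDomain l) (Fhat l) (phihat l) m) {A : Set ℝ} (hA : MeasurableSet A) :
    m ((fun x => 1 - x) ⁻¹' A) = m A := by
  conv_rhs => rw [← hm.map_reflect h0 h1]
  rw [Measure.map_apply measurable_reflect hA]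

/-- This allows masses to be compared through distances alone: two sets with the same distances to
$\frac12$, each meeting a pair $\{x,1-x\}$ at most once, have equal mass even if they lie on
different sides. -/
lemma IsConformal.two_mul_measure (h0 : 0 < l) (h1 : l < 1 / 2)
    (hm : IsConformal (retDomain l) (Fhat l) (phihat l) m) {B : Set ℝ} (hB : MeasurableSet B)
    (hinj : InjOn (fun x => |x - 1 / 2|) B) (hhalf : (1 / 2 : ℝ) ∉ B) :
    2 * m B = m {x | |x - 1 / 2| ∈ (fun x => |x - 1 / 2|) '' B} := by
  have e : {x : ℝ | |x - 1 / 2| ∈ (fun x => |x - 1 / 2|) '' B} = B ∪ (fun x => 1 - x) ⁻¹' B := by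
    ext x
    constructor
    · rintro ⟨b, hb, h⟩
      have h : |b - 1 / 2| = |x - 1 / 2| := h
      rcases abs_eq_abs.1 h with h | h
      · left; rwa [show x = b by linarith]
      · right; rw [mem_preimage, show 1 - x = b by linarith]; exact hb
    · rintro (h | h)
      · exact ⟨x, h, rfl⟩
      · exact ⟨1 - x, h, (dist_reflect x).symm⟩
  rw [e, measure_union _ (measurable_reflect hB), hm.measure_reflect h0 h1 hB, two_mul]
  refine disjoint_left.2 fun x hx hx' => ?_
  have := hinj hx hx' (dist_reflect x)
  have h2 : x = 1 / 2 := by linarith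
  exact hhalf (h2 ▸ hx)

/-! ### The conformal measure seen after one step -/

/-- The points of `V̂_1` to the right of `1 / 2` whose image has distance in `E` to `1 / 2`. -/
def rightPre (l : ℝ) (E : Set ℝ) : Set ℝ := {x | x - 1 / 2 ∈ shell l 0 ∧ T l (x - 1 / 2) ∈ E}

lemma measurableSet_rightPre (h0 : 0 < l) (h1 : l < 1 / 2) {E : Set ℝ} (hE : MeasurableSet E) :
    MeasurableSet (rightPre l E) := by
  have h : Measurable fun x : ℝ => x - 1 / 2 := by fun_prop
  exact (h (measurableSet_shell 0)).inter (((measurable_T h0 h1).comp h) hE)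

lemma abs_of_sub_mem_shell (h0 : 0 < l) {k : ℕ} {x : ℝ} (hx : x - 1 / 2 ∈ shell l k) :
    |x - 1 / 2| = x - 1 / 2 := abs_of_pos ((rad_pos h0 _).trans hx.1)

lemma injOn_dist_of_shell (h0 : 0 < l) {B : Set ℝ} (hB : ∀ x ∈ B, x - 1 / 2 ∈ shell l 0) :
    InjOn (fun x => |x - 1 / 2|) B := by
  intro x hx y hy h
  have h : |x - 1 / 2| = |y - 1 / 2| := h
  rw [abs_of_sub_mem_shell h0 (hB x hx), abs_of_sub_mem_shell h0 (hB y hy)] at h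
  linarith

lemma half_notMem_of_shell (h0 : 0 < l) {B : Set ℝ} (hB : ∀ x ∈ B, x - 1 / 2 ∈ shell l 0) :
    (1 / 2 : ℝ) ∉ B := fun h => by
  have := (hB _ h).1
  linarith [rad_pos h0 (0 + 1)]

lemma mem_shell_of_retDomain (h0 : 0 < l) (h1 : l < 1 / 2) {x : ℝ} (hx : x ∈ retDomain l) :
    |x - 1 / 2| ∈ shell l 0 := by
  have hx' := (mem_retDomain h0 h1).1 hx
  obtain ⟨k, hk⟩ := orbit_mem_shell h0 h1 hx' (i := 0) (by have := (ret_spec hx').1; omega)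
  obtain rfl := eq_zero_of_mem_base h0 h1 hk hx'.1
  exact hk

lemma T_mem_shell_of_retBase (h0 : 0 < l) (h1 : l < 1 / 2) {t : ℝ} (ht : t ∈ retBase l) :
    ∃ k, T l t ∈ shell l k := by
  rcases eq_or_lt_of_le (ret_spec ht).1 with h | h
  · have := That_mem_shell h0 h1 ht
    rw [← h] at this
    exact ⟨0, this⟩
  · exact orbit_mem_shell h0 h1 ht h

lemma IsConformal.measure_T_preimage (h0 : 0 < l) (h1 : l < 1 / 2)
    (hm : IsConformal (retDomain l) (Fhat l) (phihat l) m) {E : Set ℝ} (hE : MeasurableSet E) :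
    m {x | T l |x - 1 / 2| ∈ E} = 2 * m (rightPre l E) := by
  have hsub : ∀ x ∈ rightPre l E, x - 1 / 2 ∈ shell l 0 := fun x hx => hx.1
  rw [hm.two_mul_measure h0 h1 (measurableSet_rightPre h0 h1 hE) (injOn_dist_of_shell h0 hsub)
    (half_notMem_of_shell h0 hsub)]
  refine le_antisymm ?_ (measure_mono ?_)
  · have hz : m ({x : ℝ | T l |x - 1 / 2| ∈ E} \ retDomain l) = 0 :=
      measure_mono_null (fun x hx => hx.2) hm.carried
    rw [← measure_inter_add_sdiff {x : ℝ | T l |x - 1 / 2| ∈ E} (measurableSet_retDomain h0 h1),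
      hz, add_zero]
    refine measure_mono fun x hx => ⟨1 / 2 + |x - 1 / 2|, ⟨?_, ?_⟩, ?_⟩
    · rw [add_sub_cancel_left]; exact mem_shell_of_retDomain h0 h1 hx.2
    · rw [add_sub_cancel_left]; exact hx.1
    · simp
  · rintro x ⟨y, hy, hxy⟩
    have hxy : |y - 1 / 2| = |x - 1 / 2| := hxy
    rw [mem_ofPred_eq, ← hxy, abs_of_sub_mem_shell h0 hy.1]
    exact hy.2

lemma jac_one {t : ℝ} (h0 : 0 < l) (h1 : l < 1 / 2) (ht : t ∈ shell l 0) :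
    jac l 1 t = (1 - l)⁻¹ := by
  rw [jac_succ, Function.iterate_zero, id_eq, idx_of_mem h0 h1 (mem_Ioc_of_shell ht), contr_zero]
  simp [jac]

lemma one_sub_ne_zero (h1 : l < 1 / 2) : ENNReal.ofReal (1 - l) ≠ 0 := by
  rw [ne_eq, ENNReal.ofReal_eq_zero]; linarith

/-- The scaling of a conformal measure under the direct branch. -/
lemma IsConformal.measure_direct (h0 : 0 < l) (h1 : l < 1 / 2)
    (hm : IsConformal (retDomain l) (Fhat l) (phihat l) m) {B : Set ℝ} (hB : MeasurableSet B)
    (hBs : ∀ x ∈ B, x - 1 / 2 ∈ shell l 0) :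
    m (rightPre l ((fun t => 1 / 2 + t) ⁻¹' B)) = ENNReal.ofReal (1 - l) * m B := by
  have hpre : MeasurableSet ((fun t : ℝ => 1 / 2 + t) ⁻¹' B) :=
    (by fun_prop : Measurable fun t : ℝ => 1 / 2 + t) hB
  have hA := measurableSet_rightPre h0 h1 hpre
  have hT : ∀ x ∈ rightPre l ((fun t : ℝ => 1 / 2 + t) ⁻¹' B),
      T l |x - 1 / 2| ∈ shell l 0 ∧ x ∈ retDomain l ∧ Fhat l x = 1 / 2 + T l (x - 1 / 2) ∧
      Real.exp (-phihat l x) = (1 - l)⁻¹ := by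
    intro x hx
    have ha := abs_of_sub_mem_shell h0 hx.1
    have h2 : T l |x - 1 / 2| ∈ shell l 0 := by
      have := hBs _ hx.2
      rwa [add_sub_cancel_left, ← ha] at this
    obtain ⟨h3, h4⟩ := Fhat_of_T_mem h0 h1 (by rw [ha]; exact hx.1) (shell_zero_subset h2)
    refine ⟨h2, h3, by rw [h4, ha], ?_⟩
    rw [exp_neg_phihat h0 h1 h3, ret_eq_one (shell_zero_subset h2),
      jac_one h0 h1 (by rw [ha]; exact hx.1)]
  have hinj : InjOn (Fhat l) (rightPre l ((fun t : ℝ => 1 / 2 + t) ⁻¹' B)) := by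
    intro x hx y hy e
    rw [(hT x hx).2.2.1, (hT y hy).2.2.1] at e
    have e := add_left_cancel e
    have := invBranch_T h0 h1 hx.1
    rw [e, invBranch_T h0 h1 hy.1] at this
    linarith
  have himg : Fhat l '' rightPre l ((fun t : ℝ => 1 / 2 + t) ⁻¹' B) = B := by
    ext w
    constructor
    · rintro ⟨x, hx, rfl⟩
      rw [(hT x hx).2.2.1]; exact hx.2
    · intro hw
      have hw' := shell_subset h0 h1 (j := 0 - 1) le_rfl (hBs w hw)
      have hx : 1 / 2 + invBranch l 0 (w - 1 / 2) ∈
          rightPre l ((fun t : ℝ => 1 / 2 + t) ⁻¹' B) := by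
        refine ⟨?_, ?_⟩
        · rw [add_sub_cancel_left]; exact invBranch_mem h0 h1 hw'
        · rw [add_sub_cancel_left, T_invBranch h0 h1 hw', mem_preimage, add_sub_cancel]; exact hw
      refine ⟨_, hx, ?_⟩
      rw [(hT _ hx).2.2.1, add_sub_cancel_left, T_invBranch h0 h1 hw', add_sub_cancel]
  have := hm.measure_image hA (fun x hx => (hT x hx).2.1) hinj fun x hx => (hT x hx).2.2.2
  rw [himg] at this
  rw [this, ENNReal.ofReal_inv_of_pos (by linarith), ← mul_assoc,
    ENNReal.mul_inv_cancel (one_sub_ne_zero h1) ENNReal.ofReal_ne_top, one_mul]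

/-- Skipping one step of the orbit outside of `V̂_1`. -/
lemma skip_step (h0 : 0 < l) (h1 : l < 1 / 2) {k : ℕ} {t t' : ℝ} (hk : k ≠ 0) (ht : t ∈ shell l 0)
    (ht' : t' ∈ shell l 0) (htk : T l t ∈ shell l k) (htt : T l t' = T l (T l t))
    (hD : t ∈ retBase l ∨ t' ∈ retBase l) :
    t ∈ retBase l ∧ t' ∈ retBase l ∧ ret l t = ret l t' + 1 ∧
      (T l)^[ret l t] t = (T l)^[ret l t'] t' ∧
      jac l (ret l t) t = jac l (ret l t') t' * (contr l k)⁻¹ := by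
  have hiter : ∀ i, (T l)^[i + 2] t = (T l)^[i + 1] t' := by
    intro i
    rw [Function.iterate_succ_apply, Function.iterate_succ_apply, Function.iterate_succ_apply, htt]
  have hnot : T l t ∉ base l := fun hb => hk (eq_zero_of_mem_base h0 h1 htk hb)
  have hD' : t' ∈ retBase l := by
    rcases hD with ⟨-, n, hn, hb⟩ | h
    · obtain ⟨i, rfl⟩ : ∃ i, n = i + 2 := by
        refine ⟨n - 2, ?_⟩
        have : n ≠ 1 := by rintro rfl; exact hnot hb
        omega
      exact ⟨shell_zero_subset ht', i + 1, by omega, by rwa [← hiter]⟩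
    · exact h
  obtain ⟨hr, hrb⟩ := ret_spec hD'
  obtain ⟨j, hj⟩ : ∃ j, ret l t' = j + 1 := ⟨ret l t' - 1, by omega⟩
  rw [hj] at hrb
  have hret : ret l t = j + 2 := by
    refine ret_eq (by omega) (by rwa [hiter]) fun i hi hi' => ?_
    rcases eq_or_lt_of_le hi with rfl | hi
    · exact hnot
    · obtain ⟨i, rfl⟩ : ∃ i', i = i' + 2 := ⟨i - 2, by omega⟩
      rw [hiter]
      exact not_mem_base_of_lt_ret (by omega) (by omega)
  refine ⟨⟨shell_zero_subset ht, j + 2, by omega, by rwa [hiter]⟩, hD', by omega, ?_, ?_⟩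
  · rw [hret, hj, hiter]
  · rw [hret, hj, jac, jac, Finset.prod_range_succ', Finset.prod_range_succ',
      Finset.prod_range_succ' _ j]
    simp only [zero_add, hiter, Function.iterate_zero, id_eq, Function.iterate_one]
    rw [idx_of_mem h0 h1 (mem_Ioc_of_shell ht), idx_of_mem h0 h1 (mem_Ioc_of_shell ht'),
      idx_of_mem h0 h1 (mem_Ioc_of_shell htk)]
    ring

/-- The scaling of a conformal measure when a step outside of `V̂_1` is skipped. -/
lemma IsConformal.measure_skip (h0 : 0 < l) (h1 : l < 1 / 2)
    (hm : IsConformal (retDomain l) (Fhat l) (phihat l) m) {k : ℕ} (hk : k ≠ 0) {E : Set ℝ}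
    (hE : MeasurableSet E) (hEk : E ⊆ Ioo 0 (rad l (k - 1))) :
    m (rightPre l (shell l k ∩ T l ⁻¹' E)) = ENNReal.ofReal (contr l k) * m (rightPre l E) := by
  have hD := measurableSet_retDomain h0 h1
  have hTm := measurable_T h0 h1
  have hprob := hm.prob
  set J := Ioo 0 (rad l (k - 1)) with hJ
  have hJ0 : J ⊆ Ioo 0 (rad l (0 - 1)) := fun t ht => ⟨ht.1, ht.2.trans_le (by
    rw [rad_zero]; exact rad_le_half h0 h1 _)⟩
  -- `h` deletes the visit to shell `k`: it sends `x`, whose orbit visits shells `0` and `k`, to the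
  -- point of the right component whose first image has the distance that the orbit of `x` has after
  -- two steps.
  set h : ℝ → ℝ := fun x => 1 / 2 + invBranch l 0 (T l (T l (x - 1 / 2))) with hh
  have hmeas : Measurable h := by
    have : Measurable (invBranch l 0) := by unfold invBranch; fun_prop
    exact (this.comp (hTm.comp (hTm.comp (by fun_prop : Measurable fun x : ℝ => x - 1 / 2)))).const_add _
  set Q := rightPre l (shell l k) with hQ
  have hQm : MeasurableSet Q := measurableSet_rightPre h0 h1 (measurableSet_shell k)
  have hRm : MeasurableSet (rightPre l J) := measurableSet_rightPre h0 h1 measurableSet_Ioo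
  have hspec : ∀ x ∈ Q, T l (T l (x - 1 / 2)) ∈ J ∧ h x - 1 / 2 ∈ shell l 0 ∧
      T l (h x - 1 / 2) = T l (T l (x - 1 / 2)) := by
    intro x hx
    have h2 := T_mem_of_shell h0 h1 hx.2
    simp only [hh, add_sub_cancel_left]
    exact ⟨h2, invBranch_mem h0 h1 (hJ0 h2), T_invBranch h0 h1 (hJ0 h2)⟩
  have hskip : ∀ x ∈ Q, x ∈ retDomain l ∨ h x ∈ retDomain l → x ∈ retDomain l ∧
      h x ∈ retDomain l ∧ |Fhat l x - 1 / 2| = |Fhat l (h x) - 1 / 2| ∧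
      Real.exp (-phihat l x) = Real.exp (-phihat l (h x)) * (contr l k)⁻¹ := by
    intro x hx hor
    obtain ⟨h2, h3, h4⟩ := hspec x hx
    have a1 := abs_of_sub_mem_shell h0 hx.1
    have a2 := abs_of_sub_mem_shell h0 h3
    rw [mem_retDomain h0 h1, mem_retDomain h0 h1, a1, a2] at hor
    obtain ⟨b1, b2, b3, b4, b5⟩ := skip_step h0 h1 hk hx.1 h3 hx.2 h4 hor
    have c1 : x ∈ retDomain l := by rwa [mem_retDomain h0 h1, a1]
    have c2 : h x ∈ retDomain l := by rwa [mem_retDomain h0 h1, a2]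
    refine ⟨c1, c2, ?_, ?_⟩
    · rw [dist_Fhat h0 h1, dist_Fhat h0 h1, a1, a2, b4]
    · rw [exp_neg_phihat h0 h1 c1, exp_neg_phihat h0 h1 c2, a1, a2, b5]
  have hinjQ : InjOn h Q := by
    intro x hx y hy e
    have e2 := (hspec x hx).2.2
    rw [e, (hspec y hy).2.2] at e2
    have e3 := congrArg (invBranch l k) e2
    rw [invBranch_T h0 h1 hx.2, invBranch_T h0 h1 hy.2] at e3
    have e4 := congrArg (invBranch l 0) e3
    rw [invBranch_T h0 h1 hx.1, invBranch_T h0 h1 hy.1] at e4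
    linarith
  have hsurj : ∀ y ∈ rightPre l J, ∃ x ∈ Q, h x = y := by
    intro y hy
    have h2 := invBranch_mem h0 h1 hy.2
    have h3 := shell_subset h0 h1 (j := 0 - 1) (Nat.zero_le k) h2
    refine ⟨1 / 2 + invBranch l 0 (invBranch l k (T l (y - 1 / 2))), ⟨?_, ?_⟩, ?_⟩
    · rw [add_sub_cancel_left]; exact invBranch_mem h0 h1 h3
    · rw [add_sub_cancel_left, T_invBranch h0 h1 h3]; exact h2
    · simp only [hh, add_sub_cancel_left]
      rw [T_invBranch h0 h1 h3, T_invBranch h0 h1 hy.2, invBranch_T h0 h1 hy.1, add_sub_cancel]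
  -- Conformality only speaks of sets on which `Fhat` is injective, so the two measures are compared
  -- locally. The Jacobians at `x` and `h x` differ by the factor $1/$`contr l k`.
  have key : (m.restrict Q).map h = ENNReal.ofReal (contr l k) • m.restrict (rightPre l J) := by
    refine measure_ext_of_locally hD ?_ ?_ fun y hy => ?_
    · rw [Measure.map_apply hmeas hD.compl, Measure.restrict_apply (hmeas hD.compl)]
      refine measure_mono_null ?_ hm.carried
      rintro x ⟨hx, hxQ⟩ hxD
      exact hx (hskip x hxQ (.inl hxD)).2.1
    · rw [Measure.smul_apply, Measure.restrict_apply hD.compl,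
        measure_mono_null inter_subset_left hm.carried, smul_zero]
    · obtain ⟨U, hU, hUD, hinj⟩ := exists_nhds_injOn h0 h1 hy
      refine ⟨U, hU, fun A hA hAU => ?_⟩
      rw [Measure.map_apply hmeas hA, Measure.restrict_apply (hmeas hA), Measure.smul_apply,
        Measure.restrict_apply hA, smul_eq_mul]
      have hA1m : MeasurableSet (h ⁻¹' A ∩ Q) := (hmeas hA).inter hQm
      have hA2m : MeasurableSet (A ∩ rightPre l J) := hA.inter hRm
      have hA1 : ∀ x ∈ h ⁻¹' A ∩ Q, x ∈ retDomain l ∧ h x ∈ retDomain l ∧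
          |Fhat l x - 1 / 2| = |Fhat l (h x) - 1 / 2| ∧
          Real.exp (-phihat l x) = Real.exp (-phihat l (h x)) * (contr l k)⁻¹ :=
        fun x hx => hskip x hx.2 (.inr (hAU hx.1).2)
      have hinj1 : InjOn (fun x => |Fhat l x - 1 / 2|) (h ⁻¹' A ∩ Q) := by
        intro x hx z hz e
        have e : |Fhat l x - 1 / 2| = |Fhat l z - 1 / 2| := e
        rw [(hA1 x hx).2.2.1, (hA1 z hz).2.2.1] at e
        exact hinjQ hx.2 hz.2 (hinj (hAU hx.1).1 (hAU hz.1).1 e)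
      have hinj2 : InjOn (fun x => |Fhat l x - 1 / 2|) (A ∩ rightPre l J) :=
        hinj.mono fun x hx => (hAU hx.1).1
      have i1 := hm.measure_image hA1m (fun x hx => (hA1 x hx).1) (injOn_of_injOn_dist hinj1)
        (c := Real.exp (-phihat l y) * (contr l k)⁻¹) fun x hx => by
          rw [(hA1 x hx).2.2.2, (hUD _ (hAU hx.1).1).2]
      have i2 := hm.measure_image hA2m (fun x hx => (hAU hx.1).2) (injOn_of_injOn_dist hinj2)
        (c := Real.exp (-phihat l y)) fun x hx => by rw [(hUD _ (hAU hx.1).1).2]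
      have hFm := measurable_Fhat h0 h1
      have hhalf : ∀ x ∈ retDomain l, Fhat l x ≠ 1 / 2 := by
        intro x hx e
        have := (mem_Vhat_zero h0).1 (Fhat_mem_Vhat h0 h1 hx)
        rw [e, sub_self, abs_zero] at this
        exact mem_base_of_zero this h0
      have himg : ∀ {A' : Set ℝ}, InjOn (fun x => |Fhat l x - 1 / 2|) A' →
          InjOn (fun x => |x - 1 / 2|) (Fhat l '' A') := by
        rintro A' hA' _ ⟨x, hx, rfl⟩ _ ⟨z, hz, rfl⟩ e
        rw [hA' hx hz e]
      have t1 := hm.two_mul_measure h0 h1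
        (hA1m.image_of_measurable_injOn hFm (injOn_of_injOn_dist hinj1)) (himg hinj1)
        (by rintro ⟨x, hx, e⟩; exact hhalf x (hA1 x hx).1 e)
      have t2 := hm.two_mul_measure h0 h1
        (hA2m.image_of_measurable_injOn hFm (injOn_of_injOn_dist hinj2)) (himg hinj2)
        (by rintro ⟨x, hx, e⟩; exact hhalf x (hAU hx.1).2 e)
      -- Deleting a step may change the side of the return point but not its distance, which is all
      -- that `two_mul_measure` needs.
      have heq : (fun x => |x - 1 / 2|) '' (Fhat l '' (h ⁻¹' A ∩ Q)) =
          (fun x => |x - 1 / 2|) '' (Fhat l '' (A ∩ rightPre l J)) := by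
        ext w
        simp only [image_image, mem_image]
        constructor
        · rintro ⟨x, hx, rfl⟩
          refine ⟨h x, ⟨hx.1, (hspec x hx.2).2.1, ?_⟩, ((hA1 x hx).2.2.1).symm⟩
          rw [(hspec x hx.2).2.2]; exact (hspec x hx.2).1
        · rintro ⟨z, ⟨hzA, hzJ⟩, rfl⟩
          obtain ⟨x, hxQ, rfl⟩ := hsurj z hzJ
          exact ⟨x, ⟨hzA, hxQ⟩, (hA1 x ⟨hzA, hxQ⟩).2.2.1⟩
      rw [heq, ← t2, ENNReal.mul_right_inj (by simp) (by simp), i1, i2,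
        ENNReal.ofReal_mul (Real.exp_pos _).le, mul_assoc,
        ENNReal.mul_right_inj (by simpa using Real.exp_pos _) ENNReal.ofReal_ne_top,
        ENNReal.ofReal_inv_of_pos (contr_pos h0 h1 k)] at t1
      rw [← t1, ← mul_assoc, ENNReal.mul_inv_cancel
        (by rw [ne_eq, ENNReal.ofReal_eq_zero, not_le]; exact contr_pos h0 h1 k)
        ENNReal.ofReal_ne_top, one_mul]
  have hEm := measurableSet_rightPre h0 h1 hE
  have e1 : rightPre l (shell l k ∩ T l ⁻¹' E) = h ⁻¹' rightPre l E ∩ Q := by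
    ext x
    constructor
    · rintro ⟨hx, hxk, hxE⟩
      have hxQ : x ∈ Q := ⟨hx, hxk⟩
      refine ⟨⟨(hspec x hxQ).2.1, ?_⟩, hxQ⟩
      rw [(hspec x hxQ).2.2]; exact hxE
    · rintro ⟨⟨-, hxE⟩, hxQ⟩
      rw [(hspec x hxQ).2.2] at hxE
      exact ⟨hxQ.1, hxQ.2, hxE⟩
  have e2 : rightPre l E ∩ rightPre l J = rightPre l E :=
    inter_eq_left.2 fun x hx => ⟨hx.1, hEk hx.2⟩
  have := DFunLike.congr_fun key (rightPre l E)
  rwa [Measure.map_apply hmeas hEm, Measure.restrict_apply (hmeas hEm), Measure.smul_apply,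
    Measure.restrict_apply hEm, e2, ← e1, smul_eq_mul] at this

/-- A conformal measure is normalized Lebesgue measure on the right component of `V̂_1`. -/
lemma IsConformal.measure_right (h0 : 0 < l) (h1 : l < 1 / 2)
    (hm : IsConformal (retDomain l) (Fhat l) (phihat l) m) {B : Set ℝ} (hB : MeasurableSet B)
    (hBs : ∀ x ∈ B, x - 1 / 2 ∈ shell l 0) :
    ENNReal.ofReal (1 - l) * m B = volume B := by
  have hprob := hm.prob
  have hTd : Measurable fun x : ℝ => T l |x - 1 / 2| := (measurable_T h0 h1).comp measurable_dist
  -- `N` is the distribution of the distance after one step of `F`. It charges all shells and is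
  -- conformal for `T`: by `measure_direct` on shell `0` and by `measure_skip` on the others. Hence
  -- it is twice Lebesgue measure on $(0,\frac12)$, and `measure_direct` transfers this back to `m`.
  set N : Measure ℝ := m.map fun x => T l |x - 1 / 2| with hN
  have hNprob : IsProbabilityMeasure N := Measure.isProbabilityMeasure_map hTd.aemeasurable
  have hNapp : ∀ {E : Set ℝ}, MeasurableSet E → N E = 2 * m (rightPre l E) := fun {E} hE => by
    rw [hN, Measure.map_apply hTd hE]
    exact hm.measure_T_preimage h0 h1 hE
  have hshell : MeasurableSet (⋃ k, shell l k) := MeasurableSet.iUnion fun k => measurableSet_shell k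
  have hlin := eq_volume_of_conformal (N := N) h0 h1 ?_ ?_
  · have hpre : MeasurableSet ((fun t : ℝ => 1 / 2 + t) ⁻¹' B) :=
      (by fun_prop : Measurable fun t : ℝ => 1 / 2 + t) hB
    have h2 := hNapp hpre
    rw [hm.measure_direct h0 h1 hB hBs, hlin, measure_univ, mul_one, Measure.smul_apply,
      Measure.restrict_apply hpre, smul_eq_mul, inter_eq_left.2, measure_preimage_add,
      ENNReal.mul_right_inj (by simp) (by simp)] at h2
    · exact h2.symm
    · intro t ht
      have := shell_subset h0 h1 (j := 0) le_rfl (hBs _ ht)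
      rwa [add_sub_cancel_left, rad_zero] at this
  · rw [hN, Measure.map_apply hTd hshell.compl]
    refine measure_mono_null (t := (retDomain l)ᶜ) (fun x hx hxD => hx ?_) hm.carried
    exact mem_iUnion.2 (T_mem_shell_of_retBase h0 h1 ((mem_retDomain h0 h1).1 hxD))
  · intro k E hE hEk
    have hpre := (measurableSet_shell (l := l) k).inter (measurable_T h0 h1 hE)
    rw [hNapp hpre, hNapp hE]
    rcases Nat.eq_zero_or_pos k with rfl | hk
    · have e : shell l 0 ∩ T l ⁻¹' E = (fun t => 1 / 2 + t) ⁻¹' rightPre l E := by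
        ext t; simp [rightPre]
      rw [e, hm.measure_direct h0 h1 (measurableSet_rightPre h0 h1 hE) fun x hx => hx.1, contr_zero]
      ring
    · rw [hm.measure_skip h0 h1 hk.ne' hE hEk]
      ring

/-- Conformal measures are unique. -/
lemma IsConformal.unique (h0 : 0 < l) (h1 : l < 1 / 2)
    (hm : IsConformal (retDomain l) (Fhat l) (phihat l) m) {m' : Measure ℝ}
    (hm' : IsConformal (retDomain l) (Fhat l) (phihat l) m') : m = m' := by
  have hright : ∀ {B : Set ℝ}, MeasurableSet B → (∀ x ∈ B, x - 1 / 2 ∈ shell l 0) → m B = m' B := by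
    intro B hB hBs
    have := (hm.measure_right h0 h1 hB hBs).trans (hm'.measure_right h0 h1 hB hBs).symm
    exact (ENNReal.mul_right_inj (one_sub_ne_zero h1) ENNReal.ofReal_ne_top).1 this
  refine measure_ext_of_locally (measurableSet_retDomain h0 h1) hm.carried hm'.carried fun x hx => ?_
  rcases lt_or_gt_of_ne (ne_half_of_mem_retDomain h0 hx) with hlt | hgt
  · refine ⟨Iio (1 / 2), Iio_mem_nhds hlt, fun A hA hAU => ?_⟩
    rw [← hm.measure_reflect h0 h1 hA, ← hm'.measure_reflect h0 h1 hA]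
    refine hright (measurable_reflect hA) fun y hy => ?_
    obtain ⟨h2, h3⟩ := hAU hy
    have h2 : 1 - y < 1 / 2 := h2
    have := mem_shell_of_retDomain h0 h1 h3
    rwa [← dist_reflect, abs_of_pos (by linarith)] at this
  · refine ⟨Ioi (1 / 2), Ioi_mem_nhds hgt, fun A hA hAU => hright hA fun y hy => ?_⟩
    obtain ⟨h2, h3⟩ := hAU hy
    have h2 : 1 / 2 < y := h2
    have := mem_shell_of_retDomain h0 h1 h3
    rwa [abs_of_pos (by linarith)] at this

/-! ### Ergodicity -/

/-- The normalized restriction of a conformal measure to an invariant set is conformal. -/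
lemma IsConformal.restrict {D A : Set ℝ} {F p : ℝ → ℝ} (hm : IsConformal D F p m)
    (hA : MeasurableSet A) (hAF : F ⁻¹' A = A) (hD : MeasurableSet D) (hF : Measurable F)
    (hpos : m A ≠ 0) : IsConformal D F p ((m A)⁻¹ • m.restrict A) := by
  have hprob := hm.prob
  refine ⟨⟨?_⟩, ?_, fun B hB hBD hinj => ?_⟩
  · rw [Measure.smul_apply, Measure.restrict_apply_univ, smul_eq_mul,
      ENNReal.inv_mul_cancel hpos (measure_ne_top _ _)]
  · rw [Measure.smul_apply, Measure.restrict_apply hD.compl,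
      measure_mono_null inter_subset_left hm.carried, smul_zero]
  · have hFB := hB.image_of_measurable_injOn hF hinj
    have e : F '' B ∩ A = F '' (B ∩ A) := by
      conv_rhs => rw [← hAF]
      exact image_inter_preimage F B A |>.symm
    rw [Measure.smul_apply, Measure.restrict_apply hFB, e, Measure.restrict_smul,
      lintegral_smul_measure, Measure.restrict_restrict hB,
      hm.conformal _ (hB.inter hA) (inter_subset_left.trans hBD) (hinj.mono inter_subset_left)]

/-- If an invariant set has positive conformal measure, its normalized restriction is conformal,
hence equal to the original measure, and the complement is null. -/
lemma ergodic_invMeasure (h0 : 0 < l) (h1 : l < 1 / 2) : Ergodic (Fhat l) (invMeasure l) := by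
  have hF := measurable_Fhat h0 h1
  refine ⟨measurePreserving_invMeasure h0 h1, ⟨fun A hA hAF => ?_⟩⟩
  have hm := isConformal_refMeasure h0 h1
  rw [eventuallyConst_set']
  by_cases hpos : refMeasure l A = 0
  · left
    exact ae_eq_empty.2 (invMeasure_absolutelyContinuous h0 h1 hpos)
  · right
    refine ae_eq_univ.2 (invMeasure_absolutelyContinuous h0 h1 ?_)
    rw [(hm.unique h0 h1 (hm.restrict hA hAF (measurableSet_retDomain h0 h1) hF hpos)),
      Measure.smul_apply, Measure.restrict_apply hA.compl, compl_inter_self, measure_empty, smul_zero]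

lemma isReinducedMeasure_invMeasure (h0 : 0 < l) (h1 : l < 1 / 2) :
    IsReinducedMeasure l (invMeasure l) :=
  have := isProbabilityMeasure_refMeasure h0 h1
  ⟨Measure.isProbabilityMeasure_map (measurable_Fhat h0 h1).aemeasurable,
    measurePreserving_invMeasure h0 h1, refMeasure l, isConformal_refMeasure h0 h1,
    invMeasure_absolutelyContinuous h0 h1, refMeasure_absolutelyContinuous h0 h1⟩

lemma IsReinducedMeasure.eq_invMeasure (h0 : 0 < l) (h1 : l < 1 / 2) {ν : Measure ℝ}
    (hν : IsReinducedMeasure l ν) : ν = invMeasure l := by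
  obtain ⟨hprob, hinv, m, hm, hνm, -⟩ := hν
  have := (isReinducedMeasure_invMeasure h0 h1).prob
  obtain rfl := hm.unique h0 h1 (isConformal_refMeasure h0 h1)
  exact (ergodic_invMeasure h0 h1).eq_of_absolutelyContinuous hinv
    (hνm.trans (refMeasure_absolutelyContinuous h0 h1))

end

/-! ## The tail of the inducing time -/

section

variable {l : ℝ}

/-- The set `{τ > N}` in the coordinate `|x - 1 / 2|`. -/
def tailSet (l : ℝ) (N : ℕ) : Set ℝ :=
  {t | t ∈ retBase l ∧ N < ∑ i ∈ Finset.range (ret l t), S (idx l ((T l)^[i] t))}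

/-- The points that are stopped when entering `V̂_1` or getting `rad l K`-close to `1 / 2`. -/
def stopSet (l : ℝ) (K : ℕ) : Set ℝ := base l ∪ Ioc 0 (rad l K)

/-- The indicator of getting `rad l K`-close to `1 / 2` before entering `V̂_1`, or of doing neither
before time `n`. -/
def deep (l : ℝ) (K : ℕ) : ℕ → ℝ → ENNReal :=
  stopped l (stopSet l K) ((Ioc 0 (rad l K)).indicator 1) 0 1

/-- The time spent, before entering `V̂_1`, in the first `K` shells. -/
def shallowTime (l : ℝ) (K : ℕ) : ℕ → ℝ → ENNReal :=
  stopped l (base l) 0 (fun t => ENNReal.ofReal (if idx l t < K then (S (idx l t) : ℝ) else 0)) 0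

lemma measurable_idx : Measurable (idx l) :=
  measurable_sInf_nat (p := fun k t => rad l (k + 1) < t) fun _ => measurableSet_Ioi

lemma measurableSet_tailSet (h0 : 0 < l) (h1 : l < 1 / 2) (N : ℕ) :
    MeasurableSet (tailSet l N) := by
  have h2 : Measurable fun t => ∑ i ∈ Finset.range (ret l t), S (idx l ((T l)^[i] t)) := by
    refine measurable_apply_nat (g := fun n t => ∑ i ∈ Finset.range n, S (idx l ((T l)^[i] t)))
      (fun n => Finset.measurable_sum _ fun i _ => ?_) (measurable_ret h0 h1)
    exact (measurable_of_countable S).comp (measurable_idx.comp ((measurable_T h0 h1).iterate i))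
  exact (measurableSet_retBase h0 h1).inter (h2 measurableSet_Ioi)

/-- On the domain `tau` depends only on the distance, whose distribution is that of normalized
Lebesgue measure. -/
lemma invMeasure_tail (h0 : 0 < l) (h1 : l < 1 / 2) (N : ℕ) :
    invMeasure l {x | N < tau l x} = (ENNReal.ofReal (mass l 0))⁻¹ * volume (tailSet l N) := by
  have hA := measurableSet_tailSet h0 h1 N
  have hcar := invMeasure_retDomain_compl h0 h1
  have e1 : invMeasure l {x | N < tau l x} =
      invMeasure l ((fun x => |x - 1 / 2|) ⁻¹' tailSet l N) := by
    refine measure_congr ?_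
    have : ∀ᵐ x ∂invMeasure l, x ∈ retDomain l := by rw [ae_iff]; exact hcar
    filter_upwards [this] with x hx
    refine propext ?_
    change N < tau l x ↔ _ ∧ _
    rw [tau_eq h0 h1 hx]
    exact ⟨fun h => ⟨(mem_retDomain h0 h1).1 hx, h⟩, fun h => h.2⟩
  have hsub : (fun x => |x - 1 / 2|) ⁻¹' tailSet l N ⊆ retDomain l := fun x hx =>
    (mem_retDomain h0 h1).2 hx.1
  rw [e1, ← Measure.map_apply measurable_dist hA, map_dist_invMeasure h0 h1,
    Measure.map_apply measurable_dist hA, refMeasure, Measure.smul_apply,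
    Measure.restrict_apply (measurable_dist hA), inter_eq_left.2 hsub]
  have e2 : volume ((fun x : ℝ => |x - 1 / 2|) ⁻¹' tailSet l N) = 2 * volume (tailSet l N) :=
    volume_dist_preimage hA fun t ht => base_subset h0 ht.1.1
  have h2 : 0 < 1 - l := by linarith
  rw [e2, smul_eq_mul, ← mul_assoc, show (2 : ENNReal) = ENNReal.ofReal 2 by simp,
    ← ENNReal.ofReal_inv_of_pos h2, ← ENNReal.ofReal_inv_of_pos (mass_pos h0 h1 0),
    ← ENNReal.ofReal_mul (by positivity), mass, rad_zero]
  congr 2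
  field_simp

lemma mem_stopSet_iff (h0 : 0 < l) (h1 : l < 1 / 2) (K k : ℕ) (t : ℝ) (ht : t ∈ shell l k) :
    t ∈ stopSet l K ↔ k ∈ {k | k = 0 ∨ K ≤ k} := by
  have anti := rad_strictAnti h0 h1
  refine or_congr (mem_base_iff h0 h1 k t ht) ⟨fun h => ?_, fun h => ?_⟩
  · have := anti.lt_iff_gt.1 (ht.1.trans_le h.2)
    omega
  · exact ⟨(rad_pos h0 _).trans ht.1, ht.2.le.trans (anti.antitone h)⟩

lemma lintegral_indicator_deep (h0 : 0 < l) (h1 : l < 1 / 2) (K k : ℕ) :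
    ∫⁻ t in shell l k, (Ioc 0 (rad l K)).indicator (1 : ℝ → ENNReal) t =
      if K ≤ k then ENNReal.ofReal (mass l k) else 0 := by
  have anti := rad_strictAnti h0 h1
  rw [lintegral_indicator_one measurableSet_Ioc, Measure.restrict_apply measurableSet_Ioc]
  split_ifs with h
  · rw [inter_eq_right.2 (show shell l k ⊆ Ioc 0 (rad l K) from fun t ht =>
      ⟨(rad_pos h0 _).trans ht.1, ht.2.le.trans (anti.antitone h)⟩), volume_shell]
  · convert measure_empty (μ := volume)
    refine eq_empty_of_forall_notMem fun t ht => ?_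
    have := anti.lt_iff_gt.1 (ht.2.1.trans_le ht.1.2)
    omega

/-! ### The probability of reaching a deep shell -/

/-- The probability of reaching a shell of index at least `K` from the `k`-th shell before
returning. -/
def hitProb (l : ℝ) (K k : ℕ) : ℝ :=
  if k < K then (theta l ^ k - 1) / (theta l ^ (K + 1) - 1) else 1

lemma theta_pow_sub_one_pos (h0 : 0 < l) (h1 : l < 1 / 2) (K : ℕ) :
    0 < theta l ^ (K + 1) - 1 :=
  sub_pos.2 (one_lt_pow₀ (one_lt_theta h0 h1) (by omega))

lemma hitProb_mem (h0 : 0 < l) (h1 : l < 1 / 2) (K k : ℕ) :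
    0 ≤ hitProb l K k ∧ hitProb l K k ≤ 1 := by
  have h2 := one_lt_theta h0 h1
  have h3 := theta_pow_sub_one_pos h0 h1 K
  unfold hitProb
  split_ifs with h
  · refine ⟨div_nonneg (sub_nonneg.2 (one_le_pow₀ h2.le)) h3.le, ?_⟩
    rw [div_le_one h3]
    have := pow_le_pow_right₀ h2.le (show k ≤ K + 1 by omega)
    linarith
  · simp

/-- Upward jumps are geometric, hence memoryless: on reaching level $K$ the mean of $\theta^k$ is
$\theta^K\sum_i(1-l)l^i\theta^i=\theta^{K+1}$, whatever the starting point. This explains the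
denominator in `hitProb` and why that function is harmonic between $0$ and $K$. -/
lemma hasSum_hitProb (h0 : 0 < l) (h1 : l < 1 / 2) (j q : ℕ) :
    HasSum (fun i => (1 - l) * l ^ i * hitProb l (j + q) (j + i))
      ((theta l ^ (j + 1) - 1) / (theta l ^ (j + q + 1) - 1)) := by
  have h3 := (theta_pow_sub_one_pos h0 h1 (j + q)).ne'
  have hth : theta l = (1 - l) / l := rfl
  rw [← hasSum_nat_add_iff' q]
  -- The terms beyond level $K$: a jump reaches it with probability $l^q$.
  have htail : HasSum (fun i => (1 - l) * l ^ (i + q) * hitProb l (j + q) (j + (i + q))) (l ^ q) := by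
    convert hasSum_step_const h0 h1 (l ^ q) using 2 with i
    rw [hitProb, if_neg (by omega), pow_add]; ring
  suffices e : (theta l ^ (j + 1) - 1) / (theta l ^ (j + q + 1) - 1) - ∑ i ∈ Finset.range q,
      (1 - l) * l ^ i * hitProb l (j + q) (j + i) = l ^ q by rw [e]; exact htail
  have hfin : ∀ i ∈ Finset.range q, (1 - l) * l ^ i * hitProb l (j + q) (j + i) =
      ((1 - l) * theta l ^ j * (1 - l) ^ i - (1 - l) * l ^ i) / (theta l ^ (j + q + 1) - 1) := by
    intro i hi
    have hi := Finset.mem_range.1 hi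
    rw [hitProb, if_pos (by omega), pow_add]
    have : l ^ i * theta l ^ i = (1 - l) ^ i := by rw [← mul_pow, l_mul_theta h0]
    rw [← this]; ring
  rw [Finset.sum_congr rfl hfin, ← Finset.sum_div, Finset.sum_sub_distrib, ← Finset.mul_sum,
    ← Finset.mul_sum, mul_neg_geom_sum l q]
  have hg : l * ∑ i ∈ Finset.range q, (1 - l) ^ i = 1 - (1 - l) ^ q := by
    have := mul_neg_geom_sum (1 - l) q
    rwa [sub_sub_cancel] at this
  have hg' : (1 - l) * theta l ^ j * ∑ i ∈ Finset.range q, (1 - l) ^ i =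
      theta l ^ (j + 1) * (1 - (1 - l) ^ q) := by
    rw [← hg, pow_succ]
    linear_combination (-(theta l ^ j) * ∑ i ∈ Finset.range q, (1 - l) ^ i) * l_mul_theta h0
  rw [hg', div_sub_div_same, div_eq_iff h3]
  have hq : l ^ q * theta l ^ q = (1 - l) ^ q := by rw [← mul_pow, l_mul_theta h0]
  rw [← hq]; ring

lemma le_lintegral_deep (h0 : 0 < l) (h1 : l < 1 / 2) {K : ℕ} (hK : 1 ≤ K) (n : ℕ) :
    ENNReal.ofReal ((theta l - 1) / (theta l ^ (K + 1) - 1) * mass l 0) ≤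
      ∫⁻ t in shell l 0, deep l K n (T l t) := by
  have hsum : ∀ k ∉ {k | k = 0 ∨ K ≤ k}, HasSum (fun i => (1 - l) * l ^ i * hitProb l K (k - 1 + i))
      (hitProb l K k) := by
    intro k hk
    simp only [mem_ofPred_eq, not_or, not_le] at hk
    have := hasSum_hitProb h0 h1 (k - 1) (K - (k - 1))
    rw [show k - 1 + (K - (k - 1)) = K by omega, show k - 1 + 1 = k by omega] at this
    rwa [show hitProb l K k = _ from if_pos hk.2]
  have hstopped : ∀ k, ENNReal.ofReal (hitProb l K k * mass l k) ≤ ∫⁻ t in shell l k, deep l K n t := by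
    intro k
    refine le_lintegral_stopped h0 h1 (mem_stopSet_iff h0 h1 K) (h := hitProb l K)
      (fun k => (hitProb_mem h0 h1 K k).1) (fun k => ?_) (fun k hk => ?_)
      (fun k hk => (hsum k hk).summable) (fun k hk => (hsum k hk).tsum_eq.ge) n k
    · rw [← ENNReal.ofReal_one]
      exact ENNReal.ofReal_le_ofReal (hitProb_mem h0 h1 K k).2
    · rw [lintegral_indicator_deep h0 h1]
      split_ifs with h
      · rw [hitProb, if_neg (by omega), one_mul]
      · obtain rfl : k = 0 := hk.resolve_right h
        simp [hitProb, show 0 < K by omega]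
  have h2 : HasSum (fun i => (1 - l) * l ^ i * hitProb l K (0 - 1 + i))
      ((theta l - 1) / (theta l ^ (K + 1) - 1)) := by
    have := hasSum_hitProb h0 h1 0 K
    simpa only [Nat.zero_sub, zero_add, pow_one] using this
  have := le_lintegral_comp_T h0 h1 (fun k => (hitProb_mem h0 h1 K k).1) hstopped (k := 0) h2.summable
  rwa [h2.tsum_eq] at this

/-- In the supersolution, $\theta^{k-K}$ dominates the stopping value $1$ for $k\ge K$, and the
decaying second term pays for the value $1$ at the time cut-off. -/
lemma lintegral_deep_le (h0 : 0 < l) (h1 : l < 1 / 2) (K n : ℕ) :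
    ∫⁻ t in shell l 0, deep l K n (T l t) ≤
      ENNReal.ofReal ((theta l / theta l ^ K + decay l ^ (n + 1) * √(theta l)) * mass l 0) := by
  have h2 := one_lt_theta h0 h1
  obtain ⟨h3, h4, h5, h6⟩ := sqrt_theta_facts h0 h1
  have hpos : ∀ n k : ℕ, 0 ≤ (theta l ^ K)⁻¹ * theta l ^ k + decay l ^ n * √(theta l) ^ k :=
    fun n k => by positivity
  have hsum : ∀ n j : ℕ, HasSum (fun i => (1 - l) * l ^ i *
      ((theta l ^ K)⁻¹ * theta l ^ (j + i) + decay l ^ n * √(theta l) ^ (j + i)))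
      ((theta l ^ K)⁻¹ * theta l ^ (j + 1) + decay l ^ (n + 1) * √(theta l) ^ (j + 1)) := by
    intro n j
    have := (hasSum_step_theta h0 h1 (theta l ^ K)⁻¹ j).add
      (hasSum_step_sqrt h0 h1 (decay l ^ n) j)
    rw [← pow_succ'] at this
    simpa only [← mul_add] using this
  have hstopped : ∀ k, ∫⁻ t in shell l k, deep l K n t ≤
      ENNReal.ofReal (((theta l ^ K)⁻¹ * theta l ^ k + decay l ^ n * √(theta l) ^ k) * mass l k) := by
    intro k
    refine lintegral_stopped_le h0 h1 (mem_stopSet_iff h0 h1 K) (c' := 0) (fun _ => le_rfl)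
      (by simp) (h := fun n k => (theta l ^ K)⁻¹ * theta l ^ k + decay l ^ n * √(theta l) ^ k)
      hpos (fun k => ?_) (fun n k _ => ?_) (fun n k _ => (hsum n (k - 1)).summable)
      (fun n k hk => ?_) n k
    · rw [← ENNReal.ofReal_one]
      refine ENNReal.ofReal_le_ofReal ?_
      have : 0 ≤ (theta l ^ K)⁻¹ * theta l ^ k := by positivity
      have := one_le_pow₀ h3.le (n := k)
      rw [pow_zero, one_mul]; linarith
    · rw [lintegral_indicator_deep h0 h1]
      split_ifs with h
      · refine ENNReal.ofReal_le_ofReal (le_mul_of_one_le_left (mass_pos h0 h1 k).le ?_)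
        have : 1 ≤ (theta l ^ K)⁻¹ * theta l ^ k := by
          rw [← div_eq_inv_mul, one_le_div (by positivity)]
          exact pow_le_pow_right₀ h2.le h
        have : 0 ≤ decay l ^ (n + 1) * √(theta l) ^ k := by positivity
        linarith
      · exact zero_le
    · simp only [mem_ofPred_eq, not_or] at hk
      rw [(hsum n (k - 1)).tsum_eq, Nat.sub_add_cancel (Nat.one_le_iff_ne_zero.2 hk.1)]
      simp
  have := lintegral_comp_T_le h0 h1 (hpos n) hstopped (k := 0) (hsum n (0 - 1)).summable
  rw [(hsum n (0 - 1)).tsum_eq] at this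
  refine this.trans_eq ?_
  simp only [Nat.zero_sub, zero_add, pow_one]
  ring_nf

/-! ### The time spent in shallow shells -/

/-- The minimum of a harmonic function and a constant is superharmonic. At level $j$ the defect is
at least $1-2l$: the downward jump contributes $(1-l)\theta^{-1}=l$, all other jumps at most $l$. So
$\min(\theta^{k-j},1)/(1-2l)$ bounds the expected number of visits to $j$ before returning. -/
lemma hasSum_step_min (h0 : 0 < l) (h1 : l < 1 / 2) (j k : ℕ) :
    Summable (fun i => (1 - l) * l ^ i * min (theta l ^ (k + i) / theta l ^ j) 1) ∧
      ∑' i, (1 - l) * l ^ i * min (theta l ^ (k + i) / theta l ^ j) 1 ≤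
        min (theta l ^ (k + 1) / theta l ^ j) 1 ∧
      (k + 1 = j → ∑' i, (1 - l) * l ^ i * min (theta l ^ (k + i) / theta l ^ j) 1 ≤ 2 * l) := by
  have hth := one_lt_theta h0 h1
  have h2 : 0 < 1 - l := by linarith
  have hone := hasSum_step_const h0 h1 1
  have hs : Summable (fun i => (1 - l) * l ^ i * min (theta l ^ (k + i) / theta l ^ j) 1) := by
    refine Summable.of_nonneg_of_le (fun i => by positivity) (fun i => ?_) hone.summable
    gcongr
    exact min_le_right _ _
  refine ⟨hs, le_min ?_ ?_, ?_⟩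
  · have ht := hasSum_step_theta h0 h1 (theta l ^ j)⁻¹ k
    rw [div_eq_inv_mul, ← ht.tsum_eq]
    refine hs.tsum_le_tsum (fun i => ?_) ht.summable
    rw [← div_eq_inv_mul]
    gcongr
    exact min_le_left _ _
  · refine (hs.tsum_le_tsum (fun i => ?_) hone.summable).trans_eq hone.tsum_eq
    gcongr
    exact min_le_right _ _
  · rintro rfl
    rw [hs.tsum_eq_zero_add]
    have htail : HasSum (fun i : ℕ => (1 - l) * l ^ (i + 1) * (1 : ℝ)) l := by
      convert hasSum_step_const h0 h1 l using 2 with i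
      rw [pow_succ]; ring
    have e1 : ∑' i, (1 - l) * l ^ (i + 1) * min (theta l ^ (k + (i + 1)) / theta l ^ (k + 1)) 1 ≤ l := by
      refine le_trans (((summable_nat_add_iff 1).2 hs).tsum_le_tsum (fun i => ?_) htail.summable)
        htail.tsum_eq.le
      gcongr
      exact min_le_right _ _
    have e2 : (1 - l) * l ^ 0 * min (theta l ^ (k + 0) / theta l ^ (k + 1)) 1 ≤ l := by
      have : theta l ^ (k + 0) / theta l ^ (k + 1) = l / (1 - l) := by
        rw [add_zero, pow_succ, theta]; field_simp
      calc (1 - l) * l ^ 0 * min (theta l ^ (k + 0) / theta l ^ (k + 1)) 1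
          ≤ (1 - l) * l ^ 0 * (theta l ^ (k + 0) / theta l ^ (k + 1)) := by
            gcongr; exact min_le_left _ _
        _ = l := by rw [this]; field_simp
    linarith

/-- The bound for the time spent in the first `K` shells. -/
def shallowBound (l : ℝ) (K k : ℕ) : ℝ :=
  ∑ j ∈ Finset.range K, (S j : ℝ) / (1 - 2 * l) * min (theta l ^ k / theta l ^ j) 1

lemma step_shallowBound (h0 : 0 < l) (h1 : l < 1 / 2) (K k : ℕ) :
    Summable (fun i => (1 - l) * l ^ i * shallowBound l K (k + i)) ∧
      ∑' i, (1 - l) * l ^ i * shallowBound l K (k + i) =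
        ∑ j ∈ Finset.range K, (S j : ℝ) / (1 - 2 * l) *
          ∑' i, (1 - l) * l ^ i * min (theta l ^ (k + i) / theta l ^ j) 1 := by
  have hterm : ∀ i, (1 - l) * l ^ i * shallowBound l K (k + i) = ∑ j ∈ Finset.range K,
      (S j : ℝ) / (1 - 2 * l) * ((1 - l) * l ^ i * min (theta l ^ (k + i) / theta l ^ j) 1) := by
    intro i
    rw [shallowBound, Finset.mul_sum]
    exact Finset.sum_congr rfl fun j _ => by ring
  have hs := hasSum_sum (s := Finset.range K) fun j _ =>
    ((hasSum_step_min h0 h1 j k).1.hasSum.mul_left ((S j : ℝ) / (1 - 2 * l)))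
  simp only [← hterm] at hs
  exact ⟨hs.summable, hs.tsum_eq⟩

lemma lintegral_shallowTime_le (h0 : 0 < l) (h1 : l < 1 / 2) (K n : ℕ) :
    ∫⁻ t in shell l 0, shallowTime l K n (T l t) ≤ ENNReal.ofReal
      ((∑ j ∈ Finset.range K, (S j : ℝ) / (1 - 2 * l) * (theta l / theta l ^ j)) * mass l 0) := by
  have hth := one_lt_theta h0 h1
  have h2 : 0 < 1 - 2 * l := by linarith
  have hnn : ∀ k, 0 ≤ shallowBound l K k := fun k =>
    Finset.sum_nonneg fun j _ => mul_nonneg (by positivity) (le_min (by positivity) zero_le_one)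
  have hstopped : ∀ k, ∫⁻ t in shell l k, shallowTime l K n t ≤
      ENNReal.ofReal (shallowBound l K k * mass l k) := by
    intro k
    refine lintegral_stopped_le h0 h1 (mem_base_iff h0 h1)
      (c' := fun k => if k < K then (S k : ℝ) else 0) (fun k => by split_ifs <;> positivity)
      (fun k t ht => by rw [idx_of_mem h0 h1 (mem_Ioc_of_shell ht)])
      (h := fun _ => shallowBound l K) (fun _ => hnn) (by simp) (by simp)
      (fun n k _ => (step_shallowBound h0 h1 K (k - 1)).1) (fun n k hk => ?_) n k
    have hk : k - 1 + 1 = k := Nat.sub_add_cancel (Nat.one_le_iff_ne_zero.2 hk)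
    rw [(step_shallowBound h0 h1 K (k - 1)).2]
    -- The running cost is split over the levels, and each part is paid by the defect at its own
    -- level.
    have hdelta : (if k < K then (S k : ℝ) else 0) =
        ∑ j ∈ Finset.range K, if j = k then (S j : ℝ) else 0 := by
      simp [Finset.sum_ite_eq']
    rw [hdelta, ← Finset.sum_add_distrib, shallowBound]
    refine Finset.sum_le_sum fun j _ => ?_
    obtain ⟨-, m1, m2⟩ := hasSum_step_min h0 h1 j (k - 1)
    rw [hk] at m1 m2
    split_ifs with hjk
    · subst hjk
      have m2 := m2 rfl
      rw [div_self (by positivity), min_self]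
      have : (S j : ℝ) / (1 - 2 * l) * ∑' i, (1 - l) * l ^ i *
          min (theta l ^ (j - 1 + i) / theta l ^ j) 1 ≤ (S j : ℝ) / (1 - 2 * l) * (2 * l) := by
        gcongr
      refine (add_le_add_right this _).trans_eq ?_
      field_simp; ring
    · rw [zero_add]
      gcongr
  have h3 := step_shallowBound h0 h1 K 0
  have := lintegral_comp_T_le h0 h1 hnn hstopped (k := 0) h3.1
  refine this.trans (ENNReal.ofReal_le_ofReal (mul_le_mul_of_nonneg_right ?_ (mass_pos h0 h1 0).le))
  refine h3.2.trans_le (Finset.sum_le_sum fun j _ => ?_)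
  gcongr
  refine (hasSum_step_min h0 h1 j 0).2.1.trans ((min_le_left _ _).trans_eq ?_)
  rw [zero_add, pow_one]

/-! ### Bounds for the tail -/

lemma deep_le_one (K n : ℕ) (t : ℝ) : deep l K n t ≤ 1 := by
  induction n generalizing t with
  | zero => exact le_rfl
  | succ n ih =>
    by_cases h : t ∈ stopSet l K
    · rw [deep, stopped_succ_of_mem n h]
      exact indicator_le_self' (fun _ _ => zero_le) t
    · rw [deep, stopped_succ_of_notMem n h, ← deep]
      simpa using ih (T l t)

lemma deep_eq_zero (h0 : 0 < l) (h1 : l < 1 / 2) {K n m : ℕ} (hK : 1 ≤ K) {t : ℝ} (hmn : m < n)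
    (hb : (T l)^[m] t ∈ base l)
    (h : ∀ i < m, (T l)^[i] t ∉ base l ∧ (T l)^[i] t ∉ Ioc 0 (rad l K)) : deep l K n t = 0 := by
  induction n generalizing m t with
  | zero => omega
  | succ n ih =>
    cases m with
    | zero =>
      rw [deep, stopped_succ_of_mem n (show t ∈ stopSet l K from .inl hb)]
      refine indicator_of_notMem (fun ht => ?_) _
      have h2 := (rad_strictAnti h0 h1).antitone hK
      exact absurd (hb.1.trans_le (ht.2.trans h2)) (lt_irrefl _)
    | succ m =>
      have h2 := h 0 (by omega)
      rw [deep, stopped_succ_of_notMem n (show t ∉ stopSet l K from fun h3 => h3.elim h2.1 h2.2),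
        ← deep, ih (m := m) (by omega) hb fun i hi => h (i + 1) (by omega)]
      simp

lemma one_le_deep_or_le_shallowTime (h0 : 0 < l) (h1 : l < 1 / 2) {K m : ℕ} {t : ℝ} (n : ℕ)
    (h : ∀ i < m, (T l)^[i] t ∉ base l ∧ ∃ k, (T l)^[i] t ∈ shell l k) :
    1 ≤ deep l K n t ∨
      ((∑ i ∈ Finset.range m, S (idx l ((T l)^[i] t)) : ℕ) : ENNReal) ≤ shallowTime l K n t := by
  induction n generalizing m t with
  | zero => exact .inl le_rfl
  | succ n ih =>
    cases m with
    | zero => exact .inr (by simp)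
    | succ m =>
      obtain ⟨hb, k, hk⟩ := h 0 (by omega)
      rw [Function.iterate_zero, id_eq] at hb hk
      by_cases hd : t ∈ Ioc 0 (rad l K)
      · left
        rw [deep, stopped_succ_of_mem n (show t ∈ stopSet l K from .inr hd),
          indicator_of_mem hd, Pi.one_apply]
      · rw [deep, stopped_succ_of_notMem n (show t ∉ stopSet l K from fun h3 => h3.elim hb hd), ← deep,
          shallowTime, stopped_succ_of_notMem n hb, ← shallowTime, Pi.zero_apply, zero_add]
        refine (ih (m := m) (t := T l t) fun i hi => h (i + 1) (by omega)).imp id fun hle => ?_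
        have hidx := idx_of_mem h0 h1 (mem_Ioc_of_shell hk)
        have hkK : k < K := by
          by_contra hle
          exact hd ⟨(rad_pos h0 _).trans hk.1,
            hk.2.le.trans ((rad_strictAnti h0 h1).antitone (not_lt.1 hle))⟩
        rw [Finset.sum_range_succ', Nat.cast_add, add_comm, Function.iterate_zero, id_eq, hidx,
          if_pos hkK, ENNReal.ofReal_natCast]
        gcongr
        exact hle

lemma S_mono : Monotone S := fun _ _ h => Nat.fib_mono (by omega)

/-- A visit to a shell of index at least `K` costs at least $S_K>N$. Hence `deep` is at most the
indicator of the tail set, up to the exponentially small set of points not returned by time `n`. -/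
lemma le_volume_tailSet (h0 : 0 < l) (h1 : l < 1 / 2) {K N : ℕ} (hK : 1 ≤ K) (hN : N < S K) :
    ENNReal.ofReal ((theta l - 1) / (theta l ^ (K + 1) - 1) * mass l 0) ≤ volume (tailSet l N) := by
  have hA := measurableSet_tailSet h0 h1 N
  have hpt : ∀ n, ∀ t ∈ shell l 0, deep l K n (T l t) ≤
      (tailSet l N).indicator 1 t + alive l n (T l t) := by
    intro n t ht
    by_cases hr : t ∈ retBase l ∧ ret l t ≤ n
    · obtain ⟨hr1, hrb⟩ := ret_spec hr.1
      have hiter : ∀ i, (T l)^[i] (T l t) = (T l)^[i + 1] t := fun i =>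
        (Function.iterate_succ_apply _ _ _).symm
      by_cases hd : ∃ i < ret l t - 1, (T l)^[i + 1] t ∈ Ioc 0 (rad l K)
      · obtain ⟨i, hi, hid⟩ := hd
        have hmem : t ∈ tailSet l N := by
          refine ⟨hr.1, hN.trans_le ?_⟩
          refine le_trans ?_ (Finset.single_le_sum (f := fun i => S (idx l ((T l)^[i] t)))
            (fun _ _ => Nat.zero_le _) (Finset.mem_range.2 (show i + 1 < ret l t by omega)))
          refine S_mono ?_
          obtain ⟨k, hk⟩ := orbit_mem_shell h0 h1 hr.1 (show i + 1 < ret l t by omega)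
          rw [idx_of_mem h0 h1 (mem_Ioc_of_shell hk)]
          have := (rad_strictAnti h0 h1).lt_iff_gt.1 (hk.1.trans_le hid.2)
          omega
        rw [indicator_of_mem hmem]
        exact (deep_le_one K n _).trans (le_add_right le_rfl)
      · push Not at hd
        rw [deep_eq_zero h0 h1 hK (m := ret l t - 1) (by omega)
          (by rwa [hiter, Nat.sub_add_cancel hr1]) fun i hi => ?_]
        · exact zero_le
        · rw [hiter]
          exact ⟨not_mem_base_of_lt_ret (by omega) (by omega), hd i hi⟩
    · rw [alive_eq_one fun i hi hb => hr ?_]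
      · exact (deep_le_one K n _).trans (le_add_left le_rfl)
      · rw [← Function.iterate_succ_apply] at hb
        refine ⟨⟨shell_zero_subset ht, i + 1, by omega, hb⟩, ?_⟩
        have : ret l t ≤ i + 1 := Nat.sInf_le ⟨by omega, hb⟩
        omega
  have hle : ∀ n : ℕ, ENNReal.ofReal ((theta l - 1) / (theta l ^ (K + 1) - 1) * mass l 0) ≤
      volume (tailSet l N) + ENNReal.ofReal (decay l ^ (n + 1) * (√(theta l) * mass l 0)) := by
    intro n
    refine (le_lintegral_deep h0 h1 hK n).trans ((setLIntegral_mono' (measurableSet_shell 0)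
      (hpt n)).trans ?_)
    rw [lintegral_add_left (measurable_one.indicator hA), lintegral_indicator_one hA,
      Measure.restrict_apply hA, ← mul_assoc]
    exact add_le_add (measure_mono inter_subset_left) (lintegral_alive_T_le h0 h1 n)
  have := (tendsto_decay h0 h1 (√(theta l) * mass l 0)).const_add (volume (tailSet l N))
  rw [add_zero] at this
  exact ge_of_tendsto' this hle

/-- Union bound: a point of the tail set gets deep or spends time at least `N` in the first `K`
shells; Markov's inequality handles the latter. -/
lemma volume_tailSet_le (h0 : 0 < l) (h1 : l < 1 / 2) (K : ℕ) {N : ℕ} (hN : 1 ≤ N) :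
    volume (tailSet l N) ≤ ENNReal.ofReal ((theta l / theta l ^ K +
      (∑ j ∈ Finset.range K, (S j : ℝ) / (1 - 2 * l) * (theta l / theta l ^ j)) / N) * mass l 0) := by
  have hA := measurableSet_tailSet h0 h1 N
  have hN0 : (0 : ℝ) < N := by exact_mod_cast hN
  have hth := one_lt_theta h0 h1
  have h2 : 0 < 1 - 2 * l := by linarith
  obtain ⟨h3, h4, h5, h6⟩ := sqrt_theta_facts h0 h1
  have hm := mass_pos h0 h1 0
  set B := ∑ j ∈ Finset.range K, (S j : ℝ) / (1 - 2 * l) * (theta l / theta l ^ j) with hB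
  have hB0 : 0 ≤ B := Finset.sum_nonneg fun j _ => by positivity
  have hsub : tailSet l N ⊆ shell l 0 := by
    intro t ht
    obtain ⟨k, hk⟩ := orbit_mem_shell h0 h1 ht.1 (i := 0) (by have := (ret_spec ht.1).1; omega)
    obtain rfl := eq_zero_of_mem_base h0 h1 hk ht.1.1
    exact hk
  have hpt : ∀ n, ∀ t ∈ tailSet l N,
      1 ≤ deep l K n (T l t) + (ENNReal.ofReal N)⁻¹ * shallowTime l K n (T l t) := by
    intro n t ht
    obtain ⟨hr1, hrb⟩ := ret_spec ht.1
    have hiter : ∀ i, (T l)^[i] (T l t) = (T l)^[i + 1] t := fun i =>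
      (Function.iterate_succ_apply _ _ _).symm
    rcases one_le_deep_or_le_shallowTime h0 h1 (K := K) (m := ret l t - 1) (t := T l t) n
      (fun i hi => by
        rw [hiter]
        exact ⟨not_mem_base_of_lt_ret (by omega) (by omega), orbit_mem_shell h0 h1 ht.1 (by omega)⟩)
      with h | h
    · exact h.trans (le_add_right le_rfl)
    · refine le_trans ?_ (le_add_left le_rfl)
      have hle : N ≤ ∑ i ∈ Finset.range (ret l t - 1), S (idx l ((T l)^[i] (T l t))) := by
        have h7 := ht.2
        rw [← Nat.sub_add_cancel hr1, Finset.sum_range_succ'] at h7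
        -- The starting shell contributes $S_0=1$, so after the first step the sum is still at least
        -- `N`, although not necessarily larger.
        have hi0 : idx l ((T l)^[0] t) = 0 := idx_of_mem h0 h1 (mem_Ioc_of_shell (hsub ht))
        rw [hi0, show S 0 = 1 from rfl] at h7
        simp only [hiter]
        omega
      have h8 : ENNReal.ofReal N ≤ shallowTime l K n (T l t) := by
        rw [ENNReal.ofReal_natCast]
        exact le_trans (by exact_mod_cast hle) h
      rw [← ENNReal.inv_mul_cancel (a := ENNReal.ofReal N) (ENNReal.ofReal_pos.2 hN0).ne'
        ENNReal.ofReal_ne_top]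
      gcongr
  have hle : ∀ n : ℕ, volume (tailSet l N) ≤
      ENNReal.ofReal ((theta l / theta l ^ K + B / N) * mass l 0) +
        ENNReal.ofReal (decay l ^ (n + 1) * (√(theta l) * mass l 0)) := by
    intro n
    have hdm : Measurable fun t => deep l K n (T l t) :=
      (measurable_stopped h0 h1 (measurableSet_base.union measurableSet_Ioc)
        (measurable_one.indicator measurableSet_Ioc) measurable_zero 1 n).comp (measurable_T h0 h1)
    calc volume (tailSet l N) = ∫⁻ t in tailSet l N, 1 := (setLIntegral_one _).symm
      _ ≤ ∫⁻ t in tailSet l N,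
          (deep l K n (T l t) + (ENNReal.ofReal N)⁻¹ * shallowTime l K n (T l t)) :=
        setLIntegral_mono' hA (hpt n)
      _ ≤ ∫⁻ t in shell l 0,
          (deep l K n (T l t) + (ENNReal.ofReal N)⁻¹ * shallowTime l K n (T l t)) :=
        lintegral_mono_set hsub
      _ ≤ ENNReal.ofReal ((theta l / theta l ^ K + decay l ^ (n + 1) * √(theta l)) * mass l 0) +
          (ENNReal.ofReal N)⁻¹ * ENNReal.ofReal (B * mass l 0) := by
        rw [lintegral_add_left hdm, lintegral_const_mul' _ _
          (ENNReal.inv_ne_top.2 (ENNReal.ofReal_pos.2 hN0).ne')]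
        gcongr
        · exact lintegral_deep_le h0 h1 K n
        · exact lintegral_shallowTime_le h0 h1 K n
      _ = _ := by
        rw [← ENNReal.ofReal_inv_of_pos hN0, ← ENNReal.ofReal_mul (by positivity),
          ← ENNReal.ofReal_add (by positivity) (by positivity),
          ← ENNReal.ofReal_add (by positivity) (by positivity)]
        congr 1
        ring
  have := (tendsto_decay h0 h1 (√(theta l) * mass l 0)).const_add
    (ENNReal.ofReal ((theta l / theta l ^ K + B / N) * mass l 0))
  rw [add_zero] at this
  exact ge_of_tendsto' this hle

end

/-! ## Polynomial bounds -/

section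

variable {l : ℝ}

/-! ### Comparison of the Fibonacci numbers with powers of the golden mean -/

open Real (goldenRatio goldenRatio_sq goldenRatio_pos one_lt_goldenRatio)

lemma S_succ_succ (k : ℕ) : S (k + 2) = S k + S (k + 1) := Nat.fib_add_two

lemma goldenRatio_pow_le_S (k : ℕ) : goldenRatio ^ k ≤ S k := by
  induction k using Nat.twoStepInduction with
  | zero => simp [S]
  | one =>
    have := Real.goldenRatio_lt_two
    simpa [S, Nat.fib] using this.le
  | more k ih1 ih2 =>
    rw [S_succ_succ, Nat.cast_add, pow_add, goldenRatio_sq, mul_add, mul_one, ← pow_succ, add_comm]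
    gcongr

lemma S_le_goldenRatio_pow (k : ℕ) : (S k : ℝ) ≤ goldenRatio ^ (k + 1) := by
  induction k using Nat.twoStepInduction with
  | zero => simpa [S] using one_lt_goldenRatio.le
  | one =>
    have := one_lt_goldenRatio
    have h2 : (S 1 : ℝ) = 2 := by norm_num [S, Nat.fib]
    rw [h2, goldenRatio_sq]; linarith
  | more k ih1 ih2 =>
    rw [S_succ_succ, Nat.cast_add, show k + 2 + 1 = k + 1 + 2 by ring, pow_add _ (k + 1) 2,
      goldenRatio_sq, mul_add, mul_one, ← pow_succ, add_comm]
    gcongr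

lemma exists_S_between {n : ℕ} (hn : 1 ≤ n) : ∃ K, S K ≤ n ∧ n < S (K + 1) := by
  have hex : ∃ k, n < S k := by
    obtain ⟨k, hk⟩ := pow_unbounded_of_one_lt (n : ℝ) one_lt_goldenRatio
    exact ⟨k, by exact_mod_cast hk.trans_le (goldenRatio_pow_le_S k)⟩
  classical
  have hpos : Nat.find hex ≠ 0 := by
    intro h
    have := Nat.find_spec hex
    rw [h, show S 0 = 1 from rfl] at this
    omega
  obtain ⟨K, hK⟩ := Nat.exists_eq_succ_of_ne_zero hpos
  refine ⟨K, not_lt.1 (Nat.find_min hex (by omega)), ?_⟩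
  rw [← Nat.succ_eq_add_one, ← hK]
  exact Nat.find_spec hex

/-- Since $\theta<G$, this is comparable to a geometric sum of ratio larger than $1$, dominated by
its last term. Here the lower bound on `l` is essential. -/
lemma sum_S_div_theta_pow_le (h0 : 0 < l) (h1 : l < 1 / 2) (hG : theta l < goldenRatio) (K : ℕ) :
    ∑ j ∈ Finset.range K, (S j : ℝ) / (1 - 2 * l) * (theta l / theta l ^ j) ≤
      theta l * goldenRatio / (1 - 2 * l) / (goldenRatio / theta l - 1) *
        (goldenRatio / theta l) ^ K := by
  have hth := one_lt_theta h0 h1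
  have h2 : 0 < 1 - 2 * l := by linarith
  have h3 : 0 < goldenRatio / theta l - 1 := sub_pos.2 ((one_lt_div (by positivity)).2 hG)
  have hG0 := goldenRatio_pos
  calc ∑ j ∈ Finset.range K, (S j : ℝ) / (1 - 2 * l) * (theta l / theta l ^ j)
      ≤ ∑ j ∈ Finset.range K, theta l * goldenRatio / (1 - 2 * l) * (goldenRatio / theta l) ^ j := by
        refine Finset.sum_le_sum fun j _ => ?_
        calc (S j : ℝ) / (1 - 2 * l) * (theta l / theta l ^ j)
            ≤ goldenRatio ^ (j + 1) / (1 - 2 * l) * (theta l / theta l ^ j) := by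
              gcongr
              exact S_le_goldenRatio_pow j
          _ = _ := by rw [div_pow goldenRatio, pow_succ]; ring
    _ = theta l * goldenRatio / (1 - 2 * l) * (((goldenRatio / theta l) ^ K - 1) /
          (goldenRatio / theta l - 1)) := by
        rw [← Finset.mul_sum, geom_sum_eq (by linarith)]
    _ ≤ theta l * goldenRatio / (1 - 2 * l) * ((goldenRatio / theta l) ^ K /
          (goldenRatio / theta l - 1)) := by
        gcongr
        linarith
    _ = _ := by ring

lemma goldenRatio_rpow_beta (h0 : 0 < l) (h1 : l < 1 / 2) : goldenRatio ^ beta l = theta l := by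
  have hth := one_lt_theta h0 h1
  have hlog : Real.log goldenRatio ≠ 0 := (Real.log_pos one_lt_goldenRatio).ne'
  rw [Real.rpow_def_of_pos goldenRatio_pos, beta, mul_div_cancel₀ _ hlog]
  exact Real.exp_log (by linarith : 0 < theta l)

lemma beta_pos (h0 : 0 < l) (h1 : l < 1 / 2) : 0 < beta l :=
  div_pos (Real.log_pos (one_lt_theta h0 h1)) (Real.log_pos one_lt_goldenRatio)

lemma goldenRatio_pow_rpow_beta (h0 : 0 < l) (h1 : l < 1 / 2) (k : ℕ) :
    (goldenRatio ^ k) ^ beta l = theta l ^ k := by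
  rw [← Real.rpow_natCast_mul goldenRatio_pos.le, mul_comm, Real.rpow_mul_natCast goldenRatio_pos.le,
    goldenRatio_rpow_beta h0 h1]

/-- $2/(3+\sqrt5)=1/(1+G)$ is the value of `l` at which $\theta=G$. -/
lemma theta_lt_goldenRatio (h0 : 0 < l) (hl : 2 / (3 + √5) < l) : theta l < goldenRatio := by
  rw [theta, div_lt_iff₀ h0, Real.goldenRatio]
  rw [div_lt_iff₀ (by positivity)] at hl
  linarith

lemma ofReal_le_invMeasure_tail (h0 : 0 < l) (h1 : l < 1 / 2) {N : ℕ} {c : ℝ}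
    (h : ENNReal.ofReal (c * mass l 0) ≤ volume (tailSet l N)) :
    ENNReal.ofReal c ≤ invMeasure l {x | N < tau l x} := by
  have hm := mass_pos h0 h1 0
  rw [invMeasure_tail h0 h1, ← mul_inv_cancel_right₀ hm.ne' c, mul_comm _ (mass l 0)⁻¹,
    ENNReal.ofReal_mul (inv_nonneg.2 hm.le), ENNReal.ofReal_inv_of_pos hm]
  gcongr

lemma invMeasure_tail_le_ofReal (h0 : 0 < l) (h1 : l < 1 / 2) {N : ℕ} {c : ℝ}
    (h : volume (tailSet l N) ≤ ENNReal.ofReal (c * mass l 0)) :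
    invMeasure l {x | N < tau l x} ≤ ENNReal.ofReal c := by
  have hm := mass_pos h0 h1 0
  rw [invMeasure_tail h0 h1, ← mul_inv_cancel_right₀ hm.ne' c, mul_comm _ (mass l 0)⁻¹,
    ENNReal.ofReal_mul (inv_nonneg.2 hm.le), ENNReal.ofReal_inv_of_pos hm]
  gcongr

lemma le_invMeasure_real_tail (h0 : 0 < l) (h1 : l < 1 / 2) {n : ℕ} (hn : 1 ≤ n) :
    (theta l - 1) / theta l ^ 2 * (n : ℝ) ^ (-beta l) ≤
      (invMeasure l).real {x | n < tau l x} := by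
  have := (isReinducedMeasure_invMeasure h0 h1).prob
  have hth := one_lt_theta h0 h1
  have hG0 := goldenRatio_pos
  have hn0 : (0 : ℝ) < n := by exact_mod_cast hn
  obtain ⟨K, hK1, hK2⟩ := exists_S_between hn
  -- The level $K+1$ is the first whose Fibonacci number exceeds `n`; together with $\theta^K\le
  -- n^\beta$ it produces the denominator $\theta^2$ of the constant.
  have hle := ofReal_le_invMeasure_tail h0 h1 (le_volume_tailSet h0 h1 (by omega) hK2)
  refine le_trans ?_ ((ENNReal.ofReal_le_iff_le_toReal (measure_ne_top _ _)).1 hle)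
  have hpow : theta l ^ K ≤ (n : ℝ) ^ beta l := by
    rw [← goldenRatio_pow_rpow_beta h0 h1]
    refine Real.rpow_le_rpow (by positivity) ?_ (beta_pos h0 h1).le
    exact (goldenRatio_pow_le_S K).trans (by exact_mod_cast hK1)
  have hnb : 0 < (n : ℝ) ^ beta l := by positivity
  have hden := theta_pow_sub_one_pos h0 h1 (K + 1)
  rw [Real.rpow_neg hn0.le, ← div_eq_mul_inv, div_div]
  refine div_le_div_of_nonneg_left (by linarith) hden ?_
  have : theta l ^ 2 * theta l ^ K ≤ theta l ^ 2 * (n : ℝ) ^ beta l := by gcongr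
  rw [← pow_add, add_comm 2 K] at this
  linarith

lemma invMeasure_real_tail_le (h0 : 0 < l) (h1 : l < 1 / 2) (hG : theta l < goldenRatio) {n : ℕ}
    (hn : 1 ≤ n) :
    (invMeasure l).real {x | n < tau l x} ≤ (theta l ^ 2 + theta l * goldenRatio / (1 - 2 * l) /
      (goldenRatio / theta l - 1) * goldenRatio * theta l) * (n : ℝ) ^ (-beta l) := by
  have hth := one_lt_theta h0 h1
  have hG0 := goldenRatio_pos
  have h2 : 0 < 1 - 2 * l := by linarith
  have h3 : 0 < goldenRatio / theta l - 1 := sub_pos.2 ((one_lt_div (by positivity)).2 hG)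
  have hn0 : (0 : ℝ) < n := by exact_mod_cast hn
  obtain ⟨K, hK1, hK2⟩ := exists_S_between hn
  have hle := invMeasure_tail_le_ofReal h0 h1 (volume_tailSet_le h0 h1 (K + 1) hn)
  have hsum := sum_S_div_theta_pow_le h0 h1 hG (K + 1)
  set B := ∑ j ∈ Finset.range (K + 1), (S j : ℝ) / (1 - 2 * l) * (theta l / theta l ^ j) with hB
  set D := theta l * goldenRatio / (1 - 2 * l) / (goldenRatio / theta l - 1) with hD
  have hD0 : 0 < D := by positivity
  have hB0 : 0 ≤ B := Finset.sum_nonneg fun j _ => by positivity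
  refine (ENNReal.toReal_mono ENNReal.ofReal_ne_top hle).trans ?_
  rw [ENNReal.toReal_ofReal (by positivity), Real.rpow_neg hn0.le]
  -- The choice $S_K\le n<S_{K+1}$ makes $\theta^{-(K+1)}$ at most $\theta n^{-\beta}$, while
  -- $G^{K+1}\le Gn$ cancels the `n` in Markov's inequality.
  have hpow : (n : ℝ) ^ beta l ≤ theta l ^ (K + 2) := by
    rw [← goldenRatio_pow_rpow_beta h0 h1]
    refine Real.rpow_le_rpow hn0.le ?_ (beta_pos h0 h1).le
    exact le_trans (by exact_mod_cast hK2.le) (S_le_goldenRatio_pow (K + 1))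
  have hinv : (theta l ^ (K + 1))⁻¹ ≤ theta l * ((n : ℝ) ^ beta l)⁻¹ := by
    rw [← div_eq_mul_inv, inv_eq_one_div, div_le_div_iff₀ (by positivity) (by positivity), one_mul,
      ← pow_succ']
    exact hpow
  have hGn : goldenRatio ^ (K + 1) ≤ goldenRatio * n := by
    rw [pow_succ']
    gcongr
    exact (goldenRatio_pow_le_S K).trans (by exact_mod_cast hK1)
  have hBn : B / n ≤ D * goldenRatio * (theta l ^ (K + 1))⁻¹ := by
    rw [div_le_iff₀ hn0]
    calc B ≤ D * (goldenRatio / theta l) ^ (K + 1) := hsum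
      _ = D * (theta l ^ (K + 1))⁻¹ * goldenRatio ^ (K + 1) := by rw [div_pow goldenRatio]; ring
      _ ≤ D * (theta l ^ (K + 1))⁻¹ * (goldenRatio * n) := by gcongr
      _ = _ := by ring
  calc theta l / theta l ^ (K + 1) + B / n
      ≤ theta l * (theta l ^ (K + 1))⁻¹ + D * goldenRatio * (theta l ^ (K + 1))⁻¹ := by
        rw [div_eq_mul_inv]; gcongr
    _ = (theta l + D * goldenRatio) * (theta l ^ (K + 1))⁻¹ := by ring
    _ ≤ (theta l + D * goldenRatio) * (theta l * ((n : ℝ) ^ beta l)⁻¹) := by gcongr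
    _ = _ := by ring

end

end FibonacciMap

end

theorem theorem8p12 (l : ℝ) (hl : 2 / (3 + Real.sqrt 5) < l) (hl' : l < 1 / 2) :
    ∃ μ : MeasureTheory.Measure ℝ,
      FibonacciMap.IsReinducedMeasure l μ ∧
      (∀ ν : MeasureTheory.Measure ℝ, FibonacciMap.IsReinducedMeasure l ν → ν = μ) ∧
      ∃ C₁ C₂ : ℝ, 0 < C₂ ∧ C₂ < C₁ ∧ ∀ n : ℕ, 1 ≤ n →
        C₂ * (n : ℝ) ^ (-FibonacciMap.beta l) ≤ μ.real {x | n < FibonacciMap.tau l x} ∧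
        μ.real {x | n < FibonacciMap.tau l x} ≤ C₁ * (n : ℝ) ^ (-FibonacciMap.beta l) := by
  have h0 : 0 < l := lt_trans (by positivity) hl
  have hG := FibonacciMap.theta_lt_goldenRatio h0 hl
  have hth := FibonacciMap.one_lt_theta h0 hl'
  have hC₂ : 0 < (FibonacciMap.theta l - 1) / FibonacciMap.theta l ^ 2 :=
    div_pos (by linarith) (by positivity)
  obtain ⟨C, hC⟩ : ∃ C : ℝ, ∀ n : ℕ, 1 ≤ n → (FibonacciMap.invMeasure l).real
      {x | n < FibonacciMap.tau l x} ≤ C * (n : ℝ) ^ (-FibonacciMap.beta l) :=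
    ⟨_, fun _ hn => FibonacciMap.invMeasure_real_tail_le h0 hl' hG hn⟩
  -- The maximum and the added `1` only serve to make the upper constant strictly larger than the
  -- lower one.
  refine ⟨FibonacciMap.invMeasure l, FibonacciMap.isReinducedMeasure_invMeasure h0 hl',
    fun ν hν => hν.eq_invMeasure h0 hl', max C ((FibonacciMap.theta l - 1) /
      FibonacciMap.theta l ^ 2) + 1, _, hC₂, lt_of_le_of_lt (le_max_right _ _) (lt_add_one _),
    fun n hn => ⟨FibonacciMap.le_invMeasure_real_tail h0 hl' hn, (hC n hn).trans ?_⟩⟩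
  gcongr
  exact (le_max_left _ _).trans (lt_add_one _).le
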